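/- **Setting.** Let $n\ge 1$ and let $P=\{C_1,\dots,C_m\}$ be an unknown partition of $[n]$ ($m$ is also unknown). Let $|\psi\rangle=|\phi_1\rangle_{C_1}\otimes\cdots\otimes|\phi_m\rangle_{C_m}$ be an $n$-qubit product state whose factors $|\phi_k\rangle$ are unit vectors on the qubits in $C_k$. A state on a set of qubits is *separable* if it is a product of two states across some bipartition of these qubits into two nonempty sets; $|\phi\rangle$ is *$\epsilon$-far from separable* if its trace distance to every separable state on the same qubits is at least $\epsilon$. For even $t=2s$ and $x\in\mathbb Z_2^n$ let $R(x)$ be the unitary on $t$ copies of the $n$-qubit space which applies, to the $j$-th qubits of the $t$ copies, the permutation $(1\,2)(3\,4)\cdots(t-1\;t)$ for every $j$ with $x_j=1$; let $U=\sum_x|x\rangle\langle x|\otimes R(x)$. *Non-adaptive algorithm:* repeat $p$ times: on $t$ fresh copies of $\psi$ run $(H^{\otimes n}\otimes I)\,U\,(H^{\otimes n}\otimes I)\,|0^n\rangle|\psi\rangle^{\otimes t}$ and measure the first (group) register, obtaining $y\in\mathbb Z_2^n$. Then output the partition determined by the nullspace over $\mathbb Z_2$ of the matrix whose rows are the samples: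 $i$ and $j$ are in the same part iff $z_i=z_j$ for all $z$ in the nullspace. *Adaptive algorithm:* the same, except that each round runs $(H^{\otimes n}\otimes I)\,U\,|\Sigma\rangle|\psi\rangle^{\otimes t}$, where $\Sigma\subseteq\mathbb Z_2^n$ is the orthogonal complement of the samples kept so far and $|\Sigma\rangle$ is the uniform superposition over $\Sigma$; a new sample is kept iff it is outside the span of the kept ones, and the nullspace of the kept samples is used at the end. Rounds whose sample is rejected count towards $p$. An *implementation* uses gates $H$, CNOT and controlled-SWAP and ancillas initialized to $|0\rangle$. The circuits for all rounds (given $n$, $t$ and the outcomes so far) and the output (given all outcomes) are computed by two fixed random access machine programs, which do not depend on $n$, $t$ or $\psi$; the running time counts their steps and all gates executed. **Claim.** (a) There are an implementation of the adaptive algorithm and universal constants $c,K$ such that for all $n\ge1$ and $0<\epsilon\le1$, with $t=2\lceil c/\epsilon^2\rceil$ and $p=cn$: each circuit acts on $t\le K/\epsilon^2$ copies and has depth at most $K(n^2+\log(1/\epsilon))$; the total number of copies is $pt\le Kn/\epsilon^2$; the total running time is at most $K(n/\epsilon)^K$; and for every partition $P$ and all factors $\phi_k$ that are $\epsilon$-far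 from separable, the output is $P$ with probability at least $2/3$. (b) There are an implementation of the non-adaptive algorithm and universal constants $c,K$ such that for all $n\ge1$, with $t=2$ and $p=cn$: each circuit acts on two copies and has depth at most $K$; the total number of copies is $2cn=O(n)$; the total running time is at most $Kn^K$; and, for every $f:\mathbb N\to\mathbb N$ with $f(n)=\omega(\log n)$ and every $\delta>0$, for all sufficiently large $n$ and every partition $P$ of $[n]$ all of whose parts have at least $f(n)$ elements, if the factors $\phi_k$ are independent Haar-random states, then with probability at least $1-\delta$ over $\phi_1,\dots,\phi_m$ the algorithm outputs $P$ with probability at least $1-\delta$. -/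

import Mathlib

open MeasureTheory

noncomputable section

namespace HiddenCut

/-! ### Qubit states, separable states, trace distance -/

/-- Bit strings of length `n`, i.e. the group `ℤ₂ⁿ`. -/
abbrev Bits (n : ℕ) : Type := Fin n → ZMod 2

/-- The Hilbert space of the qubits labelled by `Q`; its computational basis is indexed by the
bit assignments `Q → ZMod 2`. A (pure) state is a vector of norm one. -/
abbrev QSpace (Q : Type) : Type := EuclideanSpace ℂ (Q → ZMod 2)

/-- The density matrix `|φ⟩⟨φ|`. -/
def density {Q : Type} (φ : QSpace Q) : Matrix (Q → ZMod 2) (Q → ZMod 2) ℂ :=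
  Matrix.of fun x y => φ x * star (φ y)

/-- The trace norm: the sum of the singular values, i.e. of the square roots of the eigenvalues
of `Mᴴ M`. -/
def traceNorm {ι : Type} [Fintype ι] [DecidableEq ι] (M : Matrix ι ι ℂ) : ℝ :=
  ∑ i, Real.sqrt ((Matrix.isHermitian_conjTranspose_mul_self M).eigenvalues i)

/-- The trace distance of two pure states. -/
def traceDist {Q : Type} [Fintype Q] [DecidableEq Q] (φ χ : QSpace Q) : ℝ :=
  (1 / 2) * traceNorm (density φ - density χ)

/-- `χ` is a product of two states across some nontrivial bipartition of its qubits. -/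
def IsSeparable {Q : Type} [Fintype Q] [DecidableEq Q] (χ : QSpace Q) : Prop :=
  ∃ S : Finset Q, S.Nonempty ∧ Sᶜ.Nonempty ∧
    ∃ (a : QSpace {q // q ∈ S}) (b : QSpace {q // q ∈ Sᶜ}), ‖a‖ = 1 ∧ ‖b‖ = 1 ∧
      ∀ x : Q → ZMod 2, χ x = a (fun q => x q.1) * b (fun q => x q.1)

/-- `φ` has trace distance at least `ε` from every separable state on the same qubits. -/
def FarFromSeparable {Q : Type} [Fintype Q] [DecidableEq Q] (ε : ℝ) (φ : QSpace Q) : Prop :=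
  ∀ χ : QSpace Q, ‖χ‖ = 1 → IsSeparable χ → ε ≤ traceDist φ χ

/-- The qubits in the part `C` of a set partition `P` of `[n]`. -/
abbrev PartQubits {n : ℕ} (P : Finpartition (Finset.univ : Finset (Fin n)))
    (C : {C // C ∈ P.parts}) : Type := {i : Fin n // i ∈ C.1}

/-- The `n`-qubit state `|φ₁⟩_{C₁} ⊗ ⋯ ⊗ |φ_m⟩_{C_m}`. -/
def productState {n : ℕ} (P : Finpartition (Finset.univ : Finset (Fin n)))
    (φ : (C : {C // C ∈ P.parts}) → QSpace (PartQubits P C)) : QSpace (Fin n) :=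
  WithLp.toLp 2 fun x => ∏ C, φ C (fun i => x i.1)

/-- The Haar (uniform) probability measure on the pure states of the qubits `Q`: the normalized
surface measure of the unit sphere. -/
def haarState (Q : Type) [Fintype Q] [DecidableEq Q] :
    Measure (Metric.sphere (0 : QSpace Q) 1) :=
  ((Measure.addHaar : Measure (QSpace Q)).toSphere Set.univ)⁻¹ •
    (Measure.addHaar : Measure (QSpace Q)).toSphere

/-- Independent Haar-random factor states, one for each part of `P`. -/
def haarFactors {n : ℕ} (P : Finpartition (Finset.univ : Finset (Fin n))) :
    Measure ((C : {C // C ∈ P.parts}) → Metric.sphere (0 : QSpace (PartQubits P C)) 1) :=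
  Measure.pi fun C => haarState (PartQubits P C)

/-! ### Quantum circuits -/

/-- Elementary gates: Hadamard, CNOT (control, target), controlled SWAP (control, two targets). -/
inductive Gate (Q : Type) : Type
  | had (q : Q) : Gate Q
  | cnot (a b : Q) : Gate Q
  | cswap (c a b : Q) : Gate Q

/-- The sign `(-1)^b`. -/
def sign (b : ZMod 2) : ℂ := if b = 0 then 1 else -1

namespace Gate

/-- The qubits on which a gate acts. -/
def qubits {Q : Type} : Gate Q → List Q
  | had q => [q]
  | cnot a b => [a, b]
  | cswap c a b => [c, a, b]

/-- The action of a gate on the amplitudes of a state in the computational basis. -/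
def apply {Q : Type} [DecidableEq Q] : Gate Q → ((Q → ZMod 2) → ℂ) → ((Q → ZMod 2) → ℂ)
  | had q, f => fun x =>
      (1 / Real.sqrt 2 : ℂ) * ∑ b : ZMod 2, sign (x q * b) * f (Function.update x q b)
  | cnot a b, f => fun x => f (Function.update x b (x b + x a))
  | cswap c a b, f => fun x => if x c = 1 then f (x ∘ Equiv.swap a b) else f x

/-- A gate as a list of numbers, relative to a numbering of the qubits. -/
def encode {Q : Type} (idx : Q → ℕ) : Gate Q → List ℕ
  | had q => [1, idx q]
  | cnot a b => [2, idx a, idx b]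
  | cswap c a b => [3, idx c, idx a, idx b]

end Gate

/-- A circuit is a sequence of layers of gates. -/
abbrev Circuit (Q : Type) : Type := List (List (Gate Q))

namespace Circuit

/-- The gates of one layer act on distinct qubits, so that they can be applied in parallel. -/
def Valid {Q : Type} (C : Circuit Q) : Prop :=
  ∀ layer ∈ C, (layer.flatMap Gate.qubits).Nodup

/-- The depth: the number of layers. -/
def depth {Q : Type} (C : Circuit Q) : ℕ := C.length

/-- The size: the number of gates. -/
def size {Q : Type} (C : Circuit Q) : ℕ := (C.map List.length).sum

/-- The amplitudes after running a circuit. -/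
def apply {Q : Type} [DecidableEq Q] (C : Circuit Q) (f : (Q → ZMod 2) → ℂ) :
    (Q → ZMod 2) → ℂ :=
  C.flatten.foldl (fun g G => G.apply g) f

/-- The description of a circuit as a list of numbers: its gates in order, with the symbol `0`
at the end of each layer. -/
def encode {Q : Type} (idx : Q → ℕ) (C : Circuit Q) : List ℕ :=
  C.flatMap fun layer => layer.flatMap (Gate.encode idx) ++ [0]

end Circuit

/-! ### Registers and Fourier sampling -/

/-- Labels of `t = 2s` copies of the input state, arranged in `s` pairs. -/
abbrev Copy (s : ℕ) : Type := Fin s × Fin 2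

/-- The qubits of a Fourier sampling circuit: the `n`-qubit group register, `2s` copies of an
`n`-qubit state, and `a` further ancillas. -/
abbrev Qubit (n s a : ℕ) : Type := Fin n ⊕ (Copy s × Fin n) ⊕ Fin a

/-- The numbering of the qubits. -/
def Qubit.index {n s a : ℕ} : Qubit n s a → ℕ
  | Sum.inl i => i
  | Sum.inr (Sum.inl ((r, b), j)) => n + (2 * r + b) * n + j
  | Sum.inr (Sum.inr k) => n + 2 * s * n + k

/-- The amplitudes of `|ψ⟩^{⊗ 2s}`. -/
def copies {n : ℕ} (ψ : QSpace (Fin n)) (s : ℕ) (e : Copy s × Fin n → ZMod 2) : ℂ :=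
  ∏ r, ψ (fun j => e (r, j))

/-- The amplitudes of `|0⟩ ⊗ |ψ⟩^{⊗ 2s} ⊗ |0⟩`. -/
def initialState {n : ℕ} (ψ : QSpace (Fin n)) (s a : ℕ) (x : Qubit n s a → ZMod 2) : ℂ :=
  if (∀ i, x (Sum.inl i) = 0) ∧ (∀ k, x (Sum.inr (Sum.inr k)) = 0) then
    copies ψ s (fun p => x (Sum.inr (Sum.inl p)))
  else 0

/-- The basis label obtained from `e` by exchanging, in each of the columns `j` with `x j = 1`,
the two copies of every pair, i.e. by applying the permutation `(1 2)(3 4)⋯(t-1 t)` there.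
As this is an involution, `R(x) Φ` has the amplitudes `e ↦ Φ (permute x e)`. -/
def permute {n s : ℕ} (x : Bits n) (e : Copy s × Fin n → ZMod 2) : Copy s × Fin n → ZMod 2 :=
  fun p => if x p.2 = 1 then e ((p.1.1, p.1.2 + 1), p.2) else e p

/-- `H^{⊗ n}` on the group register. -/
def hadamardAll {n : ℕ} (g : Bits n → ℂ) (y : Bits n) : ℂ :=
  (1 / Real.sqrt (2 ^ n) : ℂ) * ∑ x, sign (x ⬝ᵥ y) * g x

/-- The amplitudes of `(H^{⊗ n} ⊗ I) U (|g⟩ ⊗ |ψ⟩^{⊗ 2s})`, where `U = ∑ₓ |x⟩⟨x| ⊗ R(x)` is the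
controlled group action. -/
def fourierState {n : ℕ} (g : Bits n → ℂ) (ψ : QSpace (Fin n)) (s : ℕ)
    (y : Bits n) (e : Copy s × Fin n → ZMod 2) : ℂ :=
  hadamardAll (fun x => g x * copies ψ s (permute x e)) y

/-- The basis state `|0ⁿ⟩` of the group register. -/
def zeroState (n : ℕ) (x : Bits n) : ℂ := if x = 0 then 1 else 0

open Classical in
/-- The uniform superposition `|Σ⟩` over a subspace `Σ` of `ℤ₂ⁿ`. -/
def subspaceState {n : ℕ} (V : Submodule (ZMod 2) (Bits n)) (x : Bits n) : ℂ :=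
  if x ∈ V then (1 / Real.sqrt (Nat.card V) : ℂ) else 0

/-- The circuit `C` maps `|0⟩ ⊗ |ψ⟩^{⊗ 2s} ⊗ |0⟩` to `Φ ⊗ |0⟩` with
`Φ = (H^{⊗ n} ⊗ I) U (|g⟩ ⊗ |ψ⟩^{⊗ 2s})`, for every input state. -/
def ImplementsFourier {n s a : ℕ} (C : Circuit (Qubit n s a)) (g : Bits n → ℂ) : Prop :=
  C.Valid ∧ ∀ ψ : QSpace (Fin n), C.apply (initialState ψ s a) = fun x =>
    if ∀ k, x (Sum.inr (Sum.inr k)) = 0 then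
      fourierState g ψ s (fun i => x (Sum.inl i)) (fun p => x (Sum.inr (Sum.inl p)))
    else 0

/-- The Born probability of the outcome `y` when the group register is measured after running `C`
on `|0⟩ ⊗ |ψ⟩^{⊗ 2s} ⊗ |0⟩`. -/
def outcomeProb {n s a : ℕ} (C : Circuit (Qubit n s a)) (ψ : QSpace (Fin n)) (y : Bits n) : ℝ :=
  ∑ x : Qubit n s a → ZMod 2,
    if (fun i => x (Sum.inl i)) = y then ‖C.apply (initialState ψ s a) x‖ ^ 2 else 0

/-! ### Linear algebra over `ℤ₂` -/

/-- The vectors orthogonal to all of `ys`: the nullspace of the matrix with rows `ys`. -/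
def orth {n : ℕ} (ys : List (Bits n)) : Submodule (ZMod 2) (Bits n) where
  carrier := {z | ∀ y ∈ ys, y ⬝ᵥ z = 0}
  add_mem' := by
    intro a b ha hb y hy
    rw [dotProduct_add, ha y hy, hb y hy, add_zero]
  zero_mem' := fun y _ => dotProduct_zero y
  smul_mem' := by
    intro c z hz y hy
    rw [dotProduct_smul, hz y hy, smul_zero]

open Classical in
/-- The samples kept among `ys`, processed in order: a sample is kept if it lies outside the span
of the samples kept before. -/
def kept {n : ℕ} (ys : List (Bits n)) : List (Bits n) :=
  ys.foldl (fun l y => if y ∈ Submodule.span (ZMod 2) {v | v ∈ l} then l else l ++ [y]) []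

/-- The set partition read off from the nullspace `V`: `i` and `j` are in the same part if no
vector of `V` separates them. (If `V` is spanned by the indicator vectors of the parts of a
partition, this is that partition.) It is presented by labelling each `i` by the least member of
its part. -/
def cutLabels {n : ℕ} (V : Submodule (ZMod 2) (Bits n)) (i : Fin n) : ℕ :=
  sInf {k | ∃ j : Fin n, (j : ℕ) = k ∧ ∀ z ∈ V, z j = z i}

/-- The labelling `lab` describes the set partition `P`. -/
def Identifies {n : ℕ} (lab : Fin n → ℕ) (P : Finpartition (Finset.univ : Finset (Fin n))) :
    Prop :=
  ∀ i j, lab i = lab j ↔ P.part i = P.part j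

/-! ### Classical random access machine programs with a step count -/

/-- The memory: arrays of natural numbers, named by natural numbers. -/
abbrev Memory : Type := ℕ → ℕ → ℕ

/-- Expressions: literals, array access, addition, truncated subtraction. -/
inductive Expr : Type
  | lit (k : ℕ) : Expr
  | get (a : ℕ) (i : Expr) : Expr
  | add (e f : Expr) : Expr
  | sub (e f : Expr) : Expr

namespace Expr

/-- The value of an expression. -/
def eval (m : Memory) : Expr → ℕ
  | lit k => k
  | get a i => m a (i.eval m)
  | add e f => e.eval m + f.eval m
  | sub e f => e.eval m - f.eval m

/-- The number of operations in an expression. -/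
def cost : Expr → ℕ
  | lit _ => 1
  | get _ i => i.cost + 1
  | add e f => e.cost + f.cost + 1
  | sub e f => e.cost + f.cost + 1

end Expr

/-- Programs: array assignment `a[i] := e`, sequencing, branching on `e ≠ 0`, and the loop
`while e ≠ 0`. -/
inductive Program : Type
  | set (a : ℕ) (i e : Expr) : Program
  | seq (p q : Program) : Program
  | cond (e : Expr) (p q : Program) : Program
  | loop (e : Expr) (p : Program) : Program

/-- `Exec p m m' T`: started in memory `m`, the program `p` halts in memory `m'` after exactly `T`
steps. -/
inductive Exec : Program → Memory → Memory → ℕ → Prop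
  | set (a : ℕ) (i e : Expr) (m : Memory) :
      Exec (.set a i e) m
        (Function.update m a (Function.update (m a) (i.eval m) (e.eval m)))
        (i.cost + e.cost + 1)
  | seq {p q : Program} {m₁ m₂ m₃ : Memory} {T₁ T₂ : ℕ} :
      Exec p m₁ m₂ T₁ → Exec q m₂ m₃ T₂ → Exec (.seq p q) m₁ m₃ (T₁ + T₂)
  | cond_true {e : Expr} {p q : Program} {m m' : Memory} {T : ℕ} :
      e.eval m ≠ 0 → Exec p m m' T → Exec (.cond e p q) m m' (e.cost + 1 + T)
  | cond_false {e : Expr} {p q : Program} {m m' : Memory} {T : ℕ} :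
      e.eval m = 0 → Exec q m m' T → Exec (.cond e p q) m m' (e.cost + 1 + T)
  | loop_done {e : Expr} {p : Program} {m : Memory} :
      e.eval m = 0 → Exec (.loop e p) m m (e.cost + 1)
  | loop_step {e : Expr} {p : Program} {m₁ m₂ m₃ : Memory} {T₁ T₂ : ℕ} :
      e.eval m₁ ≠ 0 → Exec p m₁ m₂ T₁ → Exec (.loop e p) m₂ m₃ T₂ →
      Exec (.loop e p) m₁ m₃ (e.cost + 1 + T₁ + T₂)

/-- The initial memory: array `0` holds the input, cell `0` of array `1` its length, and all other
cells are zero. -/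
def inputMemory (l : List ℕ) : Memory := fun a i =>
  if a = 0 then l.getD i 0 else if a = 1 ∧ i = 0 then l.length else 0

/-- The output: array `2`, up to the length held in cell `0` of array `3`. -/
def outputList (m : Memory) : List ℕ := (List.range (m 3 0)).map (m 2)

/-- On input `l`, the program halts after exactly `T` steps with output `l'`. -/
def Outputs (p : Program) (l l' : List ℕ) (T : ℕ) : Prop :=
  ∃ m', Exec p (inputMemory l) m' T ∧ outputList m' = l'

/-! ### Hybrid algorithms -/

/-- The classical data available to the controller: `n`, the number `s` of pairs of copies per
circuit, the number of measurement outcomes so far, and the bits of these outcomes. -/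
def controllerInput (n s : ℕ) (ys : List (Bits n)) : List ℕ :=
  n :: s :: ys.length :: ys.flatMap fun y => List.ofFn fun i => (y i).val

/-- A quantum algorithm with classical control. In each round a classical program computes, from
the measurement outcomes `ys` so far, a circuit which is run on `2s` fresh copies of the input
state and after which the group register is measured. At the end a classical program computes
the labelling of a set partition from all outcomes. The two programs are the same for all `n`
and `s`. -/
structure HybridAlgorithm where
  /-- the number of ancillas besides the group register -/
  ancillas : ℕ → ℕ → ℕ
  /-- the circuit run after the outcomes `ys` -/
  circuit : (n s : ℕ) → List (Bits n) → Circuit (Qubit n s (ancillas n s))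
  /-- the labelling that is output after the outcomes `ys` -/
  output : (n s : ℕ) → List (Bits n) → Fin n → ℕ
  /-- the program that computes the circuits -/
  circuitProgram : Program
  /-- the program that computes the output -/
  outputProgram : Program

namespace HybridAlgorithm

/-- The adaptive algorithm: given the kept samples, the group register is prepared in the uniform
superposition `|Σ⟩` over their orthogonal complement `Σ`, the Fourier sampling circuit
`(H^{⊗ n} ⊗ I) U` is run and the group register is measured; the new sample is kept if it is
outside the span of the kept ones. At the end the partition is read off from the nullspace of the
kept samples. -/
def IsAdaptive (A : HybridAlgorithm) : Prop :=
  ∀ (n s : ℕ) (ys : List (Bits n)),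
    ImplementsFourier (A.circuit n s ys) (subspaceState (orth (kept ys))) ∧
    A.output n s ys = cutLabels (orth (kept ys))

/-- The non-adaptive algorithm: in each round `(H^{⊗ n} ⊗ I) U (H^{⊗ n} ⊗ I)` is run on
`|0ⁿ⟩ ⊗ |ψ⟩^{⊗ 2s}`, by the same circuit each time, and the group register is measured. At the end
the partition is read off from the nullspace of all samples. -/
def IsNonadaptive (A : HybridAlgorithm) : Prop :=
  ∀ (n s : ℕ) (ys : List (Bits n)),
    A.circuit n s ys = A.circuit n s [] ∧
    ImplementsFourier (A.circuit n s ys) (hadamardAll (zeroState n)) ∧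
    A.output n s ys = cutLabels (orth ys)

/-- The run with outcomes `ys` takes total time at most `T`: the steps of the classical programs
for all rounds and for the output, plus the number of gates executed in all rounds. -/
def RunsInTime (A : HybridAlgorithm) (n s : ℕ) (ys : List (Bits n)) (T : ℕ) : Prop :=
  ∃ τ : ℕ → ℕ,
    (∀ k < ys.length, Outputs A.circuitProgram (controllerInput n s (ys.take k))
      ((A.circuit n s (ys.take k)).encode Qubit.index) (τ k)) ∧
    Outputs A.outputProgram (controllerInput n s ys) (List.ofFn (A.output n s ys))
      (τ ys.length) ∧
    ∑ k ∈ Finset.range (ys.length + 1), τ k +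
      ∑ k ∈ Finset.range ys.length, (A.circuit n s (ys.take k)).size ≤ T

open Classical in
/-- The probability that, after the outcomes `ys` and `r` further rounds on copies of `ψ`, the
output identifies the partition `P`. -/
def successFrom (A : HybridAlgorithm) {n : ℕ} (s : ℕ) (ψ : QSpace (Fin n))
    (P : Finpartition (Finset.univ : Finset (Fin n))) : ℕ → List (Bits n) → ℝ
  | 0, ys => if Identifies (A.output n s ys) P then 1 else 0
  | r + 1, ys => ∑ y : Bits n,
      outcomeProb (A.circuit n s ys) ψ y * A.successFrom s ψ P r (ys ++ [y])

/-- The probability that the algorithm with `r` rounds, each on `2s` fresh copies of `ψ`,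
identifies the partition `P`. -/
def successProb (A : HybridAlgorithm) {n : ℕ} (r s : ℕ) (ψ : QSpace (Fin n))
    (P : Finpartition (Finset.univ : Finset (Fin n))) : ℝ :=
  A.successFrom s ψ P r []

end HybridAlgorithm

end HiddenCut

end

open HiddenCut

/-!
Both algorithms output the partition given by the nullspace of all samples, since discarding a
sample in the span of the kept ones does not change the nullspace (`orth_kept`).

*Statistics of the samples.* Write `p v` for the overlap of `|ψ⟩|ψ⟩` with the state in which the
qubits `j` with `v j = 1` of the two copies are exchanged; it is the purity of the reduced state of
`ψ` on these qubits. If the group register starts in the uniform superposition over a subspace `V`,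
the outcome `y` satisfies `E[(-1) ^ (y · v)] = p v ^ s` for `v ∈ V` (`sum_sign_mul_outcomeProb`). For
a product state `p` is the product of the purities of the factors (`swapOverlap_productState`). Hence
`p v = 1` if `v` is constant on the parts, and such `v` are orthogonal to every sample; if
`p v ^ s ≤ 2 θ - 1` for all other `v`, then each round leaves such a `v` in the nullspace with
probability at most `θ`, and a union bound over at most `2 ^ n` vectors bounds the failure probability
of `r` rounds by `θ ^ r * 2 ^ n` (`one_sub_successProb_le`).

*Far from separable.* If `φ` is `ε`-far from separable, its overlap with product states has squared
modulus at most `1 - ε ^ 2` (`traceDist_sq_le`), which makes the squared operator norm of the matrix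
of `φ` across any cut, and so the purity, at most `1 - ε ^ 2` (`purity_le_of_far`). With `s ≥ 10 / ε ^ 2`
the value `θ = 6 / 10` is admissible, and `10 n` rounds suffice.

*Haar-random factors.* The defect `1 - purity` is half the sum of the squared `2 × 2` minors of the
matrix of `φ` (`two_mul_one_sub_purity`). These minors can be grouped into families with disjoint
supports that cover all amplitudes (`squareEquiv`). Under a Gaussian measure the minors of one family
are independent, so their sum is linear in the dimension up to an error probability exponentially
small in the dimension; comparing the sphere with the Gaussian measure costs only a factor linear in
the dimension (`sphere_small_le`, `factorial_mul_exp_le`). A union bound over all families and cuts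
shows that all purities are at most a universal constant below one
(`exists_haarState_purity_le`), already for `s = 1`. The failure probability is exponentially
small in the size of the part, so that it stays small after summing over all parts of
superlogarithmic size.

*Implementation.* The classical programs maintain a reduced basis of the nullspace: an array `Z` of
`n` rows, in which a free coordinate `i` has `Z i i = 1` and the other rows vanish (`elim`,
`elim_spec`). The superposition over the nullspace is prepared by Hadamard gates on the free
coordinates followed by CNOT gates. The group register is then copied to `s + 1` rows of ancillas in
logarithmic depth, so that all controlled swaps can be executed in one layer; afterwards the copies
are erased (`implementsFourier_adaptiveCircuit`). Programs are verified with the predicates `Run` and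
`Emits`, and a program whose loops are all bounded by `M` takes at most `Program.bound M` steps, a
polynomial in `M` (`Program.bound_polynomial`).
-/

noncomputable section

namespace HiddenCut

/-! ### Reasoning about random access machine programs -/

/-- The memory after writing `v` to cell `i` of array `a`. -/
def Memory.set (m : Memory) (a i v : ℕ) : Memory :=
  Function.update m a (Function.update (m a) i v)

@[simp] theorem Memory.set_same (m : Memory) (a i v : ℕ) : m.set a i v a i = v := by
  simp [Memory.set]

theorem Memory.set_array (m : Memory) (a i v j : ℕ) :
    m.set a i v a j = if j = i then v else m a j := by
  simp [Memory.set, Function.update_apply]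

theorem Memory.set_of_ne (m : Memory) {a b : ℕ} (h : b ≠ a) (i v : ℕ) : m.set a i v b = m b := by
  simp [Memory.set, h]

namespace Program

/-- The arrays that a program may write to. -/
def writes : Program → List ℕ
  | set a _ _ => [a]
  | seq p q => p.writes ++ q.writes
  | cond _ p q => p.writes ++ q.writes
  | loop _ p => p.writes

/-- An upper bound for the number of steps of a program in which every activation of a loop makes
at most `M` iterations. -/
def bound (M : ℕ) : Program → ℕ
  | set _ i e => i.cost + e.cost + 1
  | seq p q => p.bound M + q.bound M
  | cond e p q => e.cost + 1 + (p.bound M + q.bound M)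
  | loop e p => M * (e.cost + 1 + p.bound M) + (e.cost + 1)

/-- The running time is polynomial in a common bound on all loop counts; loops are nested only to a
depth fixed by the program. -/
theorem bound_polynomial (p : Program) : ∃ K : ℕ, ∀ M : ℕ, 1 ≤ M → p.bound M ≤ K * M ^ K := by
  have mono : ∀ {a K L M : ℕ}, 1 ≤ M → K ≤ L → a ≤ K * M ^ K → a ≤ L * M ^ L := by
    intro a K L M hM hKL h
    exact h.trans (Nat.mul_le_mul hKL (Nat.pow_le_pow_right hM hKL))
  have const : ∀ {a K M : ℕ}, 1 ≤ M → a ≤ K → a ≤ K * M ^ K := by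
    intro a K M hM h
    exact h.trans (Nat.le_mul_of_pos_right _ (Nat.pow_pos hM))
  have add : ∀ {a b K L M : ℕ}, 1 ≤ M → a ≤ K * M ^ K → b ≤ L * M ^ L →
      a + b ≤ (K + L) * M ^ (K + L) := by
    intro a b K L M hM ha hb
    have h1 : a ≤ K * M ^ (K + L) :=
      ha.trans (Nat.mul_le_mul_left _ (Nat.pow_le_pow_right hM (by omega)))
    have h2 : b ≤ L * M ^ (K + L) :=
      hb.trans (Nat.mul_le_mul_left _ (Nat.pow_le_pow_right hM (by omega)))
    rw [add_mul]
    exact add_le_add h1 h2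
  induction p with
  | set a i e => exact ⟨i.cost + e.cost + 1, fun M hM => const hM le_rfl⟩
  | seq p q hp hq =>
    obtain ⟨K, hK⟩ := hp
    obtain ⟨L, hL⟩ := hq
    exact ⟨K + L, fun M hM => add hM (hK M hM) (hL M hM)⟩
  | cond e p q hp hq =>
    obtain ⟨K, hK⟩ := hp
    obtain ⟨L, hL⟩ := hq
    exact ⟨e.cost + 1 + (K + L),
      fun M hM => add hM (const hM le_rfl) (add hM (hK M hM) (hL M hM))⟩
  | loop e p hp =>
    obtain ⟨K, hK⟩ := hp
    refine ⟨(e.cost + 1 + K + 1) + (e.cost + 1), fun M hM => add hM ?_ (const hM le_rfl)⟩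
    have h := add hM (const hM (le_refl (e.cost + 1))) (hK M hM)
    calc M * (e.cost + 1 + p.bound M)
        ≤ M * ((e.cost + 1 + K) * M ^ (e.cost + 1 + K)) := Nat.mul_le_mul_left _ h
      _ = (e.cost + 1 + K) * M ^ (e.cost + 1 + K + 1) := by ring
      _ ≤ _ := Nat.mul_le_mul_right _ (by omega)

end Program

/-- A program changes only the arrays that occur in it as targets. -/
theorem Exec.frame {p : Program} {m m' : Memory} {T : ℕ} (h : Exec p m m' T) :
    ∀ a, a ∉ p.writes → m' a = m a := by
  induction h with
  | set b i e m => intro a ha; simp only [Program.writes, List.mem_singleton] at ha; simp [ha]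
  | seq _ _ h1 h2 =>
    intro a ha
    simp only [Program.writes, List.mem_append, not_or] at ha
    rw [h2 a ha.2, h1 a ha.1]
  | cond_true _ _ h =>
    intro a ha
    simp only [Program.writes, List.mem_append, not_or] at ha
    exact h a ha.1
  | cond_false _ _ h =>
    intro a ha
    simp only [Program.writes, List.mem_append, not_or] at ha
    exact h a ha.2
  | loop_done _ => intro a _; rfl
  | loop_step _ _ _ h1 h2 =>
    intro a ha
    rw [h2 a ha, h1 a ha]

/-- Total correctness with a time bound: started in memory `m`, the program `p` halts within
`p.bound M` steps in a memory satisfying `Q`. -/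
def Run (M : ℕ) (p : Program) (m : Memory) (Q : Memory → Prop) : Prop :=
  ∃ m' T, Exec p m m' T ∧ T ≤ p.bound M ∧ Q m'

namespace Run

variable {M : ℕ} {p q : Program} {m : Memory} {Q R : Memory → Prop}

theorem mono (h : Run M p m R) (hQ : ∀ m', R m' → (∀ a, a ∉ p.writes → m' a = m a) → Q m') :
    Run M p m Q := by
  obtain ⟨m', T, h1, h2, h3⟩ := h
  exact ⟨m', T, h1, h2, hQ m' h3 h1.frame⟩

theorem set {a : ℕ} {i e : Expr} (h : Q (m.set a (i.eval m) (e.eval m))) :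
    Run M (.set a i e) m Q :=
  ⟨_, _, Exec.set a i e m, le_rfl, h⟩

theorem seq (h : Run M p m R)
    (h' : ∀ m', R m' → (∀ a, a ∉ p.writes → m' a = m a) → Run M q m' Q) :
    Run M (.seq p q) m Q := by
  obtain ⟨m', T, h1, h2, h3⟩ := h
  obtain ⟨m'', T', h4, h5, h6⟩ := h' m' h3 h1.frame
  exact ⟨m'', T + T', h1.seq h4, Nat.add_le_add h2 h5, h6⟩

theorem cond {e : Expr} (h1 : e.eval m ≠ 0 → Run M p m Q) (h2 : e.eval m = 0 → Run M q m Q) :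
    Run M (.cond e p q) m Q := by
  by_cases he : e.eval m = 0
  · obtain ⟨m', T, h3, h4, h5⟩ := h2 he
    exact ⟨m', _, Exec.cond_false he h3, by simp only [Program.bound]; omega, h5⟩
  · obtain ⟨m', T, h3, h4, h5⟩ := h1 he
    exact ⟨m', _, Exec.cond_true he h3, by simp only [Program.bound]; omega, h5⟩

end Run

/-- The scalar variable held in cell `0` of array `x`. -/
def Expr.var (x : ℕ) : Expr := .get x (.lit 0)

@[simp] theorem Expr.eval_var (m : Memory) (x : ℕ) : (Expr.var x).eval m = m x 0 := rfl

/-- Assignment to a scalar variable. -/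
def Program.assign (x : ℕ) (e : Expr) : Program := .set x (.lit 0) e

/-- The loop `for x := 0 to b - 1`. -/
def Program.forLoop (x b : ℕ) (body : Program) : Program :=
  .seq (.assign x (.lit 0))
    (.loop (.sub (.var b) (.var x)) (.seq body (.assign x (.add (.var x) (.lit 1)))))

/-- The invariant rule for `for` loops. Arrays that the body does not write to are known to be
unchanged, so that the invariant `I` need not mention them. -/
theorem Run.forLoop {M : ℕ} {x b : ℕ} {body : Program} {m : Memory} {N : ℕ} {Q : Memory → Prop}
    (I : ℕ → Memory → Prop) (hN : m b 0 = N) (hM : N ≤ M)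
    (hx : x ∉ body.writes) (hb : b ∉ body.writes) (hxb : b ≠ x)
    (stable : ∀ k m' v, I k m' → I k (m'.set x 0 v))
    (init : I 0 m)
    (step : ∀ k < N, ∀ m', I k m' → m' x 0 = k → (∀ a, a ≠ x → a ∉ body.writes → m' a = m a) →
      Run M body m' (I (k + 1)))
    (post : ∀ m', I N m' → (∀ a, a ≠ x → a ∉ body.writes → m' a = m a) → Q m') :
    Run M (.forLoop x b body) m Q := by
  have key : ∀ r k m', k + r = N → I k m' → m' x 0 = k →
      (∀ a, a ≠ x → a ∉ body.writes → m' a = m a) →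
      ∃ m'' T, Exec (.loop (.sub (.var b) (.var x))
          (.seq body (.assign x (.add (.var x) (.lit 1))))) m' m'' T ∧
        T ≤ r * (6 + (body.bound M + 6)) + 6 ∧ Q m'' := by
    intro r
    induction r with
    | zero =>
      intro k m' hk hI hx' hfr
      have hkN : k = N := by omega
      subst hkN
      refine ⟨m', 6, Exec.loop_done ?_, by simp, post m' hI hfr⟩
      simp [Expr.eval, hx', hfr b hxb hb, hN]
    | succ r ih =>
      intro k m' hk hI hx' hfr
      obtain ⟨m1, T1, he1, hT1, hI1⟩ := step k (by omega) m' hI hx' hfr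
      have hfr1 : ∀ a, a ≠ x → a ∉ body.writes → m1 a = m a := fun a h1 h2 => by
        rw [he1.frame a h2, hfr a h1 h2]
      have hx1 : m1 x 0 = k := by rw [he1.frame x hx, hx']
      obtain ⟨m2, T2, he2, hT2, hQ⟩ := ih (k + 1) (m1.set x 0 (k + 1)) (by omega)
        (stable _ _ _ hI1) (by simp)
        (fun a h1 h2 => by rw [Memory.set_of_ne _ h1, hfr1 a h1 h2])
      have he3 : Exec (.assign x (.add (.var x) (.lit 1))) m1 (m1.set x 0 (k + 1)) 6 := by
        have := Exec.set x (.lit 0) (.add (.var x) (.lit 1)) m1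
        simpa [Expr.eval, hx1, Expr.var, Expr.cost, Memory.set, Program.assign] using this
      refine ⟨m2, _, Exec.loop_step ?_ (he1.seq he3) he2, ?_, hQ⟩
      · simp [Expr.eval, hx', hfr b hxb hb, hN]; omega
      · simp only [Expr.cost, Expr.var]
        rw [Nat.succ_mul]; omega
  have he0 : Exec (.assign x (.lit 0)) m (m.set x 0 0) 3 := by
    have := Exec.set x (.lit 0) (.lit 0) m
    simpa [Expr.eval, Expr.cost, Memory.set, Program.assign] using this
  obtain ⟨m', T, he, hT, hQ⟩ := key N 0 (m.set x 0 0) (by omega) (stable _ _ _ init) (by simp)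
    (fun a h1 _ => by rw [Memory.set_of_ne _ h1])
  refine ⟨m', _, he0.seq he, ?_, hQ⟩
  have h1 := Nat.mul_le_mul_right (6 + (body.bound M + 6)) hM
  have h2 : (Program.forLoop x b body).bound M = 3 + (M * (6 + (body.bound M + 6)) + 6) := by
    simp only [Program.forLoop, Program.bound, Program.assign, Expr.cost, Expr.var]
  omega

/-! ### Programs that write lists -/

/-- Appends the value of `e` to the output. -/
def Program.emit (e : Expr) : Program :=
  .seq (.set 2 (.var 3) e) (.assign 3 (.add (.var 3) (.lit 1)))

/-- The program appends the list `l` to the output. -/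
def Emits (M : ℕ) (p : Program) (m : Memory) (l : List ℕ) : Prop :=
  Run M p m fun m' => outputList m' = outputList m ++ l

theorem Emits.emit {M : ℕ} {e : Expr} {m : Memory} {v : ℕ} (hv : e.eval m = v) :
    Emits M (.emit e) m [v] := by
  refine Run.seq (R := fun m' => m' = m.set 2 (m 3 0) (e.eval m)) (Run.set rfl) ?_
  rintro m' rfl -
  refine Run.set ?_
  have h3 : (m.set 2 (m 3 0) (e.eval m)) 3 0 = m 3 0 := by rw [Memory.set_of_ne _ (by decide)]
  simp only [outputList, Expr.eval, Expr.eval_var, h3, Memory.set_same]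
  rw [Memory.set_of_ne _ (by decide), List.range_succ, List.map_append]
  congr 1
  · refine List.map_congr_left fun j hj => ?_
    rw [List.mem_range] at hj
    rw [Memory.set_array, if_neg (by omega)]
  · simp [hv]

theorem Emits.seq {M : ℕ} {p q : Program} {m : Memory} {l l' : List ℕ} (h : Emits M p m l)
    (h' : ∀ m', (∀ a, a ∉ p.writes → m' a = m a) → Emits M q m' l') :
    Emits M (.seq p q) m (l ++ l') := by
  refine Run.seq h fun m' hm hfr => Run.mono (h' m' hfr) fun m'' hm' _ => ?_
  rw [hm', hm, List.append_assoc]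

theorem Emits.cond {M : ℕ} {e : Expr} {p q : Program} {m : Memory} {l : List ℕ}
    (h1 : e.eval m ≠ 0 → Emits M p m l) (h2 : e.eval m = 0 → Emits M q m l) :
    Emits M (.cond e p q) m l := Run.cond h1 h2

/-- The program that does nothing of interest. -/
def Program.skip : Program := .assign 15 (.lit 0)

theorem Emits.skip {M : ℕ} {m : Memory} : Emits M .skip m [] := by
  refine Run.set ?_
  simp only [outputList, List.append_nil]
  rw [Memory.set_of_ne _ (by decide), Memory.set_of_ne _ (by decide)]

/-- A loop whose `k`-th iteration appends `f k` appends the concatenation of these lists. -/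
theorem Emits.forLoop {M : ℕ} {x b : ℕ} {body : Program} {m : Memory} {N : ℕ}
    (f : Fin N → List ℕ) (hN : m b 0 = N) (hM : N ≤ M)
    (hx : x ∉ body.writes) (hb : b ∉ body.writes) (hxb : b ≠ x) (hx2 : 2 ≠ x) (hx3 : 3 ≠ x)
    (step : ∀ (k : Fin N) (m' : Memory), m' x 0 = k →
      (∀ a, a ≠ x → a ∉ body.writes → m' a = m a) → Emits M body m' (f k)) :
    Emits M (.forLoop x b body) m ((List.finRange N).flatMap f) := by
  refine Run.forLoop (N := N)
    (fun k m' => outputList m' = outputList m ++ ((List.finRange N).take k).flatMap f)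
    hN hM hx hb hxb ?_ (by simp) ?_ ?_
  · intro k m' v h
    rw [← h]
    simp only [outputList]
    rw [Memory.set_of_ne _ hx2, Memory.set_of_ne _ hx3]
  · intro k hk m' hI hxk hfr
    refine Run.mono (step ⟨k, hk⟩ m' hxk hfr) fun m'' h _ => ?_
    rw [h, hI, List.append_assoc, List.take_succ_eq_append_getElem (by simpa using hk)]
    simp
  · intro m' hI _
    rwa [List.take_of_length_le (by simp)] at hI

theorem Outputs.of_emits {M : ℕ} {p : Program} {l l' : List ℕ}
    (h : Emits M p (inputMemory l) l') : ∃ T, Outputs p l l' T ∧ T ≤ p.bound M := by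
  obtain ⟨m', T, h1, h2, h3⟩ := h
  refine ⟨T, ⟨m', h1, ?_⟩, h2⟩
  rw [h3]
  simp [outputList, inputMemory]

/-! ### Elimination over `ℤ₂` -/

/-- The greatest `i < k` such that row `i` of `Z` is not orthogonal to `y`, or `0` if there is
none. -/
def pivot {n : ℕ} (Z : Fin n → Bits n) (y : Bits n) : ℕ → ℕ
  | 0 => 0
  | k + 1 => if ∃ h : k < n, y ⬝ᵥ Z ⟨k, h⟩ = 1 then k else pivot Z y k

theorem pivot_lt {n : ℕ} (Z : Fin n → Bits n) (y : Bits n) (hn : 0 < n) (k : ℕ) :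
    pivot Z y k < n := by
  induction k with
  | zero => exact hn
  | succ k ih =>
    rw [pivot]
    split_ifs with h
    · exact h.1
    · exact ih

theorem pivot_spec {n : ℕ} (Z : Fin n → Bits n) (y : Bits n) (k : ℕ) {i : Fin n} (hi : i < k)
    (hyi : y ⬝ᵥ Z i = 1) : ∃ h : pivot Z y k < n, y ⬝ᵥ Z ⟨pivot Z y k, h⟩ = 1 := by
  induction k with
  | zero => omega
  | succ k ih =>
    rw [pivot]
    split_ifs with h
    · exact h
    · refine ih (lt_of_le_of_ne (Nat.lt_succ_iff.mp hi) fun hik => h ?_)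
      subst hik
      exact ⟨i.2, hyi⟩

/-- The pivot row. -/
def pivotRow {n : ℕ} (Z : Fin n → Bits n) (y : Bits n) : Bits n :=
  if h : pivot Z y n < n then Z ⟨pivot Z y n, h⟩ else 0

/-- One elimination step: the pivot row is added to all rows that are not orthogonal to `y`,
including itself, which thereby becomes zero. -/
def elimStep {n : ℕ} (Z : Fin n → Bits n) (y : Bits n) : Fin n → Bits n :=
  fun i => Z i + (y ⬝ᵥ Z i) • pivotRow Z y

/-- A spanning system of the common orthogonal complement of the vectors `ys`, found by
elimination starting from the standard basis. -/
def elim {n : ℕ} (ys : List (Bits n)) : Fin n → Bits n :=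
  ys.foldl elimStep fun i => Pi.single i 1

theorem zmod_two_eq_zero_or_one : ∀ x : ZMod 2, x = 0 ∨ x = 1 := by decide

theorem mem_orth_append {n : ℕ} {ys : List (Bits n)} {y z : Bits n} :
    z ∈ orth (ys ++ [y]) ↔ z ∈ orth ys ∧ y ⬝ᵥ z = 0 := by
  change (∀ y' ∈ ys ++ [y], y' ⬝ᵥ z = 0) ↔ (∀ y' ∈ ys, y' ⬝ᵥ z = 0) ∧ y ⬝ᵥ z = 0
  simp [or_imp, forall_and]

/-- A system of rows in reduced form: each nonzero row `i` has a `1` in column `i`, where all other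
rows vanish. -/
def IsReduced {n : ℕ} (Z : Fin n → Bits n) : Prop :=
  ∀ i, Z i = 0 ∨ (Z i i = 1 ∧ ∀ j, j ≠ i → Z j i = 0)

theorem IsReduced.sum_row {n : ℕ} {Z : Fin n → Bits n} (h : IsReduced Z) (i : Fin n) :
    ∑ j, Z i j • Z j = Z i := by
  rcases h i with hi | ⟨hi, -⟩
  · simp [hi]
  · rw [Finset.sum_eq_single i]
    · rw [hi, one_smul]
    · intro j _ hji
      rcases h j with hj | ⟨-, hj⟩
      · rw [hj, smul_zero]
      · rw [hj i (Ne.symm hji), zero_smul]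
    · simp

theorem elimStep_reduced {n : ℕ} {Z : Fin n → Bits n} (h : IsReduced Z) (y : Bits n) :
    IsReduced (elimStep Z y) := by
  by_cases hex : ∃ i, y ⬝ᵥ Z i = 1
  · obtain ⟨i, hi⟩ := hex
    obtain ⟨hp, hyp⟩ := pivot_spec Z y n i.2 hi
    set p : Fin n := ⟨pivot Z y n, hp⟩ with hpdef
    have hrow : pivotRow Z y = Z p := by rw [pivotRow, dif_pos hp]
    intro i
    simp only [elimStep, hrow]
    by_cases hip : i = p
    · left
      rw [hip, hyp, one_smul]
      ext j
      exact CharTwo.add_self_eq_zero _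
    · rcases h i with h0 | ⟨h1, h2⟩
      · left; simp [h0]
      · right
        have hpi : Z p i = 0 := h2 p (Ne.symm hip)
        refine ⟨by simp [h1, hpi], fun j hj => by simp [h2 j hj, hpi]⟩
  · have : elimStep Z y = Z := by
      funext i
      have : y ⬝ᵥ Z i = 0 := by
        rcases zmod_two_eq_zero_or_one (y ⬝ᵥ Z i) with h0 | h1
        · exact h0
        · exact absurd ⟨i, h1⟩ hex
      simp [elimStep, this]
    rwa [this]

/-- Elimination preserves the invariant that `z` lies in the nullspace iff it is the combination of
the rows with its own coordinates as coefficients. If `w` denotes that combination for the old rows,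
the new one is `w + (y ⬝ᵥ w) • pivotRow Z y`. -/
theorem elimStep_mem {n : ℕ} {Z : Fin n → Bits n} {ys : List (Bits n)} (h : IsReduced Z)
    (hZ : ∀ z, z ∈ orth ys ↔ z = ∑ i, z i • Z i) (y z : Bits n) :
    z ∈ orth (ys ++ [y]) ↔ z = ∑ i, z i • elimStep Z y i := by
  set w : Bits n := ∑ i, z i • Z i with hw
  have hyw : y ⬝ᵥ w = ∑ i, z i * (y ⬝ᵥ Z i) := by
    rw [hw, dotProduct_sum]
    simp [dotProduct_smul]
  have hsum : ∑ i, z i • elimStep Z y i = w + (y ⬝ᵥ w) • pivotRow Z y := by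
    rw [hyw, Finset.sum_smul, hw, ← Finset.sum_add_distrib]
    refine Finset.sum_congr rfl fun i _ => ?_
    rw [elimStep, smul_add, smul_smul]
  have hrows : ∀ i, Z i ∈ orth ys := fun i => (hZ _).2 (h.sum_row i).symm
  rw [mem_orth_append, hsum]
  constructor
  · rintro ⟨h1, h2⟩
    have hzw : z = w := (hZ z).1 h1
    rw [← hzw, h2, zero_smul, add_zero]
  · intro hz
    have hr : pivotRow Z y ∈ orth ys := by
      rw [pivotRow]
      split_ifs
      · exact hrows _
      · exact Submodule.zero_mem _
    have hwo : w ∈ orth ys := Submodule.sum_mem _ fun i _ => Submodule.smul_mem _ _ (hrows i)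
    have hzo : z ∈ orth ys := by
      rw [hz]
      exact Submodule.add_mem _ hwo (Submodule.smul_mem _ _ hr)
    have hzw : z = w := (hZ z).1 hzo
    refine ⟨hzo, ?_⟩
    rw [hzw]
    by_cases hex : ∃ i, y ⬝ᵥ Z i = 1
    · obtain ⟨i, hi⟩ := hex
      obtain ⟨hp, hyp⟩ := pivot_spec Z y n i.2 hi
      have hrow : y ⬝ᵥ pivotRow Z y = 1 := by rw [pivotRow, dif_pos hp, hyp]
      have h0 : (y ⬝ᵥ w) • pivotRow Z y = 0 := by
        rw [← hzw] at hz ⊢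
        exact left_eq_add.mp hz
      have := congrArg (fun u => y ⬝ᵥ u) h0
      simpa [dotProduct_smul, hrow] using this
    · rw [hyw]
      refine Finset.sum_eq_zero fun i _ => ?_
      rcases zmod_two_eq_zero_or_one (y ⬝ᵥ Z i) with h0 | h1
      · rw [h0, mul_zero]
      · exact absurd ⟨i, h1⟩ hex

theorem elim_append {n : ℕ} (ys : List (Bits n)) (y : Bits n) :
    elim (ys ++ [y]) = elimStep (elim ys) y := by simp [elim]

/-- The outcome of the elimination. The second part says that the nullspace is the space of fixed
points of a linear projection whose image is spanned by the rows. -/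
theorem elim_spec {n : ℕ} (ys : List (Bits n)) :
    IsReduced (elim ys) ∧ ∀ z, z ∈ orth ys ↔ z = ∑ i, z i • elim ys i := by
  induction ys using List.reverseRecOn with
  | nil =>
    refine ⟨fun i => Or.inr ⟨by simp [elim], fun j hj => by simp [elim, hj.symm]⟩, fun z => ?_⟩
    have : z ∈ orth ([] : List (Bits n)) := fun y hy => by simp at hy
    refine iff_of_true this ?_
    ext j
    simp [elim, Finset.sum_apply, Pi.single_apply]
  | append_singleton ys y ih =>
    rw [elim_append]
    exact ⟨elimStep_reduced ih.1 y, elimStep_mem ih.1 ih.2 y⟩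

/-- The nullspace in terms of its reduced spanning system. -/
theorem mem_orth_iff {n : ℕ} (ys : List (Bits n)) (z : Bits n) :
    z ∈ orth ys ↔ ∀ j, z j = ∑ i, z i * elim ys i j := by
  rw [(elim_spec ys).2 z, funext_iff]
  simp

theorem elim_mem_orth {n : ℕ} (ys : List (Bits n)) (i : Fin n) : elim ys i ∈ orth ys :=
  ((elim_spec ys).2 _).2 ((elim_spec ys).1.sum_row i).symm

/-! ### The elimination program -/

/-- Exclusive or of two bits. -/
def Expr.xor (e f : Expr) : Expr := .add (.sub e f) (.sub f e)

/-- Conjunction of two bits. -/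
def Expr.and (e f : Expr) : Expr := .sub (.lit 1) (.add (.sub (.lit 1) e) (.sub (.lit 1) f))

theorem Expr.eval_xor {m : Memory} {e f : Expr} {x y : ZMod 2} (he : e.eval m = x.val)
    (hf : f.eval m = y.val) : (e.xor f).eval m = (x + y).val := by
  simp only [Expr.xor, Expr.eval, he, hf]
  clear he hf; revert x y; decide

theorem Expr.eval_and {m : Memory} {e f : Expr} {x y : ZMod 2} (he : e.eval m = x.val)
    (hf : f.eval m = y.val) : (e.and f).eval m = (x * y).val := by
  simp only [Expr.and, Expr.eval, he, hf]
  clear he hf; revert x y; decide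

/-- The index of the entry in row `i` and column `j`, computed from a table of row offsets. -/
def Expr.entry (i j : Expr) : Expr := .add (.get 7 i) j

/-- Computes the inner products of all rows with the current sample. -/
def dotsProgram : Program :=
  .forLoop 21 4 (.seq (.set 9 (.var 21) (.lit 0))
    (.forLoop 22 4 (.set 9 (.var 21) (.xor (.get 9 (.var 21))
      (.and (.get 0 (.add (.lit 3) (.entry (.var 20) (.var 22))))
        (.get 8 (.entry (.var 21) (.var 22))))))))

/-- Finds the pivot. -/
def pivotProgram : Program :=
  .seq (.assign 11 (.lit 0))
    (.forLoop 21 4 (.cond (.get 9 (.var 21)) (.assign 11 (.var 21)) (.assign 11 (.var 11))))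

/-- Copies the pivot row. -/
def copyProgram : Program :=
  .forLoop 22 4 (.set 10 (.var 22) (.get 8 (.entry (.var 11) (.var 22))))

/-- Adds the pivot row to the rows that are not orthogonal to the current sample. -/
def addProgram : Program :=
  .forLoop 21 4 (.forLoop 22 4 (.set 8 (.entry (.var 21) (.var 22))
    (.xor (.get 8 (.entry (.var 21) (.var 22))) (.and (.get 9 (.var 21)) (.get 10 (.var 22))))))

/-- Array `8` holds the entries of `Z`, row by row. -/
def HoldsRows {n : ℕ} (Z : Fin n → Bits n) (m : Memory) : Prop :=
  ∀ i j : Fin n, m 8 (i * n + j) = (Z i j).val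

/-- Scalar `4` holds `n` and array `7` the row offsets `k * n` for `k ≤ R`. -/
def HoldsOffsets (n R : ℕ) (m : Memory) : Prop :=
  m 4 0 = n ∧ ∀ k ≤ R, m 7 k = k * n

theorem run_dotsProgram {M n R : ℕ} {Z : Fin n → Bits n} {y : Bits n} {m : Memory} (hM : n ≤ M)
    (hR : n ≤ R) (hoff : HoldsOffsets n R m) (hZ : HoldsRows Z m)
    (hy : ∀ j : Fin n, m 0 (3 + (m 7 (m 20 0) + j)) = (y j).val) :
    Run M dotsProgram m fun m' => ∀ i : Fin n, m' 9 i = (y ⬝ᵥ Z i).val := by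
  refine Run.forLoop (N := n) (fun k m' => ∀ i : Fin n, i < k → m' 9 i = (y ⬝ᵥ Z i).val)
    hoff.1 hM (by decide) (by decide) (by decide) ?_ (by simp) ?_ ?_
  · intro k m' v h
    rwa [Memory.set_of_ne _ (by decide)]
  · intro k hk m1 hI h21 hfr1
    let F : ℕ → ZMod 2 := fun j => if h : j < n then y ⟨j, h⟩ * Z ⟨k, hk⟩ ⟨j, h⟩ else 0
    have hF : y ⬝ᵥ Z ⟨k, hk⟩ = ∑ j ∈ Finset.range n, F j := by
      rw [Finset.sum_range]
      simp [F, dotProduct]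
    refine Run.seq (Run.set rfl) ?_
    rintro m2 rfl hfr2
    refine Run.forLoop (N := n) (fun l m' => m' 9 k = (∑ j ∈ Finset.range l, F j).val ∧
      ∀ i : Fin n, i < k → m' 9 i = (y ⬝ᵥ Z i).val)
      ?_ hM (by decide) (by decide) (by decide) ?_ ?_ ?_ ?_
    · rw [hfr2 4 (by decide), hfr1 4 (by decide) (by decide), hoff.1]
    · intro l m' v h
      rwa [Memory.set_of_ne _ (by decide)]
    · refine ⟨?_, fun i hi => ?_⟩
      · simp [h21, Expr.eval]
      · simp only [Expr.eval_var, h21]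
        rw [Memory.set_array, if_neg hi.ne, hI i hi]
    · rintro l hl m3 ⟨hI1, hI2⟩ h22 hfr3
      have hfr : ∀ a, a ≠ 21 → a ≠ 22 → a ≠ 9 → m3 a = m a := fun a h1 h2 h3 => by
        rw [hfr3 a h2 (by simpa [Program.writes] using h3),
          hfr2 a (by simpa [Program.writes] using h3), hfr1 a h1 ?_]
        simp [Program.writes, Program.forLoop, Program.assign, h2, h3]
      have e21 : m3 21 0 = k := by
        rw [hfr3 21 (by decide) (by decide), hfr2 21 (by decide), h21]
      have hterm : Expr.eval m3 (.xor (.get 9 (.var 21))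
          (.and (.get 0 (.add (.lit 3) (.entry (.var 20) (.var 22))))
          (.get 8 (.entry (.var 21) (.var 22))))) = (∑ j ∈ Finset.range (l + 1), F j).val := by
        rw [Finset.sum_range_succ]
        refine Expr.eval_xor (by simpa [Expr.eval, e21] using hI1) ?_
        have : F l = y ⟨l, hl⟩ * Z ⟨k, hk⟩ ⟨l, hl⟩ := by simp [F, hl]
        rw [this]
        refine Expr.eval_and ?_ ?_
        · have := hy ⟨l, hl⟩
          simpa [Expr.eval, Expr.entry, h22, hfr] using this
        · have := hZ ⟨k, hk⟩ ⟨l, hl⟩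
          simp only [Expr.eval, Expr.entry, Expr.eval_var, h22, e21]
          rw [hfr 8 (by decide) (by decide) (by decide), hfr 7 (by decide) (by decide) (by decide),
            hoff.2 k (by omega), ← this]
      refine Run.set ⟨?_, fun i hi => ?_⟩
      · rw [hterm]
        simp [e21]
      · simp only [Expr.eval_var, e21]
        rw [Memory.set_array, if_neg hi.ne, hI2 i hi]
    · rintro m3 ⟨hI1, hI2⟩ - i hi
      rcases Nat.lt_succ_iff_lt_or_eq.mp hi with h | h
      · exact hI2 i h
      · have : i = ⟨k, hk⟩ := Fin.ext h
        rw [this, hF, ← hI1]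
  · intro m' h _ i
    exact h i i.2

theorem run_pivotProgram {M n : ℕ} {Z : Fin n → Bits n} {y : Bits n} {m : Memory} (hM : n ≤ M)
    (hn : m 4 0 = n) (hd : ∀ i : Fin n, m 9 i = (y ⬝ᵥ Z i).val) :
    Run M pivotProgram m fun m' => m' 11 0 = pivot Z y n := by
  refine Run.seq (Run.set rfl) ?_
  rintro m1 rfl hfr1
  refine Run.forLoop (N := n) (fun k m' => m' 11 0 = pivot Z y k) ?_ hM (by decide) (by decide)
    (by decide) ?_ ?_ ?_ ?_
  · rw [hfr1 4 (by decide), hn]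
  · intro k m' v h
    rwa [Memory.set_of_ne _ (by decide)]
  · simp [Expr.eval, pivot]
  · intro k hk m2 hI h21 hfr2
    have h9 : Expr.eval m2 (.get 9 (.var 21)) = (y ⬝ᵥ Z ⟨k, hk⟩).val := by
      simp only [Expr.eval, Expr.eval_var, h21]
      rw [hfr2 9 (by decide) (by decide), hfr1 9 (by decide), ← hd ⟨k, hk⟩]
    have hval : ∀ x : ZMod 2, x.val ≠ 0 ↔ x = 1 := by decide
    refine Run.cond (fun h => Run.set ?_) (fun h => Run.set ?_)
    · rw [h9, hval] at h
      simp [Expr.eval, pivot, hk, h, h21]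
    · rw [h9] at h
      have h' : ¬ y ⬝ᵥ Z ⟨k, hk⟩ = 1 := fun h1 => (hval _).2 h1 h
      simp [Expr.eval, pivot, hk, h', hI]
  · exact fun m' h _ => h

theorem run_copyProgram {M n R : ℕ} {Z : Fin n → Bits n} {y : Bits n} {m : Memory} (hM : n ≤ M)
    (hR : n ≤ R) (hoff : HoldsOffsets n R m) (hZ : HoldsRows Z m)
    (hp : m 11 0 = pivot Z y n) :
    Run M copyProgram m fun m' => ∀ j : Fin n, m' 10 j = (pivotRow Z y j).val := by
  refine Run.forLoop (N := n) (fun k m' => ∀ j : Fin n, j < k → m' 10 j = (pivotRow Z y j).val)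
    hoff.1 hM (by decide) (by decide) (by decide) ?_ (by simp) ?_ ?_
  · intro k m' v h
    rwa [Memory.set_of_ne _ (by decide)]
  · intro k hk m1 hI h22 hfr
    have hpn := pivot_lt Z y (by omega) n
    have hval : Expr.eval m1 (.get 8 (.entry (.var 11) (.var 22)))
        = (pivotRow Z y ⟨k, hk⟩).val := by
      simp only [Expr.eval, Expr.entry, Expr.eval_var, h22]
      rw [hfr 8 (by decide) (by decide), hfr 7 (by decide) (by decide),
        hfr 11 (by decide) (by decide), hp, hoff.2 _ (by omega), pivotRow, dif_pos hpn,
        ← hZ ⟨_, hpn⟩ ⟨k, hk⟩]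
    refine Run.set fun j hj => ?_
    rw [hval, Expr.eval_var, h22, Memory.set_array]
    split_ifs with h
    · have : j = ⟨k, hk⟩ := Fin.ext h
      rw [this]
    · exact hI j (by omega)
  · exact fun m' h _ j => h j j.2

theorem entry_inj {n : ℕ} {i i' : ℕ} {j j' : Fin n} (h : i * n + j = i' * n + j') :
    i = i' ∧ j = j' := by
  have hn : 0 < n := j.pos
  have h1 : (i * n + j) / n = i := by
    rw [mul_comm, Nat.mul_add_div hn, Nat.div_eq_of_lt j.2, add_zero]
  have h2 : (i' * n + j') / n = i' := by
    rw [mul_comm, Nat.mul_add_div hn, Nat.div_eq_of_lt j'.2, add_zero]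
  have hi : i = i' := by rw [← h1, h, h2]
  subst hi
  exact ⟨rfl, Fin.ext (by omega)⟩

theorem run_addProgram {M n R : ℕ} {Z : Fin n → Bits n} {y : Bits n} {m : Memory} (hM : n ≤ M)
    (hR : n ≤ R) (hoff : HoldsOffsets n R m) (hZ : HoldsRows Z m)
    (hd : ∀ i : Fin n, m 9 i = (y ⬝ᵥ Z i).val)
    (ht : ∀ j : Fin n, m 10 j = (pivotRow Z y j).val) :
    Run M addProgram m (HoldsRows (elimStep Z y)) := by
  refine Run.forLoop (N := n) (fun k m' => ∀ i j : Fin n,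
      m' 8 (i * n + j) = if i < k then (elimStep Z y i j).val else (Z i j).val)
    hoff.1 hM (by decide) (by decide) (by decide) ?_ (fun i j => by simpa using hZ i j) ?_ ?_
  · intro k m' v h
    rwa [Memory.set_of_ne _ (by decide)]
  · intro k hk m1 hI h21 hfr1
    refine Run.forLoop (N := n) (fun l m' => ∀ i j : Fin n,
      m' 8 (i * n + j) = if i < k ∨ (i = k ∧ j < l) then (elimStep Z y i j).val else (Z i j).val)
      ?_ hM (by decide) (by decide) (by decide) ?_ (by simpa using hI) ?_ ?_
    · rw [hfr1 4 (by decide) (by decide), hoff.1]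
    · intro l m' v h
      rwa [Memory.set_of_ne _ (by decide)]
    · intro l hl m2 hI2 h22 hfr2
      have hfr : ∀ a, a ≠ 21 → a ≠ 22 → a ≠ 8 → m2 a = m a := fun a h1 h2 h3 => by
        rw [hfr2 a h2 (by simpa [Program.writes] using h3), hfr1 a h1 ?_]
        simp [Program.writes, Program.forLoop, Program.assign, h2, h3]
      have e21 : m2 21 0 = k := by
        rw [hfr2 21 (by decide) (by decide), h21]
      have hent : Expr.eval m2 (.entry (.var 21) (.var 22)) = k * n + l := by
        simp only [Expr.eval, Expr.entry, Expr.eval_var, h22, e21]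
        rw [hfr 7 (by decide) (by decide) (by decide), hoff.2 k (by omega)]
      have hval : Expr.eval m2 (.xor (.get 8 (.entry (.var 21) (.var 22)))
          (.and (.get 9 (.var 21)) (.get 10 (.var 22))))
          = (elimStep Z y ⟨k, hk⟩ ⟨l, hl⟩).val := by
        have : elimStep Z y ⟨k, hk⟩ ⟨l, hl⟩ =
          Z ⟨k, hk⟩ ⟨l, hl⟩ + (y ⬝ᵥ Z ⟨k, hk⟩) * pivotRow Z y ⟨l, hl⟩ := rfl
        rw [this]
        refine Expr.eval_xor ?_ (Expr.eval_and ?_ ?_)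
        · rw [Expr.eval, hent, hI2 ⟨k, hk⟩ ⟨l, hl⟩, if_neg (by simp)]
        · simp only [Expr.eval, Expr.eval_var, e21]
          rw [hfr 9 (by decide) (by decide) (by decide), ← hd ⟨k, hk⟩]
        · simp only [Expr.eval, Expr.eval_var, h22]
          rw [hfr 10 (by decide) (by decide) (by decide), ← ht ⟨l, hl⟩]
      refine Run.set fun i j => ?_
      rw [hent, hval, Memory.set_array]
      by_cases h : (i : ℕ) = k ∧ (j : ℕ) = l
      · obtain ⟨rfl, rfl⟩ := h
        rw [if_pos rfl, if_pos (Or.inr ⟨rfl, by omega⟩)]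
      · rw [if_neg, hI2 i j]
        · refine if_congr ?_ rfl rfl
          omega
        · intro he
          obtain ⟨h1, h2⟩ := entry_inj (j := j) (j' := ⟨l, hl⟩) he
          exact h ⟨h1, congrArg Fin.val h2⟩
    · intro m2 h _ i j
      rw [h i j]
      refine if_congr ?_ rfl rfl
      have := j.2
      omega
  · intro m' h _ i j
    rw [h i j, if_pos i.2]

/-- Reads the parameters, computes the table of row offsets and performs the elimination for all
samples in the input.

Memory is allocated as follows in all programs below; scalars occupy cell `0` of their array. Array
`0` is the input, arrays `2` and `3` are the output and its length. Arrays: `7` holds the row offsets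
`k * n`, since expressions have no multiplication; `8` the entries of `Z`; `9` the inner products with
the current sample; `10` a copy of the pivot row; `12` the powers of two. Scalars: `4` is `n`; `5` is
`s`; `6` is the number of samples; `11` is the pivot; `13` is `levels s`; `14` is `s + 1`; `15` is the
unused target of `Program.skip`; `16` is the size of the table of offsets, large enough for the index
of every qubit; `17` is the number of rows in a doubling; `19` to `22` are loop counters; `23` to `25`
are the label, the number of mismatches and the column in `labelsProgram`. -/
def eliminationProgram : Program :=
  .seq (.assign 4 (.get 0 (.lit 0))) <| .seq (.assign 5 (.get 0 (.lit 1))) <|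
  .seq (.assign 6 (.get 0 (.lit 2))) <|
  .seq (.assign 16 (.add (.var 4) (.add (.var 6) (.add (.var 5) (.add (.var 5)
    (.add (.var 5) (.lit 10))))))) <|
  .seq (.forLoop 20 16 (.set 7 (.add (.var 20) (.lit 1)) (.add (.get 7 (.var 20)) (.var 4)))) <|
  .seq (.forLoop 20 4 (.set 8 (.entry (.var 20) (.var 20)) (.lit 1))) <|
  .forLoop 20 6 (.seq dotsProgram (.seq pivotProgram (.seq copyProgram addProgram)))

theorem controllerInput_bit {n : ℕ} (s : ℕ) (ys : List (Bits n)) (k : ℕ) (hk : k < ys.length)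
    (j : Fin n) : (controllerInput n s ys).getD (3 + (k * n + j)) 0 = (ys[k] j).val := by
  have key : ∀ (ys : List (Bits n)) (k : ℕ) (hk : k < ys.length),
      (ys.flatMap fun y => List.ofFn fun i => (y i).val).getD (k * n + j) 0 = (ys[k] j).val := by
    intro ys
    induction ys with
    | nil => intro k hk; simp at hk
    | cons y ys ih =>
      intro k hk
      rw [List.flatMap_cons]
      cases k with
      | zero =>
        rw [zero_mul, zero_add, List.getD_append _ _ _ _ (by simp)]
        simp [List.getD_eq_getElem?_getD]
      | succ k =>
        rw [List.getD_append_right _ _ _ _ (by simp [Nat.succ_mul]; omega), List.length_ofFn]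
        have : (k + 1) * n + j - n = k * n + j := by rw [Nat.succ_mul]; omega
        rw [this, ih k (by simpa using hk)]
        simp
  rw [controllerInput, Nat.add_comm 3]
  simp only [List.getD_cons_succ]
  exact key ys k hk

/-- The state of the memory after the elimination for the samples `ys`. -/
structure AfterElimination (n s : ℕ) (ys : List (Bits n)) (m : Memory) : Prop where
  offsets : HoldsOffsets n (n + 3 * s + 10) m
  pairs : m 5 0 = s
  rows : HoldsRows (elim ys) m
  length : m 3 0 = 0
  zero : ∀ a, 11 < a → a < 16 → m a = 0

theorem run_eliminationProgram {M n s : ℕ} {ys : List (Bits n)}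
    (hM : n + ys.length + 3 * s + 10 ≤ M) :
    Run M eliminationProgram (inputMemory (controllerInput n s ys)) (AfterElimination n s ys) := by
  set m₀ := inputMemory (controllerInput n s ys) with hm₀
  have h00 : m₀ 0 0 = n := by simp [hm₀, inputMemory, controllerInput]
  have h01 : m₀ 0 1 = s := by simp [hm₀, inputMemory, controllerInput]
  have h02 : m₀ 0 2 = ys.length := by simp [hm₀, inputMemory, controllerInput]
  have hbit : ∀ (k : ℕ) (hk : k < ys.length) (j : Fin n),
      m₀ 0 (3 + (k * n + j)) = (ys[k] j).val := by
    intro k hk j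
    rw [← controllerInput_bit s ys k hk j]
    simp [hm₀, inputMemory]
  have hzero : ∀ a, 1 < a → m₀ a = 0 := by
    intro a ha
    funext i
    have h1 : a ≠ 0 := by omega
    have h2 : a ≠ 1 := by omega
    simp [hm₀, inputMemory, h1, h2]
  clear_value m₀
  set R := n + ys.length + 3 * s + 10 with hR
  refine Run.seq (Run.set rfl) ?_
  rintro m1 rfl -
  refine Run.seq (Run.set rfl) ?_
  rintro m2 rfl -
  refine Run.seq (Run.set rfl) ?_
  rintro m3 rfl -
  refine Run.seq (Run.set rfl) ?_
  rintro m4 rfl -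
  simp only [Expr.eval, Expr.eval_var, Memory.set_of_ne _ (show (0 : ℕ) ≠ 4 by decide),
    Memory.set_of_ne _ (show (0 : ℕ) ≠ 5 by decide), Memory.set_of_ne _ (show (4 : ℕ) ≠ 5 by decide),
    Memory.set_of_ne _ (show (4 : ℕ) ≠ 6 by decide), Memory.set_of_ne _ (show (5 : ℕ) ≠ 6 by decide),
    Memory.set_same, h00, h01, h02]
  rw [show n + (ys.length + (s + (s + (s + 10)))) = R by omega]
  generalize hm : (((m₀.set 4 0 n).set 5 0 s).set 6 0 ys.length).set 16 0 R = m
  have m4 : m 4 0 = n := by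
    rw [← hm, Memory.set_of_ne _ (by decide), Memory.set_of_ne _ (by decide),
      Memory.set_of_ne _ (by decide), Memory.set_same]
  have m5 : m 5 0 = s := by
    rw [← hm, Memory.set_of_ne _ (by decide), Memory.set_of_ne _ (by decide), Memory.set_same]
  have m6 : m 6 0 = ys.length := by
    rw [← hm, Memory.set_of_ne _ (by decide), Memory.set_same]
  have m16 : m 16 0 = R := by rw [← hm, Memory.set_same]
  have mfr : ∀ a, a ≠ 4 → a ≠ 5 → a ≠ 6 → a ≠ 16 → m a = m₀ a := by
    intro a h1 h2 h3 h4
    rw [← hm, Memory.set_of_ne _ h4, Memory.set_of_ne _ h3, Memory.set_of_ne _ h2,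
      Memory.set_of_ne _ h1]
  clear hm
  -- the row offsets
  refine Run.seq (R := HoldsOffsets n R) ?_ ?_
  · refine Run.forLoop (N := R) (fun k m' => ∀ l ≤ k, m' 7 l = l * n) m16 hM (by decide)
      (by decide) (by decide) ?_ ?_ ?_ ?_
    · intro k m' v h
      rwa [Memory.set_of_ne _ (by decide)]
    · intro l hl
      rw [mfr 7 (by decide) (by decide) (by decide) (by decide), hzero 7 (by decide),
        Nat.le_zero.mp hl, zero_mul, Pi.zero_apply]
    · intro k hk m' hI h20 hfr
      refine Run.set fun l hl => ?_
      simp only [Expr.eval, Expr.eval_var, h20]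
      rw [Memory.set_array, hI k le_rfl, hfr 4 (by decide) (by decide), m4]
      split_ifs with h
      · rw [h, Nat.succ_mul]
      · exact hI l (by omega)
    · intro m' h hfr
      exact ⟨by rw [hfr 4 (by decide) (by decide), m4], h⟩
  intro m1 hoff hfr1
  -- the identity matrix
  refine Run.seq (R := HoldsRows (elim ([] : List (Bits n)))) ?_ ?_
  · refine Run.forLoop (N := n)
      (fun k m' => ∀ i j : Fin n, m' 8 (i * n + j) = if i < k ∧ j = i then 1 else 0)
      hoff.1 (by omega) (by decide) (by decide) (by decide) ?_ ?_ ?_ ?_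
    · intro k m' v h
      rwa [Memory.set_of_ne _ (by decide)]
    · intro i j
      rw [hfr1 8 (by decide), mfr 8 (by decide) (by decide) (by decide) (by decide),
        hzero 8 (by decide)]
      simp
    · intro k hk m' hI h20 hfr
      refine Run.set fun i j => ?_
      have hent : Expr.eval m' (.entry (.var 20) (.var 20)) = k * n + (⟨k, hk⟩ : Fin n) := by
        simp only [Expr.eval, Expr.entry, Expr.eval_var, h20]
        rw [hfr 7 (by decide) (by decide), hoff.2 k (by omega)]
      rw [hent, Memory.set_array, hI i j]
      by_cases h : i = ⟨k, hk⟩ ∧ j = ⟨k, hk⟩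
      · obtain ⟨rfl, rfl⟩ := h
        simp [Expr.eval]
      · rw [if_neg]
        · refine if_congr ?_ rfl rfl
          constructor
          · rintro ⟨h1, h2⟩
            exact ⟨by omega, h2⟩
          · rintro ⟨h1, h2⟩
            refine ⟨lt_of_le_of_ne (by omega) fun h3 => h ⟨Fin.ext h3, ?_⟩, h2⟩
            rw [h2]
            exact Fin.ext h3
        · intro he
          obtain ⟨h1, h2⟩ := entry_inj he
          exact h ⟨Fin.ext h1, h2⟩
    · intro m' h _ i j
      rw [h i j]
      by_cases hij : j = i
      · rcases n with _ | n
        · exact i.elim0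
        · subst hij
          simp only [elim, List.foldl_nil, Pi.single_eq_same, ZMod.val_one]
          rw [if_pos ⟨j.2, trivial⟩]
      · simp [elim, hij]
  intro m2 hZ hfr2
  -- the samples
  have hfr : ∀ a, a ≠ 20 → a ≠ 7 → a ≠ 8 → m2 a = m a := fun a h1 h2 h3 => by
    have e1 : a ∉ (Program.forLoop 20 4
        (.set 8 (.entry (.var 20) (.var 20)) (.lit 1))).writes := by
      simp [Program.forLoop, Program.assign, Program.writes, h1, h3]
    have e2 : a ∉ (Program.forLoop 20 16
        (.set 7 (.add (.var 20) (.lit 1)) (.add (.get 7 (.var 20)) (.var 4)))).writes := by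
      simp [Program.forLoop, Program.assign, Program.writes, h1, h2]
    rw [hfr2 a e1, hfr1 a e2]
  have hoff2 : HoldsOffsets n R m2 := by
    rw [HoldsOffsets, hfr2 4 (by decide), hfr2 7 (by decide)]
    exact hoff
  refine Run.forLoop (N := ys.length) (fun k m' => HoldsRows (elim (ys.take k)) m') ?_ (by omega)
    (by decide) (by decide) (by decide) ?_ (by simpa using hZ) ?_ ?_
  · rw [hfr 6 (by decide) (by decide) (by decide), m6]
  · intro k m' v h i j
    rw [Memory.set_of_ne _ (by decide)]
    exact h i j
  · intro k hk m3 hI h20 hfr3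
    have hoff3 : HoldsOffsets n R m3 := by
      rw [HoldsOffsets, hfr3 4 (by decide) (by decide), hfr3 7 (by decide) (by decide)]
      exact hoff2
    have hin : ∀ j : Fin n, m3 0 (3 + (m3 7 (m3 20 0) + j)) = (ys[k] j).val := by
      intro j
      rw [h20, hoff3.2 k (by omega), hfr3 0 (by decide) (by decide),
        hfr 0 (by decide) (by decide) (by decide),
        mfr 0 (by decide) (by decide) (by decide) (by decide), hbit k hk j]
    refine Run.seq (run_dotsProgram (by omega) (by omega) hoff3 hI hin) ?_
    intro m4 hd hfr4
    have hoff4 : HoldsOffsets n R m4 := by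
      rw [HoldsOffsets, hfr4 4 (by decide), hfr4 7 (by decide)]
      exact hoff3
    have hI4 : HoldsRows (elim (ys.take k)) m4 := by
      rw [HoldsRows, hfr4 8 (by decide)]
      exact hI
    refine Run.seq (run_pivotProgram (by omega) hoff4.1 hd) ?_
    intro m5 hp hfr5
    have hoff5 : HoldsOffsets n R m5 := by
      rw [HoldsOffsets, hfr5 4 (by decide), hfr5 7 (by decide)]
      exact hoff4
    have hI5 : HoldsRows (elim (ys.take k)) m5 := by
      rw [HoldsRows, hfr5 8 (by decide)]
      exact hI4
    refine Run.seq (run_copyProgram (by omega) (by omega) hoff5 hI5 hp) ?_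
    intro m6 ht hfr6
    have hoff6 : HoldsOffsets n R m6 := by
      rw [HoldsOffsets, hfr6 4 (by decide), hfr6 7 (by decide)]
      exact hoff5
    have hI6 : HoldsRows (elim (ys.take k)) m6 := by
      rw [HoldsRows, hfr6 8 (by decide)]
      exact hI5
    have hd6 : ∀ i : Fin n, m6 9 i = (ys[k] ⬝ᵥ elim (ys.take k) i).val := by
      rw [hfr6 9 (by decide), hfr5 9 (by decide)]
      exact hd
    have : elim (ys.take (k + 1)) = elimStep (elim (ys.take k)) ys[k] := by
      rw [List.take_succ_eq_append_getElem hk, elim_append]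
    rw [this]
    exact run_addProgram (by omega) (by omega) hoff6 hI6 hd6 ht
  · intro m3 hI hfr3
    rw [List.take_length] at hI
    refine ⟨⟨?_, ?_⟩, ?_, hI, ?_, ?_⟩
    · rw [hfr3 4 (by decide) (by decide)]
      exact hoff2.1
    · rw [hfr3 7 (by decide) (by decide)]
      intro k hk
      exact hoff2.2 k (by omega)
    · rw [hfr3 5 (by decide) (by decide), hfr 5 (by decide) (by decide) (by decide), m5]
    · rw [hfr3 3 (by decide) (by decide), hfr 3 (by decide) (by decide) (by decide),
        mfr 3 (by decide) (by decide) (by decide) (by decide), hzero 3 (by decide)]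
      rfl
    · intro a h1 h2
      rw [hfr3 a (by omega), hfr a (by omega) (by omega) (by omega),
        mfr a (by omega) (by omega) (by omega) (by omega), hzero a (by omega)]
      simp only [Program.writes, dotsProgram, pivotProgram, copyProgram, addProgram,
        Program.forLoop, Program.assign, List.mem_append, List.mem_singleton]
      omega

/-! ### The program that reads off the partition -/

/-- Writes the label of each element: the least column of the reduced spanning system that agrees
with the column of the element, found by trying all columns in descending order. -/
def labelsProgram : Program :=
  .forLoop 20 4 (.seq (.assign 23 (.var 20)) (.seq
    (.forLoop 21 4 (.seq (.assign 25 (.sub (.var 4) (.add (.var 21) (.lit 1))))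
      (.seq (.assign 24 (.lit 0))
      (.seq (.forLoop 22 4 (.assign 24 (.add (.var 24)
          (.xor (.get 8 (.entry (.var 22) (.var 25))) (.get 8 (.entry (.var 22) (.var 20)))))))
        (.cond (.var 24) (.assign 23 (.var 23)) (.assign 23 (.var 25)))))))
    (.emit (.var 23))))

theorem cutLabels_eq {n : ℕ} (ys : List (Bits n)) (i : Fin n) (k : ℕ) (hk : k < n)
    (hki : ∀ r, elim ys r ⟨k, hk⟩ = elim ys r i)
    (hmin : ∀ j : Fin n, (∀ r, elim ys r j = elim ys r i) → k ≤ j) :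
    cutLabels (orth ys) i = k := by
  have key : ∀ j : Fin n,
      (∀ z ∈ orth ys, z j = z i) ↔ ∀ r, elim ys r j = elim ys r i := by
    intro j
    constructor
    · exact fun h r => h _ (elim_mem_orth ys r)
    · intro h z hz
      rw [mem_orth_iff] at hz
      rw [hz j, hz i]
      simp only [h]
  refine le_antisymm (Nat.sInf_le ⟨⟨k, hk⟩, rfl, (key _).2 hki⟩)
    (le_csInf ⟨k, ⟨k, hk⟩, rfl, (key _).2 hki⟩ ?_)
  rintro _ ⟨j, rfl, hj⟩
  exact hmin j ((key j).1 hj)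

/-- Two elements have the same label iff all vectors in the nullspace agree on them, and it suffices
to compare the rows of `elim ys`, which span the nullspace. -/
theorem emits_labelsProgram {M n s : ℕ} {ys : List (Bits n)} {m : Memory} (hM : n ≤ M)
    (hm : AfterElimination n s ys m) :
    Emits M labelsProgram m ((List.finRange n).flatMap fun i => [cutLabels (orth ys) i]) := by
  have m4 := hm.offsets.1
  refine Emits.forLoop _ m4 hM (by decide) (by decide) (by decide) (by decide) (by decide) ?_
  intro i m1 h20 hfr1
  refine Run.seq (Run.set rfl) ?_
  rintro m2 rfl hfr2
  set m2 := m1.set 23 (Expr.eval m1 (.lit 0)) (Expr.eval m1 (.var 20)) with hm2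
  have o2 : outputList m2 = outputList m1 := by
    simp only [outputList]
    rw [hfr2 3 (by decide), hfr2 2 (by decide)]
  have e23 : m2 23 0 = i := by rw [← h20]; exact Memory.set_same _ _ _ _
  have fr2 : ∀ a, a = 4 ∨ a = 7 ∨ a = 8 → m2 a = m a := by
    rintro a (rfl | rfl | rfl) <;> rw [hfr2 _ (by decide), hfr1 _ (by decide) (by decide)]
  have e20 : m2 20 0 = i := by rw [hfr2 20 (by decide), h20]
  clear_value m2
  refine Run.seq (R := fun m' => m' 23 0 = cutLabels (orth ys) i) ?_ ?_
  -- invariant: the label is a matching column, and least among the matching ones tried so far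
  · refine Run.forLoop (N := n) (fun k m' =>
      (∃ h : m' 23 0 < n, ∀ r, elim ys r ⟨m' 23 0, h⟩ = elim ys r i) ∧
      ∀ j : Fin n, n ≤ j + k → (∀ r, elim ys r j = elim ys r i) → m' 23 0 ≤ j)
      (by rw [fr2 4 (by simp), m4]) hM (by decide) (by decide) (by decide) ?_ ?_ ?_ ?_
    · intro k m' v h
      rwa [Memory.set_of_ne _ (by decide)]
    · refine ⟨⟨by rw [e23]; exact i.2, fun r => ?_⟩, fun j hj => absurd j.2 (by omega)⟩
      congr 1
      exact Fin.ext e23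
    · intro k hk m3 hI h21 hfr3
      set J : Fin n := ⟨n - (k + 1), by omega⟩ with hJ
      refine Run.seq (Run.set rfl) ?_
      rintro m4' rfl hfr4
      set m4 := m3.set 25 (Expr.eval m3 (.lit 0))
        (Expr.eval m3 (.sub (.var 4) (.add (.var 21) (.lit 1)))) with hm4
      have e25 : m4 25 0 = J := by
        rw [hm4]
        simp only [Expr.eval, Expr.eval_var, h21, Memory.set_same]
        rw [hfr3 4 (by decide) (by decide), fr2 4 (by simp), hm.offsets.1]
      clear_value m4
      refine Run.seq (Run.set rfl) ?_
      rintro m5' rfl hfr5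
      set m5 := m4.set 24 (Expr.eval m4 (.lit 0)) (Expr.eval m4 (.lit 0)) with hm5
      have e24 : m5 24 0 = 0 := Memory.set_same _ _ _ _
      clear_value m5
      refine Run.seq (R := fun m' => m' 24 0 = 0 ↔ ∀ r, elim ys r J = elim ys r i) ?_ ?_
      · refine Run.forLoop (N := n)
          (fun k m' => m' 24 0 = 0 ↔ ∀ r : Fin n, r < k → elim ys r J = elim ys r i)
          ?_ hM (by decide) (by decide) (by decide) ?_ ?_ ?_ ?_
        · rw [hfr5 4 (by decide), hfr4 4 (by decide), hfr3 4 (by decide) (by decide),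
            fr2 4 (by simp), hm.offsets.1]
        · intro k m' v h
          rwa [Memory.set_of_ne _ (by decide)]
        · simp [e24]
        · intro l hl m6 hI6 h22 hfr6
          have fr6 : ∀ a, a = 7 ∨ a = 8 → m6 a = m a := by
            rintro a (rfl | rfl) <;>
            rw [hfr6 _ (by decide) (by decide), hfr5 _ (by decide), hfr4 _ (by decide),
              hfr3 _ (by decide) (by decide), fr2 _ (by simp)]
          have f25 : m6 25 0 = J := by
            rw [hfr6 25 (by decide) (by decide), hfr5 25 (by decide), e25]
          have f20 : m6 20 0 = i := by
            rw [hfr6 20 (by decide) (by decide), hfr5 20 (by decide), hfr4 20 (by decide),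
              hfr3 20 (by decide) (by decide), e20]
          have hx : Expr.eval m6 (.xor (.get 8 (.entry (.var 22) (.var 25)))
              (.get 8 (.entry (.var 22) (.var 20)))) =
              (elim ys ⟨l, hl⟩ J + elim ys ⟨l, hl⟩ i).val := by
            refine Expr.eval_xor ?_ ?_
            · simp only [Expr.eval, Expr.entry, Expr.eval_var, h22, f25]
              rw [fr6 8 (by simp), fr6 7 (by simp), hm.offsets.2 l (by omega),
                ← hm.rows ⟨l, hl⟩ J]
            · simp only [Expr.eval, Expr.entry, Expr.eval_var, h22, f20]
              rw [fr6 8 (by simp), fr6 7 (by simp), hm.offsets.2 l (by omega),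
                ← hm.rows ⟨l, hl⟩ i]
          have hxor : ∀ x y : ZMod 2, (x + y).val = 0 ↔ x = y := by decide
          refine Run.set ?_
          rw [Expr.eval, Expr.eval, hx, Expr.eval_var, Memory.set_same, Nat.add_eq_zero_iff, hI6,
            hxor]
          constructor
          · rintro ⟨h1, h2⟩ r hr
            rcases Nat.lt_succ_iff_lt_or_eq.mp hr with h | h
            · exact h1 r h
            · have : r = ⟨l, hl⟩ := Fin.ext h
              rw [this, h2]
          · exact fun h => ⟨fun r hr => h r (by omega), h ⟨l, hl⟩ (by simp)⟩
        · intro m6 h _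
          rw [h]
          exact ⟨fun h r => h r r.2, fun h r _ => h r⟩
      · intro m6 h6 hfr6
        have f23 : m6 23 0 = m3 23 0 := by
          rw [hfr6 23 (by decide), hfr5 23 (by decide), hfr4 23 (by decide)]
        have f25 : m6 25 0 = J := by rw [hfr6 25 (by decide), hfr5 25 (by decide), e25]
        refine Run.cond (fun h => Run.set ?_) (fun h => Run.set ?_)
        · rw [Expr.eval, Memory.set_same, Expr.eval_var, f23]
          refine ⟨hI.1, fun j hj hji => ?_⟩
          by_cases hjJ : j = J
          · rw [hjJ] at hji
            exact absurd (h6.2 hji) h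
          · refine hI.2 j ?_ hji
            have : (j : ℕ) ≠ J := fun h => hjJ (Fin.ext h)
            simp only [hJ] at this
            omega
        · rw [Expr.eval, Memory.set_same, Expr.eval_var, f25]
          refine ⟨⟨J.2, h6.1 h⟩, fun j hj _ => ?_⟩
          simp only [hJ]
          omega
    · rintro m3 ⟨⟨h1, h2⟩, h3⟩ -
      exact (cutLabels_eq ys i _ h1 h2 fun j hj => h3 j (by omega) hj).symm
  · intro m3 h3 hfr3
    refine Run.mono (Emits.emit (v := cutLabels (orth ys) i) (by rw [Expr.eval_var, h3])) ?_
    intro m4 h4 _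
    rw [h4, ← o2]
    congr 1
    simp only [outputList]
    rw [hfr3 3 (by decide), hfr3 2 (by decide)]

/-- The program that computes the labelling that is output. -/
def outputProgram : Program := .seq eliminationProgram labelsProgram

theorem outputs_outputProgram {M n : ℕ} (s : ℕ) (ys : List (Bits n))
    (hM : n + ys.length + 3 * s + 10 ≤ M) :
    ∃ T, Outputs outputProgram (controllerInput n s ys) (List.ofFn (cutLabels (orth ys))) T ∧
      T ≤ outputProgram.bound M := by
  refine Outputs.of_emits (Run.seq (run_eliminationProgram hM) fun m hm _ => ?_)
  refine Run.mono (emits_labelsProgram (by omega) hm) fun m' h _ => ?_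
  rw [h, List.ofFn_eq_map]
  simp [outputList, hm.length, inputMemory, ← List.map_eq_flatMap]

/-! ### The circuits -/

/-- Qubit `j` of the group register. -/
abbrev groupQubit {n s a : ℕ} (j : Fin n) : Qubit n s a := Sum.inl j

/-- Qubit `j` of copy `b` of pair `r`. -/
abbrev copyQubit {n s a : ℕ} (r : Fin s) (b : Fin 2) (j : Fin n) : Qubit n s a :=
  Sum.inr (Sum.inl ((r, b), j))

/-- The ancilla that receives the `r`-th copy of qubit `j` of the group register. -/
abbrev ancillaQubit {n s : ℕ} (r : Fin (s + 1)) (j : Fin n) : Qubit n s ((s + 1) * n) :=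
  Sum.inr (Sum.inr (finProdFinEquiv (r, j)))

/-- Hadamard gates on the whole group register. -/
def hadLayer (n s a : ℕ) : List (Gate (Qubit n s a)) :=
  (List.finRange n).flatMap fun j => [.had (groupQubit j)]

/-- Hadamard gates on the free coordinates of a reduced system of rows. -/
def freeLayer {n : ℕ} (s a : ℕ) (Z : Fin n → Bits n) : List (Gate (Qubit n s a)) :=
  (List.finRange n).flatMap fun j => if Z j j = 1 then [.had (groupQubit j)] else []

/-- CNOT gates that compute the dependent coordinates from the free ones. -/
def dependentLayers {n : ℕ} (s a : ℕ) (Z : Fin n → Bits n) : Circuit (Qubit n s a) :=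
  (List.finRange n).flatMap fun i => (List.finRange n).map fun j =>
    if Z i j = 1 ∧ i ≠ j then [.cnot (groupQubit i) (groupQubit j)] else []

/-- CNOT gates that copy the group register to the first row of ancillas. -/
def copyLayer (n s : ℕ) : List (Gate (Qubit n s ((s + 1) * n))) :=
  (List.finRange n).flatMap fun j => [.cnot (groupQubit j) (ancillaQubit 0 j)]

/-- CNOT gates that copy the first `w` rows of ancillas to the next `w` rows. -/
def doublingLayer (n s w : ℕ) : List (Gate (Qubit n s ((s + 1) * n))) :=
  (List.finRange w).flatMap fun r : Fin w => (List.finRange n).flatMap fun j =>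
    if h : r + w < s + 1 then
      [.cnot (ancillaQubit ⟨r, by omega⟩ j) (ancillaQubit ⟨r + w, h⟩ j)] else []

/-- All controlled swaps at once, each pair of copies being controlled by its own row of
ancillas. -/
def swapLayer (n s : ℕ) : List (Gate (Qubit n s ((s + 1) * n))) :=
  (List.finRange s).flatMap fun r => (List.finRange n).flatMap fun j =>
    [.cswap (ancillaQubit r.castSucc j) (copyQubit r 0 j) (copyQubit r 1 j)]

/-- The number of doublings needed to fill all rows of ancillas. -/
def levels (s : ℕ) : ℕ := Nat.clog 2 (s + 1)

/-- The preparation of the uniform superposition over the span of a reduced system of rows. -/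
def prepareCircuit {n : ℕ} (s a : ℕ) (Z : Fin n → Bits n) : Circuit (Qubit n s a) :=
  [freeLayer s a Z] ++ dependentLayers s a Z

/-- The fan-out of the group register to all rows of ancillas, in logarithmic depth. -/
def fanoutCircuit (n s : ℕ) : Circuit (Qubit n s ((s + 1) * n)) :=
  [copyLayer n s] ++ (List.finRange (levels s)).map fun l : Fin (levels s) => doublingLayer n s (2 ^ (l : ℕ))

/-- The inverse of the fan-out. -/
def faninCircuit (n s : ℕ) : Circuit (Qubit n s ((s + 1) * n)) :=
  ((List.finRange (levels s)).map fun l : Fin (levels s) => doublingLayer n s (2 ^ (levels s - (l + 1)))) ++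
    [copyLayer n s]

/-- The circuit of the adaptive algorithm. -/
def adaptiveCircuit (n s : ℕ) (ys : List (Bits n)) : Circuit (Qubit n s ((s + 1) * n)) :=
  prepareCircuit s _ (elim ys) ++
    (fanoutCircuit n s ++ ([swapLayer n s] ++ (faninCircuit n s ++ [hadLayer n s _])))

/-- Controlled swaps for one pair of copies, controlled by the group register itself. -/
def pairLayer {n s : ℕ} (a : ℕ) (r : Fin s) : List (Gate (Qubit n s a)) :=
  (List.finRange n).flatMap fun j =>
    [.cswap (groupQubit j) (copyQubit r 0 j) (copyQubit r 1 j)]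

/-- The circuit of the non-adaptive algorithm. -/
def nonadaptiveCircuit (n s a : ℕ) : Circuit (Qubit n s a) :=
  [hadLayer n s a] ++ ((List.finRange s).map (pairLayer a) ++ [hadLayer n s a])

/-! ### The programs that write the circuits -/

/-- The number of qubit `j` of copy `b` of pair `r`. -/
def Expr.copyIndex (r j : Expr) (b : ℕ) : Expr :=
  .entry (.add (.lit (1 + b)) (.add r r)) j

/-- The number of the ancilla in row `r` and column `j`. -/
def Expr.ancillaIndex (r j : Expr) : Expr :=
  .entry (.add (.lit 1) (.add (.add (.var 5) (.var 5)) r)) j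

/-- Writes a gate with one argument. -/
def Program.emit₁ (k : ℕ) (e : Expr) : Program := .seq (.emit (.lit k)) (.emit e)

/-- Writes a gate with two arguments. -/
def Program.emit₂ (k : ℕ) (e f : Expr) : Program := .seq (.emit₁ k e) (.emit f)

/-- Writes a gate with three arguments. -/
def Program.emit₃ (k : ℕ) (e f g : Expr) : Program := .seq (.emit₂ k e f) (.emit g)

/-- Writes the end of a layer. -/
def Program.layerEnd (p : Program) : Program := .seq p (.emit (.lit 0))

/-- Writes `hadLayer`. -/
def hadProgram : Program := .layerEnd (.forLoop 21 4 (.emit₁ 1 (.var 21)))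

/-- Writes `freeLayer`. -/
def freeProgram : Program :=
  .layerEnd (.forLoop 21 4 (.cond (.get 8 (.entry (.var 21) (.var 21))) (.emit₁ 1 (.var 21)) .skip))

/-- Writes `dependentLayers`. -/
def dependentProgram : Program :=
  .forLoop 20 4 (.forLoop 21 4 (.layerEnd (.cond (.get 8 (.entry (.var 20) (.var 21)))
    (.cond (.add (.sub (.var 20) (.var 21)) (.sub (.var 21) (.var 20)))
      (.emit₂ 2 (.var 20) (.var 21)) .skip) .skip)))

/-- Writes `copyLayer`. -/
def copyLayerProgram : Program :=
  .layerEnd (.forLoop 21 4 (.emit₂ 2 (.var 21) (.ancillaIndex (.lit 0) (.var 21))))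

/-- Writes `doublingLayer`, for the number of rows held in scalar `17`. -/
def doublingProgram : Program :=
  .layerEnd (.forLoop 20 17 (.forLoop 21 4 (.cond (.sub (.var 14) (.add (.var 20) (.var 17)))
    (.emit₂ 2 (.ancillaIndex (.var 20) (.var 21))
      (.ancillaIndex (.add (.var 20) (.var 17)) (.var 21))) .skip)))

/-- Writes `swapLayer`. -/
def swapProgram : Program :=
  .layerEnd (.forLoop 20 5 (.forLoop 21 4 (.emit₃ 3 (.ancillaIndex (.var 20) (.var 21))
    (.copyIndex (.var 20) (.var 21) 0) (.copyIndex (.var 20) (.var 21) 1))))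

/-- Tabulates the powers of two and computes `levels`. -/
def levelsProgram : Program :=
  .seq (.assign 14 (.add (.var 5) (.lit 1))) <| .seq (.assign 12 (.lit 1)) <|
  .forLoop 20 14 (.seq
    (.set 12 (.add (.var 20) (.lit 1)) (.add (.get 12 (.var 20)) (.get 12 (.var 20))))
    (.cond (.sub (.var 14) (.get 12 (.var 20))) (.assign 13 (.add (.var 20) (.lit 1)))
      (.assign 13 (.var 13))))

/-- Writes `fanoutCircuit`. -/
def fanoutProgram : Program :=
  .seq copyLayerProgram
    (.forLoop 19 13 (.seq (.assign 17 (.get 12 (.var 19))) doublingProgram))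

/-- Writes `faninCircuit`. -/
def faninProgram : Program :=
  .seq (.forLoop 19 13 (.seq
    (.assign 17 (.get 12 (.sub (.var 13) (.add (.var 19) (.lit 1))))) doublingProgram))
    copyLayerProgram

/-- Computes the circuits of the adaptive algorithm. -/
def adaptiveProgram : Program :=
  .seq eliminationProgram (.seq levelsProgram (.seq (.seq freeProgram dependentProgram)
    (.seq fanoutProgram (.seq swapProgram (.seq faninProgram hadProgram)))))

/-- Writes `pairLayer` for each pair. -/
def pairsProgram : Program :=
  .forLoop 20 5 (.layerEnd (.forLoop 21 4 (.emit₃ 3 (.var 21)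
    (.copyIndex (.var 20) (.var 21) 0) (.copyIndex (.var 20) (.var 21) 1))))

/-- Computes the circuits of the non-adaptive algorithm. -/
def nonadaptiveProgram : Program :=
  .seq eliminationProgram (.seq hadProgram (.seq pairsProgram hadProgram))

section Emission

variable {M n s : ℕ} {m : Memory}

theorem Circuit.encode_append {Q : Type} (idx : Q → ℕ) (C D : Circuit Q) :
    (C ++ D).encode idx = C.encode idx ++ D.encode idx := by
  simp [Circuit.encode]

theorem Circuit.encode_map {Q α : Type} (idx : Q → ℕ) (l : List α) (f : α → List (Gate Q)) :
    Circuit.encode idx (l.map f) = l.flatMap fun x => Circuit.encode idx [f x] := by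
  simp [Circuit.encode, List.flatMap_map]

theorem Circuit.encode_flatMap {Q α : Type} (idx : Q → ℕ) (l : List α) (f : α → Circuit Q) :
    Circuit.encode idx (l.flatMap f) = l.flatMap fun x => Circuit.encode idx (f x) := by
  simp [Circuit.encode, List.flatMap_assoc]

theorem Emits.layerEnd {Q : Type} {idx : Q → ℕ} {p : Program} {l : List (Gate Q)}
    (h : Emits M p m (l.flatMap (Gate.encode idx))) :
    Emits M (.layerEnd p) m (Circuit.encode idx [l]) := by
  simp only [Circuit.encode, List.flatMap_cons, List.flatMap_nil, List.append_nil]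
  exact Emits.seq h fun m' _ => Emits.emit rfl

theorem Emits.emit₁ {k : ℕ} {e : Expr} {x : ℕ} (h : ∀ m', (∀ a, a ≠ 2 → a ≠ 3 → m' a = m a) →
    e.eval m' = x) : Emits M (.emit₁ k e) m [k, x] := by
  refine Emits.seq (l := [k]) (Emits.emit rfl) fun m' hm' => Emits.emit (h m' fun a h2 h3 => ?_)
  refine hm' a ?_
  simp [Program.emit, Program.writes, Program.assign, h2, h3]

theorem Emits.emit₂ {k : ℕ} {e f : Expr} {x y : ℕ}
    (h : ∀ m', (∀ a, a ≠ 2 → a ≠ 3 → m' a = m a) → e.eval m' = x ∧ f.eval m' = y) :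
    Emits M (.emit₂ k e f) m [k, x, y] := by
  refine Emits.seq (l := [k, x]) (Emits.emit₁ fun m' hm' => (h m' hm').1) fun m' hm' =>
    Emits.emit (h m' fun a h2 h3 => ?_).2
  refine hm' a ?_
  simp [Program.emit₁, Program.emit, Program.writes, Program.assign, h2, h3]

theorem Emits.emit₃ {k : ℕ} {e f g : Expr} {x y z : ℕ}
    (h : ∀ m', (∀ a, a ≠ 2 → a ≠ 3 → m' a = m a) →
      e.eval m' = x ∧ f.eval m' = y ∧ g.eval m' = z) :
    Emits M (.emit₃ k e f g) m [k, x, y, z] := by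
  refine Emits.seq (l := [k, x, y])
    (Emits.emit₂ fun m' hm' => ⟨(h m' hm').1, (h m' hm').2.1⟩) fun m' hm' =>
    Emits.emit (h m' fun a h2 h3 => ?_).2.2
  refine hm' a ?_
  simp [Program.emit₂, Program.emit₁, Program.emit, Program.writes, Program.assign, h2, h3]

/-- The part of the memory that the programs writing circuits rely on. -/
structure Tables (n s : ℕ) (Z : Fin n → Bits n) (m : Memory) : Prop where
  offsets : HoldsOffsets n (n + 3 * s + 10) m
  pairs : m 5 0 = s
  rows : HoldsRows Z m

/-- The additional part that the fan-out relies on. -/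
structure LevelTables (s : ℕ) (m : Memory) : Prop where
  powers : ∀ l ≤ levels s, m 12 l = 2 ^ l
  levels : m 13 0 = levels s
  rowCount : m 14 0 = s + 1

theorem Tables.congr {Z : Fin n → Bits n} (h : Tables n s Z m) {m' : Memory}
    (h4 : m' 4 = m 4) (h5 : m' 5 = m 5) (h7 : m' 7 = m 7) (h8 : m' 8 = m 8) :
    Tables n s Z m' :=
  ⟨by rw [HoldsOffsets, h4, h7]; exact h.offsets, by rw [h5]; exact h.pairs,
    by rw [HoldsRows, h8]; exact h.rows⟩

theorem LevelTables.congr (h : LevelTables s m) {m' : Memory}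
    (h12 : m' 12 = m 12) (h13 : m' 13 = m 13) (h14 : m' 14 = m 14) :
    LevelTables s m' :=
  ⟨by rw [h12]; exact h.powers, by rw [h13]; exact h.levels, by rw [h14]; exact h.rowCount⟩

theorem Tables.ancillaIndex {Z : Fin n → Bits n} (h : Tables n s Z m) {e f : Expr}
    {r : Fin (s + 1)} {j : Fin n} (he : e.eval m = r) (hf : f.eval m = j) :
    (Expr.ancillaIndex e f).eval m = Qubit.index (ancillaQubit r j : Qubit n s ((s + 1) * n)) := by
  simp only [Expr.ancillaIndex, Expr.entry, Expr.eval, Expr.eval_var, he, hf, h.pairs]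
  rw [h.offsets.2 _ (by omega)]
  simp only [Qubit.index, finProdFinEquiv, Equiv.coe_fn_mk]
  ring

theorem Tables.copyIndex {Z : Fin n → Bits n} (h : Tables n s Z m) {e f : Expr} {a : ℕ}
    {r : Fin s} {b : Fin 2} {j : Fin n} (he : e.eval m = r) (hf : f.eval m = j) :
    (Expr.copyIndex e f b).eval m = Qubit.index (copyQubit r b j : Qubit n s a) := by
  simp only [Expr.copyIndex, Expr.entry, Expr.eval, he, hf]
  rw [h.offsets.2 _ (by omega)]
  simp only [Qubit.index]
  ring

theorem emits_hadProgram {Z : Fin n → Bits n} (h : Tables n s Z m) (hM : n ≤ M) (a : ℕ) :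
    Emits M hadProgram m (Circuit.encode Qubit.index [hadLayer n s a]) := by
  refine Emits.layerEnd ?_
  rw [hadLayer, List.flatMap_assoc]
  refine Emits.forLoop _ h.offsets.1 hM (by decide) (by decide) (by decide) (by decide)
    (by decide) ?_
  intro j m1 h21 hfr
  refine Emits.emit₁ fun m2 hfr2 => ?_
  rw [Expr.eval_var, hfr2 21 (by decide) (by decide), h21]
  rfl

theorem emits_freeProgram {Z : Fin n → Bits n} (h : Tables n s Z m) (hM : n ≤ M) (a : ℕ) :
    Emits M freeProgram m (Circuit.encode Qubit.index [freeLayer s a Z]) := by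
  refine Emits.layerEnd ?_
  rw [freeLayer, List.flatMap_assoc]
  refine Emits.forLoop _ h.offsets.1 hM (by decide) (by decide) (by decide) (by decide)
    (by decide) ?_
  intro j m1 h21 hfr
  have hZ : Expr.eval m1 (.get 8 (.entry (.var 21) (.var 21))) = (Z j j).val := by
    simp only [Expr.eval, Expr.entry, Expr.eval_var, h21]
    rw [hfr 8 (by decide) (by decide), hfr 7 (by decide) (by decide), h.offsets.2 j (by omega)]
    exact h.rows j j
  have hval : ∀ x : ZMod 2, x.val ≠ 0 ↔ x = 1 := by decide
  refine Emits.cond (fun h1 => ?_) (fun h0 => ?_)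
  · rw [hZ, hval] at h1
    rw [if_pos h1]
    refine Emits.emit₁ fun m2 hfr2 => ?_
    rw [Expr.eval_var, hfr2 21 (by decide) (by decide), h21]
    rfl
  · rw [hZ] at h0
    rw [if_neg fun h1 => (hval _).2 h1 h0]
    exact Emits.skip

theorem emits_dependentProgram {Z : Fin n → Bits n} (h : Tables n s Z m) (hM : n ≤ M) (a : ℕ) :
    Emits M dependentProgram m (Circuit.encode Qubit.index (dependentLayers s a Z)) := by
  rw [dependentLayers, Circuit.encode_flatMap]
  refine Emits.forLoop _ h.offsets.1 hM (by decide) (by decide) (by decide) (by decide)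
    (by decide) ?_
  intro i m1 h20 hfr1
  rw [Circuit.encode_map]
  refine Emits.forLoop _ ((hfr1 4 (by decide) (by decide)) ▸ h.offsets.1) hM (by decide)
    (by decide) (by decide) (by decide) (by decide) ?_
  intro j m2 h21 hfr2
  have e20 : m2 20 0 = i := by rw [hfr2 20 (by decide) (by decide), h20]
  have hZ : Expr.eval m2 (.get 8 (.entry (.var 20) (.var 21))) = (Z i j).val := by
    simp only [Expr.eval, Expr.entry, Expr.eval_var, h21, e20]
    rw [hfr2 8 (by decide) (by decide), hfr2 7 (by decide) (by decide),
      hfr1 8 (by decide) (by decide), hfr1 7 (by decide) (by decide), h.offsets.2 i (by omega)]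
    exact h.rows i j
  have hij : Expr.eval m2 (.add (.sub (.var 20) (.var 21)) (.sub (.var 21) (.var 20))) = 0 ↔
      i = j := by
    simp only [Expr.eval, Expr.eval_var, h21, e20, Fin.ext_iff]
    omega
  have hval : ∀ x : ZMod 2, x.val ≠ 0 ↔ x = 1 := by decide
  refine Emits.layerEnd ?_
  refine Emits.cond (fun h1 => Emits.cond (fun h2 => ?_) (fun h2 => ?_)) (fun h0 => ?_)
  · rw [hZ, hval] at h1
    rw [ne_eq, hij] at h2
    rw [if_pos ⟨h1, h2⟩]
    refine Emits.emit₂ fun m3 hfr3 => ?_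
    rw [Expr.eval_var, Expr.eval_var, hfr3 20 (by decide) (by decide),
      hfr3 21 (by decide) (by decide), h21, e20]
    exact ⟨rfl, rfl⟩
  · rw [hij] at h2
    rw [if_neg fun h3 => h3.2 h2]
    exact Emits.skip
  · rw [hZ] at h0
    rw [if_neg fun h1 => (hval _).2 h1.1 h0]
    exact Emits.skip

theorem emits_copyLayerProgram {Z : Fin n → Bits n} (h : Tables n s Z m) (hM : n ≤ M) :
    Emits M copyLayerProgram m (Circuit.encode Qubit.index [copyLayer n s]) := by
  refine Emits.layerEnd ?_
  rw [copyLayer, List.flatMap_assoc]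
  refine Emits.forLoop _ h.offsets.1 hM (by decide) (by decide) (by decide) (by decide)
    (by decide) ?_
  intro j m1 h21 hfr
  refine Emits.emit₂ fun m2 hfr2 => ?_
  have e21 : m2 21 0 = j := by rw [hfr2 21 (by decide) (by decide), h21]
  have ht : Tables n s Z m2 := by
    apply h.congr <;> rw [hfr2 _ (by decide) (by decide), hfr _ (by decide) (by decide)]
  exact ⟨e21, ht.ancillaIndex rfl e21⟩

theorem emits_doublingProgram {Z : Fin n → Bits n} (h : Tables n s Z m) (hl : m 14 0 = s + 1)
    {w : ℕ} (hw : m 17 0 = w) (hM : n ≤ M) (hwM : w ≤ M) :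
    Emits M doublingProgram m (Circuit.encode Qubit.index [doublingLayer n s w]) := by
  refine Emits.layerEnd ?_
  rw [doublingLayer, List.flatMap_assoc]
  refine Emits.forLoop _ hw hwM (by decide) (by decide) (by decide) (by decide)
    (by decide) ?_
  intro r m1 h20 hfr1
  rw [List.flatMap_assoc]
  refine Emits.forLoop _ ((hfr1 4 (by decide) (by decide)) ▸ h.offsets.1) hM (by decide)
    (by decide) (by decide) (by decide) (by decide) ?_
  intro j m2 h21 hfr2
  have e20 : m2 20 0 = r := by rw [hfr2 20 (by decide) (by decide), h20]
  have e17 : m2 17 0 = w := by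
    rw [hfr2 17 (by decide) (by decide), hfr1 17 (by decide) (by decide), hw]
  have e14 : m2 14 0 = s + 1 := by
    rw [hfr2 14 (by decide) (by decide), hfr1 14 (by decide) (by decide), hl]
  have hc : Expr.eval m2 (.sub (.var 14) (.add (.var 20) (.var 17))) = s + 1 - (r + w) := by
    simp only [Expr.eval, Expr.eval_var, e20, e17, e14]
  refine Emits.cond (fun h1 => ?_) (fun h1 => ?_)
  · rw [hc] at h1
    rw [dif_pos (by omega)]
    refine Emits.emit₂ fun m3 hfr3 => ?_
    have ht : Tables n s Z m3 := by
      apply h.congr <;> rw [hfr3 _ (by decide) (by decide), hfr2 _ (by decide) (by decide),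
        hfr1 _ (by decide) (by decide)]
    have f20 : m3 20 0 = r := by rw [hfr3 20 (by decide) (by decide), e20]
    have f21 : m3 21 0 = j := by rw [hfr3 21 (by decide) (by decide), h21]
    have f17 : m3 17 0 = w := by rw [hfr3 17 (by decide) (by decide), e17]
    refine ⟨ht.ancillaIndex f20 f21, ht.ancillaIndex ?_ f21⟩
    simp [Expr.eval, f20, f17]
  · rw [hc] at h1
    rw [dif_neg (by omega)]
    exact Emits.skip

theorem emits_swapProgram {Z : Fin n → Bits n} (h : Tables n s Z m) (hM : n ≤ M) (hsM : s ≤ M) :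
    Emits M swapProgram m (Circuit.encode Qubit.index [swapLayer n s]) := by
  refine Emits.layerEnd ?_
  rw [swapLayer, List.flatMap_assoc]
  refine Emits.forLoop _ h.pairs hsM (by decide) (by decide) (by decide) (by decide)
    (by decide) ?_
  intro r m1 h20 hfr1
  rw [List.flatMap_assoc]
  refine Emits.forLoop _ ((hfr1 4 (by decide) (by decide)) ▸ h.offsets.1) hM (by decide)
    (by decide) (by decide) (by decide) (by decide) ?_
  intro j m2 h21 hfr2
  refine Emits.emit₃ fun m3 hfr3 => ?_
  have ht : Tables n s Z m3 := by
    apply h.congr <;> rw [hfr3 _ (by decide) (by decide), hfr2 _ (by decide) (by decide),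
      hfr1 _ (by decide) (by decide)]
  have f20 : m3 20 0 = r := by
    rw [hfr3 20 (by decide) (by decide), hfr2 20 (by decide) (by decide), h20]
  have f21 : m3 21 0 = j := by rw [hfr3 21 (by decide) (by decide), h21]
  exact ⟨ht.ancillaIndex (r := r.castSucc) f20 f21, ht.copyIndex (b := 0) f20 f21,
    ht.copyIndex (b := 1) f20 f21⟩

theorem emits_pairsProgram {Z : Fin n → Bits n} (h : Tables n s Z m) (hM : n ≤ M) (hsM : s ≤ M)
    (a : ℕ) : Emits M pairsProgram m
      (Circuit.encode Qubit.index ((List.finRange s).map (pairLayer (n := n) a))) := by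
  rw [Circuit.encode_map]
  refine Emits.forLoop _ h.pairs hsM (by decide) (by decide) (by decide) (by decide)
    (by decide) ?_
  intro r m1 h20 hfr1
  refine Emits.layerEnd ?_
  rw [pairLayer, List.flatMap_assoc]
  refine Emits.forLoop _ ((hfr1 4 (by decide) (by decide)) ▸ h.offsets.1) hM (by decide)
    (by decide) (by decide) (by decide) (by decide) ?_
  intro j m2 h21 hfr2
  refine Emits.emit₃ fun m3 hfr3 => ?_
  have ht : Tables n s Z m3 := by
    apply h.congr <;> rw [hfr3 _ (by decide) (by decide), hfr2 _ (by decide) (by decide),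
      hfr1 _ (by decide) (by decide)]
  have f20 : m3 20 0 = r := by
    rw [hfr3 20 (by decide) (by decide), hfr2 20 (by decide) (by decide), h20]
  have f21 : m3 21 0 = j := by rw [hfr3 21 (by decide) (by decide), h21]
  exact ⟨f21, ht.copyIndex (b := 0) f20 f21, ht.copyIndex (b := 1) f20 f21⟩

theorem lt_levels_iff {s l : ℕ} : l < levels s ↔ 2 ^ l < s + 1 :=
  Nat.lt_clog_iff_pow_lt (by decide)

theorem run_levelsProgram (h5 : m 5 0 = s) (h13 : m 13 = 0) (hM : s + 1 ≤ M) :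
    Run M levelsProgram m (LevelTables s) := by
  refine Run.seq (Run.set rfl) ?_
  rintro m1 rfl hfr1
  refine Run.seq (Run.set rfl) ?_
  rintro m2 rfl hfr2
  set m1 := m.set 14 (Expr.eval m (.lit 0)) (Expr.eval m (.add (.var 5) (.lit 1))) with hm1
  set m2 := m1.set 12 (Expr.eval m1 (.lit 0)) (Expr.eval m1 (.lit 1)) with hm2
  have e12 : m2 12 0 = 1 := Memory.set_same _ _ _ _
  have e14 : m2 14 0 = s + 1 := by
    rw [hfr2 14 (by decide), hm1, ← h5]
    exact Memory.set_same _ _ _ _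
  have e13 : m2 13 0 = 0 := by rw [hfr2 13 (by decide), hfr1 13 (by decide), h13]; rfl
  clear_value m1 m2
  refine Run.forLoop (N := s + 1)
    (fun k m' => (∀ l ≤ k, m' 12 l = 2 ^ l) ∧ m' 13 0 = min k (levels s))
    e14 hM (by decide) (by decide) (by decide) ?_ ?_ ?_ ?_
  · intro k m' v h
    rwa [Memory.set_of_ne _ (by decide), Memory.set_of_ne _ (by decide)]
  · refine ⟨fun l hl => ?_, by simp [e13]⟩
    rw [Nat.le_zero.mp hl, e12, pow_zero]
  · rintro k hk m3 ⟨hI1, hI2⟩ h20 hfr3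
    refine Run.seq (Run.set rfl) ?_
    intro m4 hm4 hfr4
    have h12 : ∀ l ≤ k + 1, m4 12 l = 2 ^ l := by
      intro l hl
      rw [← hm4]
      simp only [Expr.eval, Expr.eval_var, h20]
      rw [Memory.set_array, hI1 k le_rfl]
      split_ifs with h
      · rw [h, pow_succ]; ring
      · exact hI1 l (by omega)
    have h20' : m4 20 0 = k := by rw [hfr4 20 (by decide), h20]
    have hc : Expr.eval m4 (.sub (.var 14) (.get 12 (.var 20))) = s + 1 - 2 ^ k := by
      simp only [Expr.eval, Expr.eval_var]
      rw [h20', h12 k (by omega), hfr4 14 (by decide), hfr3 14 (by decide) (by decide), e14]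
    refine Run.cond (fun h1 => Run.set ?_) (fun h1 => Run.set ?_)
    · rw [hc] at h1
      have : k < levels s := lt_levels_iff.2 (by omega)
      rw [Memory.set_of_ne _ (by decide)]
      refine ⟨h12, ?_⟩
      simp only [Expr.eval, Expr.eval_var, h20', Memory.set_same]
      omega
    · rw [hc] at h1
      have : ¬ k < levels s := fun h => by
        have := lt_levels_iff.1 h
        omega
      rw [Memory.set_of_ne _ (by decide)]
      refine ⟨h12, ?_⟩
      simp only [Expr.eval, Expr.eval_var, Memory.set_same]
      rw [hfr4 13 (by decide), hI2]
      omega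
  · rintro m3 ⟨h1, h2⟩ hfr3
    have hle : levels s ≤ s + 1 := by
      by_contra h
      have := lt_levels_iff.1 (not_le.1 h)
      have := @Nat.lt_two_pow_self (s + 1)
      omega
    exact ⟨fun l hl => h1 l (by omega), by omega,
      by rw [hfr3 14 (by decide) (by decide), e14]⟩

theorem emits_fanoutProgram {Z : Fin n → Bits n} (h : Tables n s Z m) (hl : LevelTables s m)
    (hM : n ≤ M) (hsM : s + 1 ≤ M) :
    Emits M fanoutProgram m (Circuit.encode Qubit.index (fanoutCircuit n s)) := by
  rw [fanoutCircuit, Circuit.encode_append, Circuit.encode_map]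
  refine Emits.seq (emits_copyLayerProgram h hM) fun m1 hfr1 => ?_
  have hle : levels s ≤ M := by
    by_contra hlt
    have := lt_levels_iff.1 (not_le.1 hlt)
    have := @Nat.lt_two_pow_self M
    omega
  refine Emits.forLoop _ ((hfr1 13 (by decide)) ▸ hl.levels) hle (by decide)
    (by decide) (by decide) (by decide) (by decide) ?_
  intro l m2 h19 hfr2
  have hpow := lt_levels_iff.1 l.2
  refine Run.seq (Run.set rfl) ?_
  intro m3 hm3 hfr3
  have hval : m3 17 0 = 2 ^ (l : ℕ) := by
    rw [← hm3]
    simp only [Expr.eval, Expr.eval_var, h19, Memory.set_same]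
    rw [hfr2 12 (by decide) (by decide), hfr1 12 (by decide), hl.powers l l.2.le]
  have ht : Tables n s Z m3 := by
    apply h.congr <;> rw [hfr3 _ (by decide), hfr2 _ (by decide) (by decide), hfr1 _ (by decide)]
  have h14 : m3 14 0 = s + 1 := by
    rw [hfr3 14 (by decide), hfr2 14 (by decide) (by decide), hfr1 14 (by decide), hl.rowCount]
  refine Run.mono (emits_doublingProgram ht h14 hval hM (by omega)) fun m4 h4 _ => ?_
  rw [h4, outputList, outputList, hfr3 2 (by decide), hfr3 3 (by decide)]

theorem emits_faninProgram {Z : Fin n → Bits n} (h : Tables n s Z m) (hl : LevelTables s m)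
    (hM : n ≤ M) (hsM : s + 1 ≤ M) :
    Emits M faninProgram m (Circuit.encode Qubit.index (faninCircuit n s)) := by
  rw [faninCircuit, Circuit.encode_append, Circuit.encode_map]
  have hle : levels s ≤ M := by
    by_contra hlt
    have := lt_levels_iff.1 (not_le.1 hlt)
    have := @Nat.lt_two_pow_self M
    omega
  refine Emits.seq ?_ fun m1 hfr1 => emits_copyLayerProgram (h.congr (hfr1 _ (by decide))
    (hfr1 _ (by decide)) (hfr1 _ (by decide)) (hfr1 _ (by decide))) hM
  refine Emits.forLoop _ hl.levels hle (by decide) (by decide) (by decide) (by decide)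
    (by decide) ?_
  intro l m2 h19 hfr2
  have hpow := lt_levels_iff.1 (show levels s - (l + 1) < levels s by omega)
  refine Run.seq (Run.set rfl) ?_
  intro m3 hm3 hfr3
  have hval : m3 17 0 = 2 ^ (levels s - (l + 1)) := by
    rw [← hm3]
    simp only [Expr.eval, Expr.eval_var, h19, Memory.set_same]
    rw [hfr2 12 (by decide) (by decide), hfr2 13 (by decide) (by decide), hl.levels,
      hl.powers _ (by omega)]
  have ht : Tables n s Z m3 := by
    apply h.congr <;> rw [hfr3 _ (by decide), hfr2 _ (by decide) (by decide)]
  have h14 : m3 14 0 = s + 1 := by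
    rw [hfr3 14 (by decide), hfr2 14 (by decide) (by decide), hl.rowCount]
  refine Run.mono (emits_doublingProgram ht h14 hval hM (by omega)) fun m4 h4 _ => ?_
  rw [h4, outputList, outputList, hfr3 2 (by decide), hfr3 3 (by decide)]

theorem outputs_adaptiveProgram (s : ℕ) (ys : List (Bits n))
    (hM : n + ys.length + 3 * s + 10 ≤ M) :
    ∃ T, Outputs adaptiveProgram (controllerInput n s ys)
      ((adaptiveCircuit n s ys).encode Qubit.index) T ∧ T ≤ adaptiveProgram.bound M := by
  refine Outputs.of_emits (Run.seq (run_eliminationProgram hM) fun m hm _ => ?_)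
  refine Run.seq (run_levelsProgram hm.pairs (hm.zero 13 (by decide) (by decide)) (by omega))
    fun m1 hl hfr1 => ?_
  have ht : Tables n s (elim ys) m1 :=
    Tables.congr ⟨hm.offsets, hm.pairs, hm.rows⟩ (hfr1 4 (by decide)) (hfr1 5 (by decide))
      (hfr1 7 (by decide)) (hfr1 8 (by decide))
  have key : Emits M (.seq (.seq freeProgram dependentProgram)
      (.seq fanoutProgram (.seq swapProgram (.seq faninProgram hadProgram)))) m1
      ((adaptiveCircuit n s ys).encode Qubit.index) := by
    simp only [adaptiveCircuit, prepareCircuit, Circuit.encode_append]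
    refine Emits.seq (Emits.seq (emits_freeProgram ht (by omega) _) fun m2 hfr2 =>
      emits_dependentProgram ?_ (by omega) _) fun m3 hfr3 =>
      Emits.seq (emits_fanoutProgram (Z := elim ys) ?_ ?_ (by omega) (by omega)) fun m4 hfr4 =>
      Emits.seq (emits_swapProgram (Z := elim ys) ?_ (by omega) (by omega)) fun m5 hfr5 =>
      Emits.seq (emits_faninProgram (Z := elim ys) ?_ ?_ (by omega) (by omega)) fun m6 hfr6 =>
      emits_hadProgram (Z := elim ys) ?_ (by omega) _
    · apply ht.congr <;> rw [hfr2 _ (by decide)]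
    · apply ht.congr <;> rw [hfr3 _ (by decide)]
    · apply hl.congr <;> rw [hfr3 _ (by decide)]
    · apply ht.congr <;> rw [hfr4 _ (by decide), hfr3 _ (by decide)]
    · apply ht.congr <;> rw [hfr5 _ (by decide), hfr4 _ (by decide), hfr3 _ (by decide)]
    · apply hl.congr <;> rw [hfr5 _ (by decide), hfr4 _ (by decide), hfr3 _ (by decide)]
    · apply ht.congr <;> rw [hfr6 _ (by decide), hfr5 _ (by decide), hfr4 _ (by decide),
        hfr3 _ (by decide)]
  refine Run.mono key fun m' h' _ => ?_
  rw [h']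
  simp [outputList, hfr1 3 (by decide), hm.length, inputMemory]

theorem outputs_nonadaptiveProgram (s a : ℕ) (ys : List (Bits n))
    (hM : n + ys.length + 3 * s + 10 ≤ M) :
    ∃ T, Outputs nonadaptiveProgram (controllerInput n s ys)
      ((nonadaptiveCircuit n s a).encode Qubit.index) T ∧ T ≤ nonadaptiveProgram.bound M := by
  refine Outputs.of_emits (Run.seq (run_eliminationProgram hM) fun m hm _ => ?_)
  have ht : Tables n s (elim ys) m := ⟨hm.offsets, hm.pairs, hm.rows⟩
  have key : Emits M (.seq hadProgram (.seq pairsProgram hadProgram)) m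
      ((nonadaptiveCircuit n s a).encode Qubit.index) := by
    simp only [nonadaptiveCircuit, Circuit.encode_append]
    refine Emits.seq (emits_hadProgram ht (by omega) _) fun m1 hfr1 =>
      Emits.seq (emits_pairsProgram (Z := elim ys) ?_ (by omega) (by omega) _) fun m2 hfr2 =>
      emits_hadProgram (Z := elim ys) ?_ (by omega) _
    · apply ht.congr <;> rw [hfr1 _ (by decide)]
    · apply ht.congr <;> rw [hfr2 _ (by decide), hfr1 _ (by decide)]
  refine Run.mono key fun m' h' _ => ?_
  rw [h']
  simp [outputList, hm.length, inputMemory]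

end Emission

/-! ### The action of reversible layers -/

/-- The permutation of the basis labels by which a CNOT or controlled SWAP gate acts. -/
def Gate.labelMap {Q : Type} [DecidableEq Q] : Gate Q → (Q → ZMod 2) → (Q → ZMod 2)
  | had _, x => x
  | cnot a b, x => Function.update x b (x b + x a)
  | cswap c a b, x => if x c = 1 then x ∘ Equiv.swap a b else x

/-- The gate is not a Hadamard gate. -/
def Gate.IsReversible {Q : Type} : Gate Q → Prop
  | had _ => False
  | _ => True

/-- The action of a list of reversible gates on basis labels. -/
def labelMaps {Q : Type} [DecidableEq Q] (l : List (Gate Q)) (x : Q → ZMod 2) : Q → ZMod 2 :=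
  l.foldr Gate.labelMap x

section Layers

variable {Q : Type} [DecidableEq Q]

theorem Gate.apply_of_isReversible {G : Gate Q} (hG : G.IsReversible) (f : (Q → ZMod 2) → ℂ)
    (x : Q → ZMod 2) : G.apply f x = f (G.labelMap x) := by
  cases G with
  | had q => exact hG.elim
  | cnot a b => rfl
  | cswap c a b =>
    simp only [Gate.apply, Gate.labelMap]
    split_ifs <;> rfl

theorem foldl_apply_of_isReversible {l : List (Gate Q)} (hl : ∀ G ∈ l, G.IsReversible)
    (f : (Q → ZMod 2) → ℂ) (x : Q → ZMod 2) :
    l.foldl (fun g G => G.apply g) f x = f (labelMaps l x) := by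
  induction l generalizing f with
  | nil => rfl
  | cons G l ih =>
    rw [List.foldl_cons, ih fun G' h => hl G' (List.mem_cons_of_mem _ h),
      Gate.apply_of_isReversible (hl G List.mem_cons_self)]
    rfl

theorem Gate.labelMap_of_notMem {G : Gate Q} {q : Q} (hq : q ∉ G.qubits) (x : Q → ZMod 2) :
    G.labelMap x q = x q := by
  cases G with
  | had q => rfl
  | cnot a b =>
    simp only [Gate.qubits, List.mem_cons, List.not_mem_nil, or_false, not_or] at hq
    simp [Gate.labelMap, hq.2]
  | cswap c a b =>
    simp only [Gate.qubits, List.mem_cons, List.not_mem_nil, or_false, not_or] at hq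
    simp only [Gate.labelMap]
    split_ifs
    · simp [Equiv.swap_apply_of_ne_of_ne hq.2.1 hq.2.2]
    · rfl

theorem Gate.labelMap_congr {G : Gate Q} {q : Q} (hq : q ∈ G.qubits) {x y : Q → ZMod 2}
    (h : ∀ q ∈ G.qubits, x q = y q) : G.labelMap x q = G.labelMap y q := by
  cases G with
  | had q => exact h _ hq
  | cnot a b =>
    simp only [Gate.labelMap, Function.update_apply]
    rw [h a (by simp [Gate.qubits]), h b (by simp [Gate.qubits]), h q hq]
  | cswap c a b =>
    have hs : Equiv.swap a b q ∈ (Gate.cswap c a b).qubits := by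
      rw [Equiv.swap_apply_def]
      split_ifs
      · simp [Gate.qubits]
      · simp [Gate.qubits]
      · exact hq
    simp only [Gate.labelMap]
    rw [h c (by simp [Gate.qubits])]
    split_ifs
    · exact h _ hs
    · exact h _ hq

theorem labelMaps_of_notMem {l : List (Gate Q)} {q : Q} (hq : q ∉ l.flatMap Gate.qubits)
    (x : Q → ZMod 2) : labelMaps l x q = x q := by
  induction l with
  | nil => rfl
  | cons G l ih =>
    simp only [List.flatMap_cons, List.mem_append, not_or] at hq
    rw [labelMaps, List.foldr_cons, Gate.labelMap_of_notMem hq.1]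
    exact ih hq.2

/-- As the gates of a layer act on distinct qubits, the new value of a qubit is determined by the
gate acting on it. -/
theorem labelMaps_of_mem {l : List (Gate Q)} (hl : (l.flatMap Gate.qubits).Nodup) {G : Gate Q}
    (hG : G ∈ l) {q : Q} (hq : q ∈ G.qubits) (x : Q → ZMod 2) :
    labelMaps l x q = G.labelMap x q := by
  induction l with
  | nil => simp at hG
  | cons G' l ih =>
    rw [List.flatMap_cons, List.nodup_append'] at hl
    rw [labelMaps, List.foldr_cons]
    change G'.labelMap (labelMaps l x) q = _
    rcases List.mem_cons.1 hG with rfl | hG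
    · exact Gate.labelMap_congr hq fun q' hq' =>
        labelMaps_of_notMem (fun h => hl.2.2 hq' h) x
    · rw [Gate.labelMap_of_notMem fun h => hl.2.2 h (List.mem_flatMap.2 ⟨G, hG, hq⟩)]
      exact ih hl.2.1 hG

theorem Circuit.apply_append (C D : Circuit Q) (f : (Q → ZMod 2) → ℂ) :
    Circuit.apply (C ++ D) f = Circuit.apply D (Circuit.apply C f) := by
  simp [Circuit.apply]

theorem Circuit.apply_singleton (l : List (Gate Q)) (f : (Q → ZMod 2) → ℂ) :
    Circuit.apply [l] f = l.foldl (fun g G => G.apply g) f := by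
  simp [Circuit.apply]

end Layers

theorem nodup_flatMap_of_injective {α β : Type*} {l : List α} (hl : l.Nodup) {f : α → List β}
    (h1 : ∀ a, (f a).Nodup) (h2 : ∀ a b q, q ∈ f a → q ∈ f b → a = b) : (l.flatMap f).Nodup := by
  rw [List.nodup_flatMap]
  refine ⟨fun a _ => h1 a, hl.imp fun {a b} hab => ?_⟩
  exact fun q hqa hqb => hab (h2 a b q hqa hqb)

/-! ### Validity of the layers -/

section Valid

variable {n s a : ℕ}

theorem hadLayer_nodup : ((hadLayer n s a).flatMap Gate.qubits).Nodup := by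
  rw [hadLayer, List.flatMap_assoc]
  refine nodup_flatMap_of_injective (List.nodup_finRange n) (fun j => by simp [Gate.qubits]) ?_
  intro i j q h1 h2
  simp only [Gate.qubits, List.flatMap_cons, List.flatMap_nil, List.append_nil,
    List.mem_singleton] at h1 h2
  exact Sum.inl_injective (h1.symm.trans h2)

theorem freeLayer_nodup (Z : Fin n → Bits n) :
    ((freeLayer s a Z).flatMap Gate.qubits).Nodup := by
  rw [freeLayer, List.flatMap_assoc]
  refine nodup_flatMap_of_injective (List.nodup_finRange n)
    (fun j => by split_ifs <;> simp [Gate.qubits]) ?_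
  intro i j q h1 h2
  split_ifs at h1 h2 <;> simp [Gate.qubits] at h1 h2
  exact Sum.inl_injective (h1.symm.trans h2)

theorem copyLayer_nodup : ((copyLayer n s).flatMap Gate.qubits).Nodup := by
  rw [copyLayer, List.flatMap_assoc]
  refine nodup_flatMap_of_injective (List.nodup_finRange n) (fun j => by simp [Gate.qubits]) ?_
  intro i j q h1 h2
  simp only [Gate.qubits, List.flatMap_cons, List.flatMap_nil, List.append_nil, List.mem_cons,
    List.not_mem_nil, or_false] at h1 h2
  rcases h1 with rfl | rfl <;> simpa using h2

theorem doublingLayer_nodup (w : ℕ) (hw : 0 < w) :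
    ((doublingLayer n s w).flatMap Gate.qubits).Nodup := by
  rw [doublingLayer, List.flatMap_assoc]
  simp only [List.flatMap_assoc]
  refine nodup_flatMap_of_injective (List.nodup_finRange w) (fun r =>
    nodup_flatMap_of_injective (List.nodup_finRange n) (fun j => ?_) ?_) ?_
  · split_ifs <;> simp [Gate.qubits]; omega
  · intro i j q h1 h2
    split_ifs at h1 h2 <;> simp [Gate.qubits] at h1 h2
    rcases h1 with rfl | rfl <;> simp at h2 <;> tauto
  · intro r r' q h1 h2
    simp only [List.mem_flatMap] at h1 h2
    obtain ⟨i, -, G, hG, h1⟩ := h1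
    obtain ⟨j, -, G', hG', h2⟩ := h2
    split_ifs at hG hG' <;> simp only [List.mem_singleton, List.not_mem_nil] at hG hG'
    subst hG hG'
    simp only [Gate.qubits, List.mem_cons, List.not_mem_nil, or_false] at h1 h2
    rcases h1 with rfl | rfl <;> simp at h2 <;> omega

theorem swapLayer_nodup : ((swapLayer n s).flatMap Gate.qubits).Nodup := by
  rw [swapLayer, List.flatMap_assoc]
  simp only [List.flatMap_assoc]
  refine nodup_flatMap_of_injective (List.nodup_finRange s) (fun r =>
    nodup_flatMap_of_injective (List.nodup_finRange n) (fun j => ?_) ?_) ?_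
  · simp [Gate.qubits]
  · intro i j q h1 h2
    simp only [Gate.qubits, List.flatMap_cons, List.flatMap_nil, List.append_nil, List.mem_cons,
      List.not_mem_nil, or_false] at h1 h2
    rcases h1 with rfl | rfl | rfl <;> simpa using h2
  · intro r r' q h1 h2
    simp only [List.mem_flatMap] at h1 h2
    obtain ⟨i, -, G, hG, h1⟩ := h1
    obtain ⟨j, -, G', hG', h2⟩ := h2
    simp only [List.mem_singleton] at hG hG'
    subst hG hG'
    simp only [Gate.qubits, List.mem_cons, List.not_mem_nil, or_false] at h1 h2
    rcases h1 with rfl | rfl | rfl <;> simp at h2 <;> tauto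

theorem pairLayer_nodup (r : Fin s) : ((pairLayer (n := n) a r).flatMap Gate.qubits).Nodup := by
  rw [pairLayer, List.flatMap_assoc]
  refine nodup_flatMap_of_injective (List.nodup_finRange n) (fun j => by simp [Gate.qubits]) ?_
  intro i j q h1 h2
  simp only [Gate.qubits, List.flatMap_cons, List.flatMap_nil, List.append_nil, List.mem_cons,
    List.not_mem_nil, or_false] at h1 h2
  rcases h1 with rfl | rfl | rfl <;> simpa using h2

theorem nonadaptiveCircuit_valid : (nonadaptiveCircuit n s a).Valid := by
  intro l hl
  simp only [nonadaptiveCircuit, List.mem_append, List.mem_singleton, List.mem_map] at hl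
  rcases hl with rfl | ⟨r, -, rfl⟩ | rfl
  · exact hadLayer_nodup
  · exact pairLayer_nodup r
  · exact hadLayer_nodup

theorem adaptiveCircuit_valid (ys : List (Bits n)) : (adaptiveCircuit n s ys).Valid := by
  intro l hl
  simp only [adaptiveCircuit, prepareCircuit, fanoutCircuit, faninCircuit, dependentLayers,
    List.mem_append, List.mem_singleton, List.mem_map, List.mem_flatMap] at hl
  rcases hl with (rfl | ⟨i, -, j, -, rfl⟩) | (rfl | ⟨l, -, rfl⟩) | rfl | (⟨l, -, rfl⟩ | rfl) | rfl
  · exact freeLayer_nodup _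
  · split_ifs with h
    · simp [Gate.qubits, h.2]
    · simp
  · exact copyLayer_nodup
  · exact doublingLayer_nodup _ (by positivity)
  · exact swapLayer_nodup
  · exact doublingLayer_nodup _ (by positivity)
  · exact copyLayer_nodup
  · exact hadLayer_nodup

/-- The size of a valid circuit is at most its depth times the number of qubits. -/
theorem Circuit.size_le {Q : Type} [Fintype Q] [DecidableEq Q] {C : Circuit Q} (hC : C.Valid) :
    C.size ≤ C.depth * Fintype.card Q := by
  have hlayer : ∀ l : List (Gate Q), l.length ≤ (l.flatMap Gate.qubits).length := by
    intro l
    induction l with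
    | nil => simp
    | cons G l ih =>
      have : 1 ≤ G.qubits.length := by cases G <;> simp [Gate.qubits]
      simp only [List.flatMap_cons, List.length_append, List.length_cons]
      omega
  have h := List.sum_le_card_nsmul (C.map List.length) (Fintype.card Q) fun x hx => by
    obtain ⟨l, hl, rfl⟩ := List.mem_map.1 hx
    exact (hlayer l).trans (hC l hl).length_le_card
  simpa [Circuit.size, Circuit.depth] using h

end Valid

/-! ### The states produced by the circuits -/

section Semantics

variable {n s a : ℕ}

/-- The basis label made up of the labels of the three registers. -/
def joinLabel (g : Bits n) (e : Copy s × Fin n → ZMod 2) (k : Fin a → ZMod 2) :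
    Qubit n s a → ZMod 2 := Sum.elim g (Sum.elim e k)

@[simp] theorem joinLabel_group (g : Bits n) (e : Copy s × Fin n → ZMod 2) (k : Fin a → ZMod 2)
    (j : Fin n) : joinLabel g e k (Sum.inl j) = g j := rfl

@[simp] theorem joinLabel_copy (g : Bits n) (e : Copy s × Fin n → ZMod 2) (k : Fin a → ZMod 2)
    (p : Copy s × Fin n) : joinLabel g e k (Sum.inr (Sum.inl p)) = e p := rfl

@[simp] theorem joinLabel_ancilla (g : Bits n) (e : Copy s × Fin n → ZMod 2) (k : Fin a → ZMod 2)
    (i : Fin a) : joinLabel g e k (Sum.inr (Sum.inr i)) = k i := rfl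

theorem joinLabel_eta (x : Qubit n s a → ZMod 2) :
    joinLabel (fun i => x (Sum.inl i)) (fun p => x (Sum.inr (Sum.inl p)))
      (fun k => x (Sum.inr (Sum.inr k))) = x := by
  funext q
  rcases q with i | p | k <;> rfl

theorem update_joinLabel (g : Bits n) (e : Copy s × Fin n → ZMod 2) (k : Fin a → ZMod 2)
    (j : Fin n) (b : ZMod 2) :
    Function.update (joinLabel g e k) (Sum.inl j) b = joinLabel (Function.update g j b) e k := by
  funext q
  rcases q with i | p | k
  · simp only [joinLabel_group, Function.update_apply, Sum.inl.injEq]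
  · simp
  · simp

theorem sign_add (b c : ZMod 2) : sign (b + c) = sign b * sign c := by
  revert b c
  have h : ∀ b : ZMod 2, b = 0 ∨ b = 1 := by decide
  have h1 : (1 : ZMod 2) + 1 = 0 := by decide
  intro b c
  rcases h b with rfl | rfl <;> rcases h c with rfl | rfl <;> simp [sign, h1]

@[simp] theorem sign_zero : sign 0 = 1 := by simp [sign]

@[simp] theorem sign_one : sign 1 = -1 := by simp [sign]

theorem sign_sum {ι : Type*} (t : Finset ι) (f : ι → ZMod 2) :
    sign (∑ i ∈ t, f i) = ∏ i ∈ t, sign (f i) := by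
  classical
  induction t using Finset.induction_on with
  | empty => simp
  | insert i t hi ih => rw [Finset.sum_insert hi, Finset.prod_insert hi, sign_add, ih]

theorem apply_had_joinLabel (f : (Qubit n s a → ZMod 2) → ℂ) (j : Fin n) (g : Bits n)
    (e : Copy s × Fin n → ZMod 2) (k : Fin a → ZMod 2) :
    (Gate.had (groupQubit j)).apply f (joinLabel g e k) =
      (1 / Real.sqrt 2 : ℂ) *
        ∑ c, sign (g j * c) * f (joinLabel (Function.update g j c) e k) := by
  simp only [Gate.apply, joinLabel_group, update_joinLabel]

/-- Hadamard gates on the qubits in a list `l` of qubits of the group register. -/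
theorem foldl_had {l : List (Fin n)} (hl : l.Nodup) (f : (Qubit n s a → ZMod 2) → ℂ)
    (g : Bits n) (e : Copy s × Fin n → ZMod 2) (k : Fin a → ZMod 2) :
    (l.map fun j => Gate.had (groupQubit j)).foldl (fun g G => G.apply g) f (joinLabel g e k) =
      (1 / Real.sqrt 2 : ℂ) ^ l.length * ∑ b : Bits n,
        if ∀ i, i ∉ l → b i = g i then
          (∏ i ∈ l.toFinset, sign (g i * b i)) * f (joinLabel b e k) else 0 := by
  induction l using List.reverseRecOn generalizing g with
  | nil =>
    simp only [List.map_nil, List.foldl_nil, List.length_nil, pow_zero, one_mul,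
      List.not_mem_nil, not_false_eq_true, forall_true_left, List.toFinset_nil, Finset.prod_empty]
    simp only [← funext_iff]
    simp
  | append_singleton l q ih =>
    have hq : q ∉ l := by
      have := List.nodup_append.1 hl
      intro h
      exact this.2.2 q h q (by simp) rfl
    have hl' : l.Nodup := (List.nodup_append.1 hl).1
    rw [List.map_append, List.foldl_append]
    rw [List.map_singleton, List.foldl_cons, List.foldl_nil, apply_had_joinLabel]
    simp only [ih hl']
    rw [List.length_append, List.length_singleton, pow_succ', mul_assoc]
    congr 1
    rw [Finset.mul_sum, Finset.sum_congr rfl fun c _ => mul_left_comm _ _ _, ← Finset.mul_sum]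
    simp only [Finset.mul_sum]
    rw [Finset.sum_comm]
    refine Finset.sum_congr rfl fun b _ => ?_
    have hprod : ∀ c, ∏ i ∈ l.toFinset, sign (Function.update g q c i * b i) =
        ∏ i ∈ l.toFinset, sign (g i * b i) := fun c => by
      refine Finset.prod_congr rfl fun i hi => ?_
      rw [Function.update_of_ne]
      rintro rfl
      exact hq (List.mem_toFinset.1 hi)
    have hcond : ∀ c, (∀ i, i ∉ l → b i = Function.update g q c i) ↔
        (c = b q ∧ ∀ i, i ∉ l ++ [q] → b i = g i) := by
      intro c
      constructor
      · intro h
        refine ⟨by simpa using (h q hq).symm, fun i hi => ?_⟩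
        simp only [List.mem_append, List.mem_singleton, not_or] at hi
        simpa [hi.2] using h i hi.1
      · rintro ⟨rfl, h⟩ i hi
        by_cases hiq : i = q
        · subst hiq; simp
        · simpa [hiq] using h i (by simp [hi, hiq])
    simp only [hprod, hcond]
    rw [Finset.sum_eq_single (b q)]
    · by_cases h : ∀ i, i ∉ l ++ [q] → b i = g i
      · rw [if_pos ⟨rfl, h⟩, if_pos h, List.toFinset_append, List.toFinset_cons,
          List.toFinset_nil, insert_empty_eq, Finset.prod_union (by simpa using hq),
          Finset.prod_singleton]
        ring
      · rw [if_neg fun h' => h h'.2, if_neg h, mul_zero]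
    · intro c _ hc
      rw [if_neg fun h => hc h.1, mul_zero, mul_zero]
    · simp

theorem inv_sqrt_two_pow (k : ℕ) : (1 / Real.sqrt 2 : ℂ) ^ k = 1 / Real.sqrt (2 ^ k) := by
  rw [div_pow, one_pow, ← Complex.ofReal_pow]
  congr 2
  rw [Real.sqrt_eq_rpow, Real.sqrt_eq_rpow, ← Real.rpow_natCast, ← Real.rpow_natCast,
    ← Real.rpow_mul (by norm_num), ← Real.rpow_mul (by norm_num), mul_comm]

theorem apply_hadLayer (f : (Qubit n s a → ZMod 2) → ℂ) (g : Bits n)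
    (e : Copy s × Fin n → ZMod 2) (k : Fin a → ZMod 2) :
    Circuit.apply [hadLayer n s a] f (joinLabel g e k) =
      hadamardAll (fun b => f (joinLabel b e k)) g := by
  have : hadLayer n s a = (List.finRange n).map fun j => Gate.had (groupQubit j) := by
    rw [hadLayer, List.map_eq_flatMap]
  rw [Circuit.apply_singleton, this, foldl_had (List.nodup_finRange n), hadamardAll,
    List.length_finRange, inv_sqrt_two_pow]
  congr 1
  refine Finset.sum_congr rfl fun b _ => ?_
  rw [if_pos (by simp), dotProduct, sign_sum]
  simp [mul_comm]

theorem initialState_joinLabel (ψ : QSpace (Fin n)) (g : Bits n) (e : Copy s × Fin n → ZMod 2)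
    (k : Fin a → ZMod 2) : initialState ψ s a (joinLabel g e k) =
      if g = 0 ∧ k = 0 then copies ψ s e else 0 := by
  simp only [initialState, joinLabel_group, joinLabel_copy, joinLabel_ancilla, funext_iff,
    Pi.zero_apply]
  rfl

/-- The state with group register in the state `g`, input register `|ψ⟩^{⊗ 2s}` and ancillas
`|0⟩`. -/
def preparedState (g : Bits n → ℂ) (ψ : QSpace (Fin n)) (s a : ℕ)
    (x : Qubit n s a → ZMod 2) : ℂ :=
  if ∀ k, x (Sum.inr (Sum.inr k)) = 0 then
    g (fun i => x (Sum.inl i)) * copies ψ s (fun p => x (Sum.inr (Sum.inl p))) else 0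

theorem preparedState_joinLabel (γ : Bits n → ℂ) (ψ : QSpace (Fin n)) (g : Bits n)
    (e : Copy s × Fin n → ZMod 2) (k : Fin a → ZMod 2) :
    preparedState γ ψ s a (joinLabel g e k) = if k = 0 then γ g * copies ψ s e else 0 := by
  simp only [preparedState, joinLabel_group, joinLabel_copy, joinLabel_ancilla, funext_iff,
    Pi.zero_apply]
  rfl

/-- A circuit that prepares the group register, then permutes the copies under its control, and
ends with Hadamard gates, implements Fourier sampling. -/
theorem implementsFourier_of_parts {C D : Circuit (Qubit n s a)} {γ : Bits n → ℂ}
    (hv : (C ++ (D ++ [hadLayer n s a])).Valid)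
    (hC : ∀ ψ : QSpace (Fin n), C.apply (initialState ψ s a) = preparedState γ ψ s a)
    (hD : ∀ (ψ : QSpace (Fin n)) g e k, D.apply (preparedState γ ψ s a) (joinLabel g e k) =
      if k = 0 then γ g * copies ψ s (permute g e) else 0) :
    ImplementsFourier (C ++ (D ++ [hadLayer n s a])) γ := by
  refine ⟨hv, fun ψ => ?_⟩
  rw [Circuit.apply_append, hC, Circuit.apply_append]
  funext x
  rw [← joinLabel_eta x, apply_hadLayer]
  simp only [hD, joinLabel_ancilla, joinLabel_group, joinLabel_copy, funext_iff, Pi.zero_apply]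
  by_cases h : ∀ i, x (Sum.inr (Sum.inr i)) = 0
  · simp only [h, implies_true, if_true]
    rfl
  · simp only [h, if_false]
    simp [hadamardAll]

theorem flatten_map_apply_of_reversible {Q : Type} [DecidableEq Q] {ι : Type*} {l : List ι}
    {F : ι → List (Gate Q)} (hF : ∀ i, ∀ G ∈ F i, G.IsReversible) (f : (Q → ZMod 2) → ℂ)
    (x : Q → ZMod 2) : Circuit.apply (l.map F) f x =
      f ((l.map F).foldr labelMaps x) := by
  induction l generalizing f with
  | nil => rfl
  | cons i l ih =>
    have : (i :: l).map F = [F i] ++ l.map F := by simp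
    rw [this, Circuit.apply_append, ih, Circuit.apply_singleton,
      foldl_apply_of_isReversible (hF i)]
    rfl

theorem labelMap_cswap {Q : Type} [DecidableEq Q] (c a b q : Q) (x : Q → ZMod 2) :
    (Gate.cswap c a b).labelMap x q = if x c = 1 then x (Equiv.swap a b q) else x q := by
  simp only [Gate.labelMap]
  split_ifs <;> rfl

/-! ### The non-adaptive circuit -/

theorem labelMaps_pairLayer (r : Fin s) (g : Bits n) (e : Copy s × Fin n → ZMod 2)
    (k : Fin a → ZMod 2) : labelMaps (pairLayer a r) (joinLabel g e k) =
      joinLabel g (fun p => if p.1.1 = r ∧ g p.2 = 1 then e ((p.1.1, p.1.2 + 1), p.2) else e p)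
        k := by
  have hG : ∀ j, Gate.cswap (groupQubit j) (copyQubit r 0 j) (copyQubit r 1 j) ∈
      pairLayer (n := n) (s := s) a r := fun j => by simp [pairLayer]
  have hnot : ∀ q : Qubit n s a, (∀ j b, q ≠ copyQubit r b j) → (∀ j, q ≠ groupQubit j) →
      labelMaps (pairLayer a r) (joinLabel g e k) q = joinLabel g e k q := by
    intro q hq hq'
    refine labelMaps_of_notMem ?_ _
    simp only [pairLayer, List.flatMap_assoc, List.mem_flatMap, not_exists, not_and]
    intro j _
    simp [Gate.qubits, hq, hq']
  funext q
  rcases q with j | ⟨⟨r', b⟩, j⟩ | i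
  · rw [labelMaps_of_mem (pairLayer_nodup r) (hG j) (by simp [Gate.qubits])]
    rw [labelMap_cswap, Equiv.swap_apply_of_ne_of_ne (by simp) (by simp), ite_self]
    rfl
  · by_cases hr : r' = r
    · subst hr
      have hmem : (Sum.inr (Sum.inl ((r', b), j)) : Qubit n s a) ∈
          (Gate.cswap (groupQubit j) (copyQubit r' 0 j) (copyQubit r' 1 j)).qubits := by
        fin_cases b <;> simp [Gate.qubits]
      rw [labelMaps_of_mem (pairLayer_nodup r') (hG j) hmem]
      simp only [labelMap_cswap, joinLabel_group, joinLabel_copy, true_and]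
      by_cases h : g j = 1
      · simp only [h, if_true]
        fin_cases b <;> simp
      · simp only [h, if_false]
    · rw [hnot]
      · simp [hr]
      · intro j' b' h
        simp at h
        exact hr h.1.1
      · simp
  · rw [hnot _ (by simp) (by simp)]
    rfl

theorem foldr_pairLayer {l : List (Fin s)} (hl : l.Nodup) (g : Bits n)
    (e : Copy s × Fin n → ZMod 2) (k : Fin a → ZMod 2) :
    (l.map (pairLayer (n := n) a)).foldr labelMaps (joinLabel g e k) =
      joinLabel g (fun p => if p.1.1 ∈ l ∧ g p.2 = 1 then e ((p.1.1, p.1.2 + 1), p.2) else e p)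
        k := by
  induction l with
  | nil => simp
  | cons r l ih =>
    rw [List.nodup_cons] at hl
    rw [List.map_cons, List.foldr_cons, ih hl.2, labelMaps_pairLayer]
    congr 1
    funext ⟨⟨r', b⟩, j⟩
    by_cases hr : r' = r
    · subst hr
      simp [hl.1]
    · simp [hr]

theorem pairLayer_isReversible (r : Fin s) : ∀ G ∈ pairLayer (n := n) a r, G.IsReversible := by
  intro G hG
  simp only [pairLayer, List.mem_flatMap, List.mem_singleton] at hG
  obtain ⟨j, -, rfl⟩ := hG
  trivial

/-- Each group qubit controls the swaps of all pairs of copies, one layer per pair, so no ancillas are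
needed. -/
theorem implementsFourier_nonadaptiveCircuit :
    ImplementsFourier (nonadaptiveCircuit n s a) (hadamardAll (zeroState n)) := by
  refine implementsFourier_of_parts nonadaptiveCircuit_valid (fun ψ => ?_) fun ψ g e k => ?_
  · funext x
    rw [← joinLabel_eta x, apply_hadLayer, preparedState_joinLabel]
    simp only [initialState_joinLabel, hadamardAll, zeroState]
    split_ifs with h
    · simp [h]
    · simp [h]
  · rw [flatten_map_apply_of_reversible pairLayer_isReversible,
      foldr_pairLayer (List.nodup_finRange s), preparedState_joinLabel]
    simp only [List.mem_finRange, true_and]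
    rfl

/-! ### The preparation of the group register -/

theorem freeLayer_eq (Z : Fin n → Bits n) : freeLayer s a Z =
    ((List.finRange n).filter fun j => Z j j = 1).map fun j => Gate.had (groupQubit j) := by
  rw [freeLayer]
  induction List.finRange n with
  | nil => rfl
  | cons j l ih =>
    rw [List.flatMap_cons, ih]
    by_cases h : Z j j = 1 <;> simp [h]

theorem apply_freeLayer (Z : Fin n → Bits n) (ψ : QSpace (Fin n)) (g : Bits n)
    (e : Copy s × Fin n → ZMod 2) (k : Fin a → ZMod 2) :
    Circuit.apply [freeLayer s a Z] (initialState ψ s a) (joinLabel g e k) =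
      if (∀ i, Z i i ≠ 1 → g i = 0) ∧ k = 0 then
        (1 / Real.sqrt (2 ^ (Finset.univ.filter fun i => Z i i = 1).card) : ℂ) * copies ψ s e
      else 0 := by
  set l := (List.finRange n).filter fun j => Z j j = 1 with hl
  have hnd : l.Nodup := (List.nodup_finRange n).filter _
  have hmem : ∀ i, i ∈ l ↔ Z i i = 1 := fun i => by simp [hl]
  have hlen : l.length = (Finset.univ.filter fun i => Z i i = 1).card := by
    rw [← List.toFinset_card_of_nodup hnd]
    congr 1
    ext i
    simp [hmem]
  rw [Circuit.apply_singleton, freeLayer_eq, foldl_had hnd, inv_sqrt_two_pow, hlen]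
  rw [Finset.sum_eq_single 0]
  · simp only [initialState_joinLabel, hmem, Pi.zero_apply, mul_zero, sign_zero,
      Finset.prod_const_one, one_mul, true_and, mul_ite]
    by_cases h1 : ∀ i, Z i i ≠ 1 → g i = 0
    · rw [if_pos fun i hi => (h1 i hi).symm]
      by_cases h2 : k = 0
      · rw [if_pos h2, if_pos ⟨h1, h2⟩]
      · rw [if_neg h2, if_neg fun h => h2 h.2]
    · rw [if_neg fun h => h1 fun i hi => (h i hi).symm, if_neg fun h => h1 h.1]
  · intro b _ hb
    simp [initialState_joinLabel, hb]
  · simp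

theorem sum_map_flatMap {α β M : Type*} [AddMonoid M] (l : List α) (f : α → List β) (g : β → M) :
    ((l.flatMap f).map g).sum = (l.map fun x => ((f x).map g).sum).sum := by
  induction l with
  | nil => simp
  | cons x l ih => simp [ih]

/-- CNOT gates within the group register, none of whose targets is a control. -/
theorem labelMaps_groupCnots {l : List (Fin n × Fin n)} (hl : ∀ p ∈ l, ∀ q ∈ l, p.1 ≠ q.2)
    (g : Bits n) (e : Copy s × Fin n → ZMod 2) (k : Fin a → ZMod 2) :
    labelMaps (l.map fun p => Gate.cnot (groupQubit p.1) (groupQubit p.2)) (joinLabel g e k) =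
      joinLabel (fun j => g j + (l.map fun p => if p.2 = j then g p.1 else 0).sum) e k := by
  induction l with
  | nil => simp [labelMaps]
  | cons p l ih =>
    have ih := ih fun p hp q hq => hl p (List.mem_cons_of_mem _ hp) q (List.mem_cons_of_mem _ hq)
    have hp : (l.map fun q => if q.2 = p.1 then g q.1 else 0).sum = 0 := by
      refine List.sum_eq_zero fun x hx => ?_
      obtain ⟨q, hq, rfl⟩ := List.mem_map.1 hx
      rw [if_neg fun h => hl p List.mem_cons_self q (List.mem_cons_of_mem _ hq) h.symm]
    rw [List.map_cons, labelMaps, List.foldr_cons]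
    change Gate.labelMap _ (labelMaps _ _) = _
    rw [ih]
    simp only [Gate.labelMap, update_joinLabel, joinLabel_group, hp, add_zero]
    congr 1
    funext j
    rw [Function.update_apply, List.map_cons, List.sum_cons]
    split_ifs with h1 h2 h2
    · rw [h1]; ring
    · exact absurd h1.symm h2
    · exact absurd h2.symm h1
    · ring

/-- On basis labels the CNOT gates act all at once: every target coordinate is changed by the sum of
its controls, regardless of the order of the gates. -/
theorem apply_dependentLayers {Z : Fin n → Bits n} (hZ : IsReduced Z)
    (f : (Qubit n s a → ZMod 2) → ℂ) (g : Bits n)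
    (e : Copy s × Fin n → ZMod 2) (k : Fin a → ZMod 2) :
    Circuit.apply (dependentLayers s a Z) f (joinLabel g e k) =
      f (joinLabel (fun j => g j + ∑ i, if Z i j = 1 ∧ i ≠ j then g i else 0) e k) := by
  let l : List (Fin n × Fin n) := (List.finRange n).flatMap fun i => (List.finRange n).flatMap
    fun j => if Z i j = 1 ∧ i ≠ j then [(i, j)] else []
  have hflat : (dependentLayers s a Z).flatten =
      l.map fun p => Gate.cnot (groupQubit p.1) (groupQubit p.2) := by
    simp only [dependentLayers, l, List.map_flatMap]
    rw [← List.flatMap_id, List.flatMap_assoc]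
    congr 1
    funext i
    rw [List.flatMap_map]
    congr 1
    funext j
    split_ifs <;> simp
  have hmem : ∀ p : Fin n × Fin n, p ∈ l ↔ Z p.1 p.2 = 1 ∧ p.1 ≠ p.2 := by
    rintro ⟨i, j⟩
    simp only [l, List.mem_flatMap, List.mem_finRange, true_and]
    constructor
    · rintro ⟨i', j', h⟩
      split_ifs at h with hc
      · simp only [List.mem_singleton, Prod.mk.injEq] at h
        obtain ⟨rfl, rfl⟩ := h
        exact hc
      · simp at h
    · intro h
      exact ⟨i, j, by rw [if_pos h]; simp⟩
  -- in a reduced system no target is a control, as rows other than `i` vanish in column `i`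
  have hdisj : ∀ p ∈ l, ∀ q ∈ l, p.1 ≠ q.2 := by
    intro p hp q hq hpq
    rw [hmem] at hp hq
    rcases hZ p.1 with h | ⟨-, h⟩
    · rw [h] at hp
      simp at hp
    · have := h q.1 (by rw [hpq]; exact hq.2)
      rw [hpq, hq.1] at this
      exact one_ne_zero this
  rw [Circuit.apply, hflat, foldl_apply_of_isReversible, labelMaps_groupCnots hdisj]
  · congr 2
    funext j
    congr 1
    simp only [l, sum_map_flatMap]
    rw [Fin.sum_univ_def]
    congr 1
    refine List.map_congr_left fun i _ => ?_
    rw [← Fin.sum_univ_def, Finset.sum_eq_single j]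
    · split_ifs <;> simp
    · intro b _ hb
      split_ifs <;> simp [hb]
    · simp
  · intro G hG
    obtain ⟨p, -, rfl⟩ := List.mem_map.1 hG
    trivial

/-- Vectors of the nullspace are determined by their free coordinates, which are arbitrary. -/
theorem card_orth (ys : List (Bits n)) :
    Nat.card (orth ys) = 2 ^ (Finset.univ.filter fun i => elim ys i i = 1).card := by
  obtain ⟨hred, hmem⟩ := elim_spec ys
  set Z := elim ys with hZ
  have hfree : ∀ i, Z i i ≠ 1 → Z i = 0 := fun i hi => (hred i).resolve_right fun h => hi h.1
  have hcol : ∀ i, Z i i = 1 → ∀ j, j ≠ i → Z j i = 0 := by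
    intro i hi
    rcases hred i with h | h
    · rw [h] at hi
      simp at hi
    · exact h.2
  let E : orth ys ≃ ({i // Z i i = 1} → ZMod 2) :=
    { toFun := fun z i => z.1 i.1
      invFun := fun c => ⟨∑ i : {i // Z i i = 1}, c i • Z i.1,
        Submodule.sum_mem _ fun i _ => Submodule.smul_mem _ _ (elim_mem_orth ys _)⟩
      left_inv := by
        rintro ⟨z, hz⟩
        refine Subtype.ext ?_
        change ∑ i : {i // Z i i = 1}, z i.1 • Z i.1 = z
        conv_rhs => rw [(hmem z).1 hz]
        rw [← Finset.sum_subtype (Finset.univ.filter fun i => Z i i = 1) (by simp)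
          (fun i => z i • Z i), Finset.sum_filter]
        refine Finset.sum_congr rfl fun i _ => ?_
        split_ifs with h
        · rfl
        · rw [hfree i h, smul_zero]
      right_inv := by
        intro c
        funext j
        change (∑ i : {i // Z i i = 1}, c i • Z i.1) j.1 = c j
        rw [Finset.sum_apply, Finset.sum_eq_single j]
        · simp [j.2]
        · intro i _ hij
          have : Z i.1 j.1 = 0 := hcol j.1 j.2 i.1 fun h => hij (Subtype.ext h)
          simp [this]
        · simp }
  rw [Nat.card_congr E, Nat.card_eq_fintype_card, Fintype.card_fun, ZMod.card,
    Fintype.card_subtype]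

/-- The preparation circuit produces the uniform superposition over the nullspace: after the Hadamard
gates the dependent coordinates are zero, so `g` has nonzero amplitude iff undoing the CNOT gates
clears its dependent coordinates. -/
theorem apply_prepareCircuit (ys : List (Bits n)) (ψ : QSpace (Fin n)) :
    Circuit.apply (prepareCircuit s a (elim ys)) (initialState ψ s a) =
      preparedState (subspaceState (orth ys)) ψ s a := by
  obtain ⟨hred, hmem⟩ := elim_spec ys
  funext x
  obtain ⟨g, e, k, rfl⟩ : ∃ g e k, x = joinLabel g e k := ⟨_, _, _, (joinLabel_eta x).symm⟩
  rw [prepareCircuit, Circuit.apply_append, apply_dependentLayers hred,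
    apply_freeLayer, preparedState_joinLabel, subspaceState, card_orth]
  have key : (∀ i, elim ys i i ≠ 1 →
      g i + ∑ j, (if elim ys j i = 1 ∧ j ≠ i then g j else 0) = 0) ↔ g ∈ orth ys := by
    rw [mem_orth_iff]
    refine forall_congr' fun j => ?_
    have hsum : ∑ i, g i * elim ys i j =
        g j * elim ys j j + ∑ i, (if elim ys i j = 1 ∧ i ≠ j then g i else 0) := by
      rw [← Finset.add_sum_erase _ _ (Finset.mem_univ j)]
      congr 1
      rw [← Finset.sum_erase Finset.univ (a := j)
        (f := fun i => if elim ys i j = 1 ∧ i ≠ j then g i else 0) (by simp)]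
      refine Finset.sum_congr rfl fun i hi => ?_
      rcases zmod_two_eq_zero_or_one (elim ys i j) with h | h
      · simp [h]
      · simp [h, Finset.ne_of_mem_erase hi]
    rw [hsum]
    rcases hred j with h | ⟨h, h'⟩
    · rw [h]
      simp only [Pi.zero_apply, ne_eq, zero_ne_one, not_false_eq_true, forall_const, mul_zero,
        zero_add]
      exact CharTwo.add_eq_zero
    · rw [h]
      refine iff_of_true (fun hne => absurd rfl hne) ?_
      rw [mul_one, Finset.sum_eq_zero, add_zero]
      intro i _
      rw [if_neg]
      rintro ⟨h1, h2⟩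
      rw [h' i h2] at h1
      exact zero_ne_one h1
  by_cases h2 : k = 0
  · by_cases h1 : g ∈ orth ys
    · rw [if_pos ⟨key.2 h1, h2⟩, if_pos h2, if_pos h1, Nat.cast_pow, Nat.cast_ofNat]
    · rw [if_neg fun h => h1 (key.1 h.1), if_pos h2, if_neg h1, zero_mul]
  · rw [if_neg fun h => h2 h.2, if_neg h2]

end Semantics

/-! ### The fan-out -/

section Fanout

variable {n s : ℕ}

/-- A circuit that changes the ancillas only, by a permutation `δ` controlled by the group
register. -/
def ActsOnAncillas {a : ℕ} (C : Circuit (Qubit n s a))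
    (δ : Bits n → (Fin a → ZMod 2) → Fin a → ZMod 2) : Prop :=
  ∀ f g e k, C.apply f (joinLabel g e k) = f (joinLabel g e (δ g k))

theorem ActsOnAncillas.append {a : ℕ} {C D : Circuit (Qubit n s a)}
    {δ η : Bits n → (Fin a → ZMod 2) → Fin a → ZMod 2} (hC : ActsOnAncillas C δ)
    (hD : ActsOnAncillas D η) : ActsOnAncillas (C ++ D) fun g k => δ g (η g k) := by
  intro f g e k
  rw [Circuit.apply_append, hD, hC]

/-- The action of `copyLayer`. -/
def copyMap (n s : ℕ) (g : Bits n) (k : Fin ((s + 1) * n) → ZMod 2) : Fin ((s + 1) * n) → ZMod 2 :=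
  fun i => k i + if (finProdFinEquiv.symm i).1 = 0 then g (finProdFinEquiv.symm i).2 else 0

/-- The action of `doublingLayer`. -/
def doublingMap (n s w : ℕ) (k : Fin ((s + 1) * n) → ZMod 2) : Fin ((s + 1) * n) → ZMod 2 :=
  fun i => k i + if w ≤ (finProdFinEquiv.symm i).1 ∧ (finProdFinEquiv.symm i).1 < w + w then
    k (finProdFinEquiv (⟨(finProdFinEquiv.symm i).1 - w, by omega⟩, (finProdFinEquiv.symm i).2))
    else 0

theorem copyMap_copyMap (g : Bits n) (k : Fin ((s + 1) * n) → ZMod 2) :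
    copyMap n s g (copyMap n s g k) = k := by
  funext i
  simp only [copyMap]
  rw [add_assoc, CharTwo.add_self_eq_zero, add_zero]

theorem doublingMap_doublingMap (w : ℕ) (k : Fin ((s + 1) * n) → ZMod 2) :
    doublingMap n s w (doublingMap n s w k) = k := by
  funext i
  simp only [doublingMap, Equiv.symm_apply_apply]
  split_ifs with h1
  · omega
  · rw [add_zero, add_assoc, CharTwo.add_self_eq_zero, add_zero]
  · simp

theorem copyLayer_acts : ActsOnAncillas [copyLayer n s] (copyMap n s) := by
  intro f g e k
  have hrev : ∀ G ∈ copyLayer n s, G.IsReversible := by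
    intro G hG
    simp only [copyLayer, List.mem_flatMap, List.mem_singleton] at hG
    obtain ⟨j, -, rfl⟩ := hG
    trivial
  have hG : ∀ j, Gate.cnot (groupQubit j) (ancillaQubit 0 j) ∈ copyLayer n s :=
    fun j => by simp [copyLayer]
  rw [Circuit.apply_singleton, foldl_apply_of_isReversible hrev]
  congr 1
  funext q
  rcases q with j | p | i
  · rw [labelMaps_of_mem copyLayer_nodup (hG j) (by simp [Gate.qubits])]
    simp [Gate.labelMap]
  · rw [labelMaps_of_notMem]
    · rfl
    · simp [copyLayer, List.mem_flatMap, Gate.qubits]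
  · obtain ⟨⟨r, j⟩, rfl⟩ := finProdFinEquiv.surjective i
    by_cases hr : r = 0
    · subst hr
      rw [labelMaps_of_mem copyLayer_nodup (hG j) (by simp [Gate.qubits])]
      simp [Gate.labelMap, copyMap]
    · rw [labelMaps_of_notMem]
      · simp [copyMap, hr]
      · simp only [copyLayer, List.mem_flatMap, List.mem_singleton, not_exists, not_and]
        rintro G ⟨j', -, rfl⟩
        simp [Gate.qubits, hr]

theorem doublingLayer_isReversible (w : ℕ) : ∀ G ∈ doublingLayer n s w, G.IsReversible := by
  intro G hG
  simp only [doublingLayer, List.mem_flatMap] at hG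
  obtain ⟨r, -, j, -, hG⟩ := hG
  split_ifs at hG
  · rw [List.mem_singleton] at hG
    subst hG
    trivial
  · simp at hG

theorem doublingLayer_acts (w : ℕ) (hw : 0 < w) :
    ActsOnAncillas [doublingLayer n s w] fun _ => doublingMap n s w := by
  intro f g e k
  have hG : ∀ (r : Fin (s + 1)) j (h : w ≤ r ∧ r < w + w),
      Gate.cnot (ancillaQubit ⟨r - w, by omega⟩ j) (ancillaQubit r j) ∈ doublingLayer n s w := by
    intro r j h
    simp only [doublingLayer, List.mem_flatMap, List.mem_finRange, true_and]
    refine ⟨⟨r - w, by omega⟩, j, ?_⟩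
    rw [dif_pos (by simp only; omega), List.mem_singleton]
    congr 4
    exact Fin.ext (by simp only; omega)
  have hmem : ∀ G ∈ doublingLayer n s w, ∃ (r : Fin (s + 1)) (j : Fin n), ∃ h : w ≤ r ∧ r < w + w,
      G = Gate.cnot (ancillaQubit ⟨r - w, by omega⟩ j) (ancillaQubit r j) := by
    intro G hG
    simp only [doublingLayer, List.mem_flatMap] at hG
    obtain ⟨r, -, j, -, hG⟩ := hG
    split_ifs at hG with h
    · rw [List.mem_singleton] at hG
      refine ⟨⟨r + w, h⟩, j, ⟨by simp only; omega, by simp only; omega⟩, ?_⟩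
      rw [hG]
      simp only [Nat.add_sub_cancel]
    · simp at hG
  rw [Circuit.apply_singleton, foldl_apply_of_isReversible (doublingLayer_isReversible w)]
  congr 1
  funext q
  rcases q with j | p | i
  · rw [labelMaps_of_notMem]
    · rfl
    · rw [List.mem_flatMap]
      rintro ⟨G, hG, h⟩
      obtain ⟨r, j, _, rfl⟩ := hmem G hG
      simp [Gate.qubits] at h
  · rw [labelMaps_of_notMem]
    · rfl
    · rw [List.mem_flatMap]
      rintro ⟨G, hG, h⟩
      obtain ⟨r, j, _, rfl⟩ := hmem G hG
      simp [Gate.qubits] at h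
  · obtain ⟨⟨r, j⟩, rfl⟩ := finProdFinEquiv.surjective i
    simp only [joinLabel_ancilla, doublingMap, Equiv.symm_apply_apply]
    by_cases hr : w ≤ r ∧ r < w + w
    · rw [labelMaps_of_mem (doublingLayer_nodup w hw) (hG r j hr) (by simp [Gate.qubits]),
        if_pos hr]
      simp [Gate.labelMap]
    · rw [if_neg hr, add_zero]
      -- the qubit is a control or is not acted upon
      by_cases hm : Sum.inr (Sum.inr (finProdFinEquiv (r, j))) ∈
          (doublingLayer n s w).flatMap Gate.qubits
      · obtain ⟨G, hGm, hq⟩ := List.mem_flatMap.1 hm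
        rw [labelMaps_of_mem (doublingLayer_nodup w hw) hGm hq]
        obtain ⟨r', j', h', rfl⟩ := hmem G hGm
        rw [Gate.labelMap, Function.update_of_ne]
        · rfl
        · intro he
          simp only [Sum.inr.injEq, EmbeddingLike.apply_eq_iff_eq, Prod.mk.injEq] at he
          rw [he.1] at hr
          exact hr h'
      · rw [labelMaps_of_notMem hm]
        rfl

/-- The inverses of the first `l` doublings. -/
def unfillMap (n s : ℕ) : ℕ → (Fin ((s + 1) * n) → ZMod 2) → Fin ((s + 1) * n) → ZMod 2
  | 0, k => k
  | l + 1, k => unfillMap n s l (doublingMap n s (2 ^ l) k)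

/-- The first `l` doublings. -/
def fillMap (n s : ℕ) : ℕ → (Fin ((s + 1) * n) → ZMod 2) → Fin ((s + 1) * n) → ZMod 2
  | 0, k => k
  | l + 1, k => doublingMap n s (2 ^ l) (fillMap n s l k)

theorem unfillMap_fillMap (l : ℕ) (k : Fin ((s + 1) * n) → ZMod 2) :
    unfillMap n s l (fillMap n s l k) = k := by
  induction l with
  | zero => rfl
  | succ l ih => rw [unfillMap, fillMap, doublingMap_doublingMap, ih]

theorem doublings_act (L : ℕ) : ActsOnAncillas
    ((List.finRange L).map fun l : Fin L => doublingLayer n s (2 ^ (l : ℕ)))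
    fun _ => unfillMap n s L := by
  induction L with
  | zero => intro f g e k; rfl
  | succ L ih =>
    rw [List.finRange_succ_last, List.map_append, List.map_map]
    exact ih.append (doublingLayer_acts _ (by positivity))

theorem doublings_reversed_act (L : ℕ) : ActsOnAncillas
    ((List.finRange L).map fun l : Fin L => doublingLayer n s (2 ^ (L - (l + 1))))
    fun _ => fillMap n s L := by
  induction L with
  | zero => intro f g e k; rfl
  | succ L ih =>
    have : (List.finRange (L + 1)).map
        (fun l : Fin (L + 1) => doublingLayer n s (2 ^ (L + 1 - (l + 1)))) =
        [doublingLayer n s (2 ^ L)] ++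
          (List.finRange L).map fun l : Fin L => doublingLayer n s (2 ^ (L - (l + 1))) := by
      rw [List.finRange_succ, List.map_cons, List.map_map]
      simp only [Fin.val_zero, List.singleton_append, List.cons.injEq]
      refine ⟨by simp, List.map_congr_left fun l _ => ?_⟩
      simp
    rw [this]
    exact (doublingLayer_acts _ (by positivity)).append ih

/-- After `l` doublings, starting from ancillas `|0⟩`, the first `2 ^ l` rows hold the group
register. -/
theorem fillMap_copyMap (g : Bits n) (l : ℕ) (r : Fin (s + 1)) (j : Fin n) :
    fillMap n s l (copyMap n s g 0) (finProdFinEquiv (r, j)) =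
      if (r : ℕ) < 2 ^ l then g j else 0 := by
  induction l generalizing r with
  | zero =>
    simp only [fillMap, copyMap, Equiv.symm_apply_apply, Pi.zero_apply, zero_add, pow_zero,
      Nat.lt_one_iff, Fin.ext_iff, Fin.val_zero]
  | succ l ih =>
    rw [fillMap]
    simp only [doublingMap, Equiv.symm_apply_apply, ih]
    rw [pow_succ]
    split_ifs <;> first | omega | simp

theorem labelMaps_swapLayer (g : Bits n) (e : Copy s × Fin n → ZMod 2)
    (k : Fin ((s + 1) * n) → ZMod 2) :
    labelMaps (swapLayer n s) (joinLabel g e k) =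
      joinLabel g (fun p => if k (finProdFinEquiv (p.1.1.castSucc, p.2)) = 1 then
        e ((p.1.1, p.1.2 + 1), p.2) else e p) k := by
  have hG : ∀ r j, Gate.cswap (ancillaQubit r.castSucc j) (copyQubit r 0 j) (copyQubit r 1 j) ∈
      swapLayer n s := fun r j => by simp [swapLayer]
  have hmem : ∀ G ∈ swapLayer n s, ∃ r j, G =
      Gate.cswap (ancillaQubit r.castSucc j) (copyQubit r 0 j) (copyQubit r 1 j) := by
    intro G hG
    simp only [swapLayer, List.mem_flatMap, List.mem_singleton] at hG
    obtain ⟨r, -, j, -, rfl⟩ := hG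
    exact ⟨r, j, rfl⟩
  funext q
  rcases q with j | ⟨⟨r, b⟩, j⟩ | i
  · rw [labelMaps_of_notMem]
    · rfl
    · rw [List.mem_flatMap]
      rintro ⟨G, hG, h⟩
      obtain ⟨r, j, rfl⟩ := hmem G hG
      simp [Gate.qubits] at h
  · rw [labelMaps_of_mem swapLayer_nodup (hG r j) (by fin_cases b <;> simp [Gate.qubits])]
    simp only [labelMap_cswap, joinLabel_copy, joinLabel_ancilla]
    by_cases h : k (finProdFinEquiv (r.castSucc, j)) = 1
    · simp only [h, if_true]
      fin_cases b <;> simp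
    · simp only [h, if_false]
  · by_cases hm : Sum.inr (Sum.inr i) ∈ (swapLayer n s).flatMap Gate.qubits
    · obtain ⟨G, hGm, hq⟩ := List.mem_flatMap.1 hm
      rw [labelMaps_of_mem swapLayer_nodup hGm hq]
      obtain ⟨r, j, rfl⟩ := hmem G hGm
      rw [labelMap_cswap, Equiv.swap_apply_of_ne_of_ne (by simp) (by simp), ite_self]
      rfl
    · rw [labelMaps_of_notMem hm]
      rfl

/-- The adaptive circuit samples from the nullspace of the kept samples. The fan-out is undone after
the controlled swaps, so that the ancillas return to zero and do not destroy the interference in the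
group register. -/
theorem implementsFourier_adaptiveCircuit (ys : List (Bits n)) :
    ImplementsFourier (adaptiveCircuit n s ys) (subspaceState (orth ys)) := by
  have hassoc : adaptiveCircuit n s ys = prepareCircuit s _ (elim ys) ++
      ((fanoutCircuit n s ++ ([swapLayer n s] ++ faninCircuit n s)) ++ [hadLayer n s _]) := by
    simp [adaptiveCircuit]
  rw [hassoc]
  refine implementsFourier_of_parts (hassoc ▸ adaptiveCircuit_valid ys)
    (apply_prepareCircuit ys) fun ψ g e k => ?_
  set L := levels s with hL
  have hout : ActsOnAncillas (fanoutCircuit n s) fun g k => copyMap n s g (unfillMap n s L k) :=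
    copyLayer_acts.append (doublings_act L)
  have hin : ActsOnAncillas (faninCircuit n s) fun g k => fillMap n s L (copyMap n s g k) :=
    (doublings_reversed_act L).append copyLayer_acts
  have hswap : ∀ G ∈ swapLayer n s, G.IsReversible := by
    intro G hG
    simp only [swapLayer, List.mem_flatMap, List.mem_singleton] at hG
    obtain ⟨r, -, j, -, rfl⟩ := hG
    trivial
  rw [Circuit.apply_append, Circuit.apply_append, hin, Circuit.apply_singleton,
    foldl_apply_of_isReversible hswap, labelMaps_swapLayer, hout]
  simp only [unfillMap_fillMap, copyMap_copyMap, preparedState_joinLabel]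
  split_ifs with hk
  · subst hk
    congr 2
    funext p
    have hlt : ((p.1.1.castSucc : Fin (s + 1)) : ℕ) < 2 ^ L := by
      have h1 : ¬ 2 ^ L < s + 1 := fun h => (lt_levels_iff.2 h).ne hL
      have h2 := p.1.1.2
      simp only [Fin.val_castSucc]
      omega
    have hval := fillMap_copyMap g L p.1.1.castSucc p.2
    rw [if_pos hlt] at hval
    simp only [hval]
    rfl
  · rfl

end Fanout

/-! ### Overlaps and outcome statistics -/

/-- The bit assignment that agrees with `b` where `v` is `1`, and with `a` elsewhere. -/
def mix {Q : Type} (v a b : Q → ZMod 2) : Q → ZMod 2 := fun q => if v q = 1 then b q else a q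

/-- The overlap of `|φ⟩|φ⟩` with the state obtained by exchanging the qubits `q` with `v q = 1` of
the two copies. It equals the purity of the reduced state on these qubits. -/
def swapOverlap {Q : Type} [Fintype Q] [DecidableEq Q] (φ : QSpace Q) (v : Q → ZMod 2) : ℂ :=
  ∑ p : (Q → ZMod 2) × (Q → ZMod 2),
    φ p.1 * φ p.2 * star (φ (mix v p.1 p.2) * φ (mix v p.2 p.1))

section Statistics

variable {n s a : ℕ}

theorem mul_self_zmod_two (x : Bits n) : x + x = 0 := by
  funext j
  exact CharTwo.add_self_eq_zero _

/-- Orthogonality of the characters of `ℤ₂ⁿ`. -/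
theorem sum_sign (u : Bits n) : ∑ y : Bits n, sign (u ⬝ᵥ y) = if u = 0 then (2 : ℂ) ^ n else 0 := by
  split_ifs with h
  · subst h
    simp [ZMod.card]
  · obtain ⟨j, hj⟩ := Function.ne_iff.1 h
    have hj1 : u j = 1 := (zmod_two_eq_zero_or_one _).resolve_left hj
    have h1 : ∑ y : Bits n, sign (u ⬝ᵥ y) = -∑ y : Bits n, sign (u ⬝ᵥ y) := by
      rw [← Finset.sum_neg_distrib]
      refine Fintype.sum_equiv (Equiv.addRight (Pi.single j 1)) _ _ fun y => ?_
      rw [Equiv.coe_addRight, dotProduct_add, sign_add]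
      simp [hj1]
    exact self_eq_neg.1 h1

theorem star_sign (b : ZMod 2) : star (sign b) = sign b := by
  rcases zmod_two_eq_zero_or_one b with rfl | rfl <;> simp

/-- The Fourier coefficients of the outcome distribution. -/
theorem sum_sign_mul_norm_hadamardAll (G : Bits n → ℂ) (v : Bits n) :
    ∑ y, sign (y ⬝ᵥ v) * ((‖hadamardAll G y‖ ^ 2 : ℝ) : ℂ) = ∑ x, G x * star (G (x + v)) := by
  have h2 : ((1 / Real.sqrt (2 ^ n) : ℂ)) * star (1 / Real.sqrt (2 ^ n) : ℂ) * 2 ^ n = 1 := by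
    have h3 : (Real.sqrt (2 ^ n) : ℂ) * Real.sqrt (2 ^ n) = 2 ^ n := by
      rw [← Complex.ofReal_mul, Real.mul_self_sqrt (by positivity)]
      push_cast
      rfl
    have h4 : (Real.sqrt (2 ^ n) : ℂ) ≠ 0 := by
      rw [Complex.ofReal_ne_zero]
      positivity
    simp only [Complex.star_def, map_div₀, map_one, Complex.conj_ofReal]
    rw [← h3]
    field_simp
  have hexp : ∀ y, sign (y ⬝ᵥ v) * ((‖hadamardAll G y‖ ^ 2 : ℝ) : ℂ) =
      (1 / Real.sqrt (2 ^ n) : ℂ) * star (1 / Real.sqrt (2 ^ n) : ℂ) *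
        ∑ x, ∑ x', G x * star (G x') * sign ((x + x' + v) ⬝ᵥ y) := by
    intro y
    have h5 : ((‖hadamardAll G y‖ ^ 2 : ℝ) : ℂ) = hadamardAll G y * star (hadamardAll G y) := by
      rw [Complex.star_def, Complex.mul_conj, Complex.normSq_eq_norm_sq]
    rw [h5, hadamardAll, star_mul', star_sum]
    have h6 : ∀ A B c d e : ℂ, e * ((c * A) * (d * B)) = c * d * (e * (A * B)) := by
      intros; ring
    rw [h6, Finset.sum_mul_sum, Finset.mul_sum]
    congr 1
    refine Finset.sum_congr rfl fun x _ => ?_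
    rw [Finset.mul_sum]
    refine Finset.sum_congr rfl fun x' _ => ?_
    rw [star_mul', star_sign, add_dotProduct, add_dotProduct, sign_add, sign_add,
      dotProduct_comm y v]
    ring
  rw [Finset.sum_congr rfl fun y _ => hexp y, ← Finset.mul_sum, Finset.sum_comm]
  rw [Finset.sum_congr rfl fun x _ => Finset.sum_comm]
  simp only [← Finset.mul_sum, sum_sign]
  rw [Finset.mul_sum]
  refine Finset.sum_congr rfl fun x _ => ?_
  rw [Finset.sum_eq_single (x + v)]
  · rw [if_pos]
    · linear_combination (G x * star (G (x + v))) * h2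
    · rw [← add_assoc, mul_self_zmod_two, zero_add, mul_self_zmod_two]
  · intro x' _ hx'
    rw [if_neg, mul_zero]
    intro h
    refine hx' ?_
    have h7 : x' = (x + x' + v) + (x + v) := by
      have : x + x' + v + (x + v) = x' + (x + x) + (v + v) := by abel
      rw [this, mul_self_zmod_two, mul_self_zmod_two, add_zero, add_zero]
    rw [h7, h, zero_add]
  · simp

theorem permute_permute (x v : Bits n) (e : Copy s × Fin n → ZMod 2) :
    permute (x + v) e = permute v (permute x e) := by
  have h2 : ∀ b : Fin 2, b + 1 + 1 = b := by decide
  have h3 : (1 : ZMod 2) + 1 = 0 := by decide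
  funext p
  simp only [permute, Pi.add_apply]
  rcases zmod_two_eq_zero_or_one (x p.2) with hx | hx <;>
    rcases zmod_two_eq_zero_or_one (v p.2) with hv | hv <;> simp [hx, hv, h2, h3]

theorem permute_self (x : Bits n) (e : Copy s × Fin n → ZMod 2) :
    permute x (permute x e) = e := by
  rw [← permute_permute, mul_self_zmod_two]
  funext p
  simp [permute]

/-- A labelling of all copies is a labelling of each pair of copies. -/
def pairsEquiv (n s : ℕ) : (Copy s × Fin n → ZMod 2) ≃ (Fin s → Bits n × Bits n) where
  toFun e r := (fun j => e ((r, 0), j), fun j => e ((r, 1), j))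
  invFun h p := if p.1.2 = 0 then (h p.1.1).1 p.2 else (h p.1.1).2 p.2
  left_inv e := by
    funext ⟨⟨r, b⟩, j⟩
    fin_cases b <;> simp
  right_inv h := by
    funext r
    simp

/-- The overlap of `2 s` copies with their permuted version factorizes over the pairs of copies. -/
theorem sum_copies_mul_star (ψ : QSpace (Fin n)) (v : Bits n) :
    ∑ e, copies ψ s e * star (copies ψ s (permute v e)) = swapOverlap ψ v ^ s := by
  have hpow : ∀ T : Bits n × Bits n → ℂ, (∑ p, T p) ^ s = ∑ h : Fin s → Bits n × Bits n,
      ∏ r, T (h r) := fun T => Fintype.sum_pow T s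
  rw [swapOverlap, hpow]
  refine Fintype.sum_equiv (pairsEquiv n s) _ _ fun e => ?_
  simp only [copies, Fintype.prod_prod_type, Fin.prod_univ_two]
  rw [star_prod, ← Finset.prod_mul_distrib]
  refine Finset.prod_congr rfl fun r _ => ?_
  have h0 : (fun j => permute v e ((r, 0), j)) =
      mix v (pairsEquiv n s e r).1 (pairsEquiv n s e r).2 := by
    funext j
    simp [permute, mix, pairsEquiv]
  have h1 : (fun j => permute v e ((r, 1), j)) =
      mix v (pairsEquiv n s e r).2 (pairsEquiv n s e r).1 := by
    funext j
    simp [permute, mix, pairsEquiv]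
  rw [h0, h1]
  rfl

theorem sum_fourierState (V : Submodule (ZMod 2) (Bits n)) (ψ : QSpace (Fin n)) {v : Bits n}
    (hv : v ∈ V) :
    ∑ y, sign (y ⬝ᵥ v) * ((∑ e, ‖fourierState (subspaceState V) ψ s y e‖ ^ 2 : ℝ) : ℂ) =
      swapOverlap ψ v ^ s := by
  classical
  simp only [Complex.ofReal_sum, Finset.mul_sum]
  rw [Finset.sum_comm]
  simp only [fourierState, sum_sign_mul_norm_hadamardAll]
  rw [Finset.sum_comm]
  have hterm : ∀ x, ∑ e, subspaceState V x * copies ψ s (permute x e) *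
      star (subspaceState V (x + v) * copies ψ s (permute (x + v) e)) =
      (if x ∈ V then (1 / (Nat.card V : ℂ)) else 0) * swapOverlap ψ v ^ s := by
    intro x
    rw [← sum_copies_mul_star]
    have hxv : x + v ∈ V ↔ x ∈ V := Submodule.add_mem_iff_left V hv
    by_cases hx : x ∈ V
    · have hsq : (1 / Real.sqrt (Nat.card V) : ℂ) * star (1 / Real.sqrt (Nat.card V) : ℂ) =
          1 / (Nat.card V : ℂ) := by
        simp only [Complex.star_def, map_div₀, map_one, Complex.conj_ofReal]
        rw [div_mul_div_comm, one_mul, ← Complex.ofReal_mul, Real.mul_self_sqrt (by positivity)]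
        simp
      rw [if_pos hx, ← hsq, Finset.mul_sum]
      refine Fintype.sum_equiv ⟨permute x, permute x, permute_self x, permute_self x⟩ _ _
        fun e => ?_
      simp only [Equiv.coe_fn_mk, subspaceState, if_pos hx, if_pos (hxv.2 hx), permute_permute,
        star_mul']
      ring
    · rw [if_neg hx, zero_mul]
      simp [subspaceState, hx]
  rw [Finset.sum_congr rfl fun x _ => hterm x, ← Finset.sum_mul, ← Finset.sum_filter,
    Finset.sum_const, ← Fintype.card_subtype, nsmul_eq_mul]
  have hcard : (Fintype.card {x // x ∈ V} : ℂ) = Nat.card V := by rw [Nat.card_eq_fintype_card]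
  have hne : (Nat.card V : ℂ) ≠ 0 := Nat.cast_ne_zero.2 Nat.card_pos.ne'
  rw [hcard, mul_one_div_cancel hne, one_mul]

/-- Basis labels correspond to triples of labels of the three registers. -/
def labelEquiv (n s a : ℕ) : Bits n × (Copy s × Fin n → ZMod 2) × (Fin a → ZMod 2) ≃
    (Qubit n s a → ZMod 2) where
  toFun t := joinLabel t.1 t.2.1 t.2.2
  invFun x := (fun i => x (Sum.inl i), fun p => x (Sum.inr (Sum.inl p)),
    fun k => x (Sum.inr (Sum.inr k)))
  left_inv _ := rfl
  right_inv x := joinLabel_eta x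

/-- In the final state of the circuit all ancillas are zero, so only the amplitudes of the input
register are summed over. -/
theorem outcomeProb_eq {C : Circuit (Qubit n s a)} {γ : Bits n → ℂ} (hC : ImplementsFourier C γ)
    (ψ : QSpace (Fin n)) (y : Bits n) :
    outcomeProb C ψ y = ∑ e, ‖fourierState γ ψ s y e‖ ^ 2 := by
  have hval : ∀ e k, C.apply (initialState ψ s a) (labelEquiv n s a (y, e, k)) =
      if k = 0 then fourierState γ ψ s y e else 0 := by
    intro e k
    rw [hC.2 ψ]
    by_cases hk : k = 0
    · rw [if_pos hk]
      exact if_pos fun i => congrFun hk i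
    · rw [if_neg hk]
      exact if_neg fun h => hk (funext h)
  rw [outcomeProb, ← (labelEquiv n s a).sum_comp, Fintype.sum_prod_type,
    Finset.sum_eq_single y]
  · rw [Fintype.sum_prod_type]
    refine Finset.sum_congr rfl fun e _ => ?_
    rw [Finset.sum_eq_single 0]
    · refine (if_pos rfl).trans ?_
      rw [hval, if_pos rfl]
    · intro k _ hk
      refine (if_pos rfl).trans ?_
      rw [hval, if_neg hk]
      simp
    · simp
  · intro g _ hg
    refine Finset.sum_eq_zero fun t _ => ?_
    rw [if_neg]
    exact hg
  · simp

theorem outcomeProb_nonneg (C : Circuit (Qubit n s a)) (ψ : QSpace (Fin n)) (y : Bits n) :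
    0 ≤ outcomeProb C ψ y :=
  Finset.sum_nonneg fun x _ => by split_ifs <;> positivity

theorem sum_sign_mul_outcomeProb {C : Circuit (Qubit n s a)} {V : Submodule (ZMod 2) (Bits n)}
    (hC : ImplementsFourier C (subspaceState V)) (ψ : QSpace (Fin n)) {v : Bits n} (hv : v ∈ V) :
    ∑ y, sign (y ⬝ᵥ v) * (outcomeProb C ψ y : ℂ) = swapOverlap ψ v ^ s := by
  simp only [outcomeProb_eq hC]
  exact sum_fourierState V ψ hv

theorem mix_zero {Q : Type} (a b : Q → ZMod 2) : mix 0 a b = a := by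
  funext q
  simp [mix]

theorem norm_sq_eq_sum {Q : Type} [Fintype Q] [DecidableEq Q] (φ : QSpace Q) :
    ((‖φ‖ ^ 2 : ℝ) : ℂ) = ∑ x, φ x * star (φ x) := by
  rw [EuclideanSpace.norm_sq_eq, Complex.ofReal_sum]
  refine Finset.sum_congr rfl fun x _ => ?_
  rw [Complex.star_def, Complex.mul_conj, Complex.normSq_eq_norm_sq]

theorem swapOverlap_zero {Q : Type} [Fintype Q] [DecidableEq Q] (φ : QSpace Q) :
    swapOverlap φ 0 = ((‖φ‖ ^ 4 : ℝ) : ℂ) := by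
  have : ((‖φ‖ ^ 4 : ℝ) : ℂ) = ((‖φ‖ ^ 2 : ℝ) : ℂ) * ((‖φ‖ ^ 2 : ℝ) : ℂ) := by
    rw [← Complex.ofReal_mul]; ring_nf
  rw [this, norm_sq_eq_sum, Finset.sum_mul_sum, swapOverlap, Fintype.sum_prod_type]
  refine Finset.sum_congr rfl fun x _ => Finset.sum_congr rfl fun y _ => ?_
  rw [mix_zero, mix_zero, star_mul']
  ring

/-- The probability that the outcome is orthogonal to a vector `v` of the subspace. -/
theorem sum_outcomeProb_orthogonal {C : Circuit (Qubit n s a)} {V : Submodule (ZMod 2) (Bits n)}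
    (hC : ImplementsFourier C (subspaceState V)) {ψ : QSpace (Fin n)} (hψ : ‖ψ‖ = 1)
    {v : Bits n} (hv : v ∈ V) {p : ℝ} (hp : swapOverlap ψ v = p) :
    ∑ y, outcomeProb C ψ y = 1 ∧
      ∑ y, (if y ⬝ᵥ v = 0 then outcomeProb C ψ y else 0) = (1 + p ^ s) / 2 := by
  have h0 := sum_sign_mul_outcomeProb hC ψ (Submodule.zero_mem V)
  have h1 := sum_sign_mul_outcomeProb hC ψ hv
  rw [swapOverlap_zero, hψ] at h0
  simp only [dotProduct_zero, sign_zero, one_mul, one_pow, Complex.ofReal_one] at h0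
  have h0' : ∑ y, outcomeProb C ψ y = 1 := by exact_mod_cast h0
  refine ⟨h0', ?_⟩
  rw [hp] at h1
  have h2 : ((∑ y, (if y ⬝ᵥ v = 0 then outcomeProb C ψ y else 0) : ℝ) : ℂ) =
      ∑ y, (1 + sign (y ⬝ᵥ v)) / 2 * (outcomeProb C ψ y : ℂ) := by
    rw [Complex.ofReal_sum]
    refine Finset.sum_congr rfl fun y _ => ?_
    rcases zmod_two_eq_zero_or_one (y ⬝ᵥ v) with h | h <;> simp [h]
  have h3 : ∑ y, (1 + sign (y ⬝ᵥ v)) / 2 * (outcomeProb C ψ y : ℂ) = ((1 + p ^ s) / 2 : ℂ) := by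
    rw [← h1]
    conv_rhs => rw [← h0]
    rw [← Finset.sum_add_distrib, Finset.sum_div]
    exact Finset.sum_congr rfl fun y _ => by ring
  rw [h3] at h2
  exact_mod_cast h2

end Statistics

/-! ### The success probability -/

/-- The vectors that are constant on each part of `P`. -/
def cutSpace {n : ℕ} (P : Finpartition (Finset.univ : Finset (Fin n))) :
    Submodule (ZMod 2) (Bits n) where
  carrier := {z | ∀ i j, P.part i = P.part j → z i = z j}
  add_mem' := by
    intro a b ha hb i j hij
    rw [Pi.add_apply, Pi.add_apply, ha i j hij, hb i j hij]
  zero_mem' := fun _ _ _ => rfl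
  smul_mem' := by
    intro c z hz i j hij
    rw [Pi.smul_apply, Pi.smul_apply, hz i j hij]

/-- The label of `i` is the least index in its class, so equality of labels is equality of
classes. -/
theorem cutLabels_eq_iff {n : ℕ} (V : Submodule (ZMod 2) (Bits n)) (i j : Fin n) :
    cutLabels V i = cutLabels V j ↔ ∀ z ∈ V, z i = z j := by
  have hmem : ∀ i : Fin n, ∃ k : Fin n, (k : ℕ) = cutLabels V i ∧ ∀ z ∈ V, z k = z i := by
    intro i
    have hne : {k | ∃ j : Fin n, (j : ℕ) = k ∧ ∀ z ∈ V, z j = z i}.Nonempty :=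
      ⟨i, i, rfl, fun _ _ => rfl⟩
    exact Nat.sInf_mem hne
  constructor
  · intro h z hz
    obtain ⟨k, hk, hki⟩ := hmem i
    obtain ⟨l, hl, hlj⟩ := hmem j
    have : k = l := Fin.ext (by rw [hk, hl, h])
    rw [← hki z hz, ← hlj z hz, this]
  · intro h
    simp only [cutLabels]
    congr 1
    ext k
    refine exists_congr fun l => and_congr_right fun _ => forall₂_congr fun z hz => ?_
    rw [h z hz]

theorem identifies_cutSpace {n : ℕ} (P : Finpartition (Finset.univ : Finset (Fin n))) :
    Identifies (cutLabels (cutSpace P)) P := by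
  classical
  intro i j
  rw [cutLabels_eq_iff]
  constructor
  · intro h
    have hz : (fun k => if P.part k = P.part i then (1 : ZMod 2) else 0) ∈ cutSpace P := by
      intro k l hkl
      simp only [hkl]
    have := h _ hz
    simp only [if_true] at this
    by_contra hne
    rw [if_neg fun h => hne h.symm] at this
    exact one_ne_zero this
  · intro h z hz
    exact hz i j h

open Classical in
/-- The failure probability shrinks by a factor `θ` per round: each vector of the current nullspace
that is not constant on the parts survives a round with probability at most `θ`. -/
theorem one_sub_successFrom_le (A : HybridAlgorithm) {n s : ℕ} {ψ : QSpace (Fin n)} (hψ : ‖ψ‖ = 1)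
    (P : Finpartition (Finset.univ : Finset (Fin n)))
    {V : List (Bits n) → Submodule (ZMod 2) (Bits n)} (hV : ∀ ys, orth ys ≤ V ys)
    (hC : ∀ ys, ImplementsFourier (A.circuit n s ys) (subspaceState (V ys)))
    (hout : ∀ ys, A.output n s ys = cutLabels (orth ys))
    {p : Bits n → ℝ} (hp : ∀ v, swapOverlap ψ v = p v) (hp1 : ∀ v ∈ cutSpace P, p v = 1)
    {θ : ℝ} (hθ0 : 0 ≤ θ) (hθ : ∀ v, v ∉ cutSpace P → p v ^ s ≤ 2 * θ - 1) (r : ℕ) :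
    ∀ ys : List (Bits n), cutSpace P ≤ orth ys → 1 - A.successFrom s ψ P r ys ≤
      θ ^ r * (Finset.univ.filter fun v => v ∈ orth ys ∧ v ∉ cutSpace P).card := by
  induction r with
  | zero =>
    intro ys hys
    rw [HybridAlgorithm.successFrom, pow_zero, one_mul]
    by_cases hI : Identifies (A.output n s ys) P
    · rw [if_pos hI, sub_self]
      positivity
    · rw [if_neg hI, sub_zero, Nat.one_le_cast, Nat.one_le_iff_ne_zero, Finset.card_ne_zero]
      by_contra hne
      refine hI ?_
      have : orth ys = cutSpace P := by
        refine le_antisymm (fun v hv => ?_) hys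
        by_contra hvP
        exact hne ⟨v, by simp [hv, hvP]⟩
      rw [hout, this]
      exact identifies_cutSpace P
  | succ r ih =>
    intro ys hys
    set q := outcomeProb (A.circuit n s ys) ψ with hq
    have hq0 : ∀ y, 0 ≤ q y := outcomeProb_nonneg _ ψ
    have hstat : ∀ v ∈ orth ys, ∑ y, q y = 1 ∧
        ∑ y, (if y ⬝ᵥ v = 0 then q y else 0) = (1 + p v ^ s) / 2 := fun v hv =>
      sum_outcomeProb_orthogonal (hC ys) hψ (hV ys hv) (hp v)
    have hsum : ∑ y, q y = 1 := (hstat 0 (Submodule.zero_mem _)).1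
    -- a vector `w` constant on the parts is orthogonal to the outcome with probability
    -- `(1 + p w ^ s) / 2 = 1`
    have hsupp : ∀ y, q y ≠ 0 → cutSpace P ≤ orth (ys ++ [y]) := by
      intro y hy w hw
      refine mem_orth_append.2 ⟨hys hw, ?_⟩
      have h1 := (hstat w (hys hw)).2
      rw [hp1 w hw, one_pow, add_self_div_two, ← hsum] at h1
      have h2 : ∀ y ∈ Finset.univ, (if y ⬝ᵥ w = 0 then q y else 0) ≤ q y := fun y _ => by
        split_ifs
        · exact le_rfl
        · exact hq0 y
      have h3 := (Finset.sum_eq_sum_iff_of_le h2).1 h1 y (Finset.mem_univ y)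
      by_contra hne
      rw [if_neg hne] at h3
      exact hy h3.symm
    rw [HybridAlgorithm.successFrom]
    calc 1 - ∑ y, q y * A.successFrom s ψ P r (ys ++ [y])
        = ∑ y, q y * (1 - A.successFrom s ψ P r (ys ++ [y])) := by
          simp only [mul_sub, mul_one, Finset.sum_sub_distrib, hsum]
      _ ≤ ∑ y, q y * (θ ^ r *
            (Finset.univ.filter fun v => v ∈ orth (ys ++ [y]) ∧ v ∉ cutSpace P).card) := by
          refine Finset.sum_le_sum fun y _ => ?_
          by_cases hy : q y = 0
          · rw [hy, zero_mul, zero_mul]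
          · exact mul_le_mul_of_nonneg_left (ih _ (hsupp y hy)) (hq0 y)
      -- exchange the sums: count for each `v` the outcomes orthogonal to it
      _ = θ ^ r * ∑ v with v ∈ orth ys ∧ v ∉ cutSpace P,
            ∑ y, (if y ⬝ᵥ v = 0 then q y else 0) := by
          rw [Finset.sum_comm, Finset.mul_sum]
          refine Finset.sum_congr rfl fun y _ => ?_
          rw [mul_left_comm]
          congr 1
          rw [← Finset.sum_filter, Finset.sum_const, nsmul_eq_mul, mul_comm, Finset.filter_filter]
          congr 3
          ext v
          simp only [Finset.mem_filter, Finset.mem_univ, true_and, mem_orth_append]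
          tauto
      _ ≤ θ ^ r * ∑ v with v ∈ orth ys ∧ v ∉ cutSpace P, θ := by
          refine mul_le_mul_of_nonneg_left (Finset.sum_le_sum fun v hv => ?_) (by positivity)
          simp only [Finset.mem_filter, Finset.mem_univ, true_and] at hv
          rw [(hstat v hv.1).2]
          linarith [hθ v hv.2]
      _ = _ := by
          rw [Finset.sum_const, nsmul_eq_mul, pow_succ]
          ring

/-- The union bound for the whole algorithm: without samples at most `2 ^ n` vectors have to be
excluded. The subspace `V ys` is the nullspace for the adaptive and the whole space for the
non-adaptive algorithm. -/
theorem one_sub_successProb_le (A : HybridAlgorithm) {n s : ℕ} {ψ : QSpace (Fin n)} (hψ : ‖ψ‖ = 1)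
    (P : Finpartition (Finset.univ : Finset (Fin n)))
    {V : List (Bits n) → Submodule (ZMod 2) (Bits n)} (hV : ∀ ys, orth ys ≤ V ys)
    (hC : ∀ ys, ImplementsFourier (A.circuit n s ys) (subspaceState (V ys)))
    (hout : ∀ ys, A.output n s ys = cutLabels (orth ys))
    {p : Bits n → ℝ} (hp : ∀ v, swapOverlap ψ v = p v) (hp1 : ∀ v ∈ cutSpace P, p v = 1)
    {θ : ℝ} (hθ0 : 0 ≤ θ) (hθ : ∀ v, v ∉ cutSpace P → p v ^ s ≤ 2 * θ - 1) (r : ℕ) :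
    1 - A.successProb r s ψ P ≤ θ ^ r * 2 ^ n := by
  classical
  have h := one_sub_successFrom_le A hψ P hV hC hout hp hp1 hθ0 hθ r []
    (fun v _ y hy => by simp at hy)
  refine h.trans (mul_le_mul_of_nonneg_left ?_ (by positivity))
  have hcard : (Finset.univ : Finset (Bits n)).card = 2 ^ n := by
    simp [ZMod.card]
  calc ((Finset.univ.filter fun v : Bits n => v ∈ orth [] ∧ v ∉ cutSpace P).card : ℝ)
      ≤ ((Finset.univ : Finset (Bits n)).card : ℝ) := by
        exact_mod_cast Finset.card_filter_le _ _
    _ = 2 ^ n := by rw [hcard]; push_cast; rfl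

/-! ### Overlaps of product states -/

section Product

variable {n : ℕ} (P : Finpartition (Finset.univ : Finset (Fin n)))

/-- The part containing `i`. -/
def partOf (i : Fin n) : {C // C ∈ P.parts} := ⟨P.part i, P.part_mem.2 (Finset.mem_univ i)⟩

theorem mem_partOf (i : Fin n) : i ∈ (partOf P i).1 := P.mem_part_self.2 (Finset.mem_univ i)

theorem partOf_eq {C : {C // C ∈ P.parts}} {i : Fin n} (hi : i ∈ C.1) : partOf P i = C :=
  Subtype.ext (P.part_eq_of_mem C.2 hi)

/-- Labels of all qubits are labels of the qubits of each part. -/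
def restrictEquiv : Bits n ≃ ((C : {C // C ∈ P.parts}) → PartQubits P C → ZMod 2) where
  toFun x C i := x i.1
  invFun f i := f (partOf P i) ⟨i, mem_partOf P i⟩
  left_inv x := rfl
  right_inv f := by
    funext C ⟨i, hi⟩
    obtain rfl := partOf_eq P hi
    rfl

theorem swapOverlap_productState (φ : (C : {C // C ∈ P.parts}) → QSpace (PartQubits P C))
    (v : Bits n) :
    swapOverlap (productState P φ) v = ∏ C, swapOverlap (φ C) (fun i => v i.1) := by
  simp only [swapOverlap]
  rw [Finset.prod_univ_sum, Fintype.piFinset_univ]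
  refine Fintype.sum_equiv (((restrictEquiv P).prodCongr (restrictEquiv P)).trans
    (Equiv.arrowProdEquivProdArrow _ _ _).symm) _ _ fun p => ?_
  simp only [productState]
  rw [← Finset.prod_mul_distrib, ← Finset.prod_mul_distrib, star_prod,
    ← Finset.prod_mul_distrib]
  rfl

theorem norm_productState {φ : (C : {C // C ∈ P.parts}) → QSpace (PartQubits P C)}
    (hφ : ∀ C, ‖φ C‖ = 1) : ‖productState P φ‖ = 1 := by
  have h := swapOverlap_productState P φ 0
  have h2 : ∀ C, swapOverlap (φ C) (fun i : PartQubits P C => (0 : Bits n) i.1) = 1 := by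
    intro C
    have := swapOverlap_zero (φ C)
    rw [hφ C, one_pow, Complex.ofReal_one] at this
    exact this
  rw [swapOverlap_zero, Finset.prod_congr rfl fun C _ => h2 C, Finset.prod_const_one] at h
  have h3 : ‖productState P φ‖ ^ 4 = 1 := by exact_mod_cast h
  exact (pow_eq_one_iff_of_nonneg (norm_nonneg _) (by norm_num)).1 h3

end Product

section Purity

variable {Q : Type} [Fintype Q] [DecidableEq Q]

omit [Fintype Q] [DecidableEq Q] in
theorem mix_mix (v a b : Q → ZMod 2) : mix v (mix v a b) (mix v b a) = a := by
  funext q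
  simp only [mix]
  split_ifs <;> rfl

/-- Exchanging the qubits selected by `v` between two labels. -/
def mixEquiv (v : Q → ZMod 2) : ((Q → ZMod 2) × (Q → ZMod 2)) ≃ ((Q → ZMod 2) × (Q → ZMod 2)) where
  toFun p := (mix v p.1 p.2, mix v p.2 p.1)
  invFun p := (mix v p.1 p.2, mix v p.2 p.1)
  left_inv p := by simp [mix_mix]
  right_inv p := by simp [mix_mix]

theorem star_swapOverlap (φ : QSpace Q) (v : Q → ZMod 2) :
    star (swapOverlap φ v) = swapOverlap φ v := by
  rw [swapOverlap, star_sum]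
  refine Fintype.sum_equiv (mixEquiv v) _ _ fun p => ?_
  simp only [mixEquiv, Equiv.coe_fn_mk, mix_mix, star_mul', star_star]
  ring

/-- The purity of the reduced state of `φ` on the qubits selected by `v`. -/
def purity (φ : QSpace Q) (v : Q → ZMod 2) : ℝ := (swapOverlap φ v).re

theorem swapOverlap_eq_purity (φ : QSpace Q) (v : Q → ZMod 2) :
    swapOverlap φ v = (purity φ v : ℂ) :=
  (Complex.conj_eq_iff_re.1 (star_swapOverlap φ v)).symm

/-- The defect of purity is half the sum of the squared `2 × 2` minors of the matrix of `φ` across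
the cut `v`. -/
theorem two_mul_one_sub_purity {φ : QSpace Q} (hφ : ‖φ‖ = 1) (v : Q → ZMod 2) :
    2 * (1 - purity φ v) = ∑ p : (Q → ZMod 2) × (Q → ZMod 2),
      ‖φ p.1 * φ p.2 - φ (mix v p.1 p.2) * φ (mix v p.2 p.1)‖ ^ 2 := by
  have h0 : ∑ p : (Q → ZMod 2) × (Q → ZMod 2), (φ p.1 * φ p.2) * star (φ p.1 * φ p.2) = 1 := by
    have := swapOverlap_zero φ
    rw [hφ] at this
    simpa [swapOverlap, mix_zero] using this
  have h1 : ∑ p : (Q → ZMod 2) × (Q → ZMod 2), (φ (mix v p.1 p.2) * φ (mix v p.2 p.1)) *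
      star (φ (mix v p.1 p.2) * φ (mix v p.2 p.1)) = 1 := by
    rw [← h0]
    exact Fintype.sum_equiv (mixEquiv v) _ _ fun p => rfl
  have h2 := swapOverlap_eq_purity φ v
  have h3 : star (swapOverlap φ v) = (purity φ v : ℂ) := by rw [star_swapOverlap, h2]
  rw [swapOverlap] at h2
  rw [swapOverlap, star_sum] at h3
  apply Complex.ofReal_injective
  push_cast
  have h4 : ∀ z : ℂ, (‖z‖ : ℂ) ^ 2 = z * star z := by
    intro z
    rw [Complex.star_def, Complex.mul_conj, Complex.normSq_eq_norm_sq]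
    push_cast
    rfl
  calc (2 * (1 - purity φ v) : ℂ) = 1 - purity φ v - purity φ v + 1 := by ring
    _ = _ := by
      conv_lhs => rw [← h0]
      nth_rewrite 1 [← h2]
      rw [← h3]
      conv_lhs => rw [h0]
      conv_lhs => enter [2]; rw [← h1]
      conv_lhs => enter [1,1,1]; rw [← h0]
      rw [← Finset.sum_sub_distrib, ← Finset.sum_sub_distrib, ← Finset.sum_add_distrib]
      refine Finset.sum_congr rfl fun p _ => ?_
      rw [h4, star_sub]
      simp only [star_mul', star_star]
      ring

theorem purity_le_one {φ : QSpace Q} (hφ : ‖φ‖ = 1) (v : Q → ZMod 2) : purity φ v ≤ 1 := by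
  have h := two_mul_one_sub_purity hφ v
  have : 0 ≤ ∑ p : (Q → ZMod 2) × (Q → ZMod 2),
      ‖φ p.1 * φ p.2 - φ (mix v p.1 p.2) * φ (mix v p.2 p.1)‖ ^ 2 := by positivity
  linarith

theorem purity_const {φ : QSpace Q} (hφ : ‖φ‖ = 1) {v : Q → ZMod 2} (hv : ∀ i j, v i = v j) :
    purity φ v = 1 := by
  have h := two_mul_one_sub_purity hφ v
  rw [Finset.sum_eq_zero] at h
  · linarith
  · intro p _
    have : (mix v p.1 p.2 = p.1 ∧ mix v p.2 p.1 = p.2) ∨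
        (mix v p.1 p.2 = p.2 ∧ mix v p.2 p.1 = p.1) := by
      by_cases h : ∃ i, v i = 1
      · obtain ⟨i, hi⟩ := h
        have : ∀ j, v j = 1 := fun j => (hv j i).trans hi
        right
        constructor <;> · funext q; simp [mix, this]
      · push Not at h
        left
        constructor <;> · funext q; simp [mix, h]
    rcases this with ⟨h1, h2⟩ | ⟨h1, h2⟩
    · simp [h1, h2]
    · simp [h1, h2, mul_comm]

/-! ### The matrix of a state across a bipartition -/

/-- The label that agrees with `x` on `S` and with `y` outside. -/
def glue (S : Finset Q) : (({q // q ∈ S} → ZMod 2) × ({q // q ∈ Sᶜ} → ZMod 2)) ≃ (Q → ZMod 2) where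
  toFun p q := if h : q ∈ S then p.1 ⟨q, h⟩ else p.2 ⟨q, Finset.mem_compl.2 h⟩
  invFun z := (fun q => z q.1, fun q => z q.1)
  left_inv p := by
    refine Prod.ext ?_ ?_
    · funext ⟨q, hq⟩
      simp [hq]
    · funext ⟨q, hq⟩
      simp [Finset.mem_compl.1 hq]
  right_inv z := by
    funext q
    simp

theorem mix_glue {v : Q → ZMod 2} {S : Finset Q} (hS : ∀ q, q ∈ S ↔ v q = 1)
    (x x' : {q // q ∈ S} → ZMod 2) (y y' : {q // q ∈ Sᶜ} → ZMod 2) :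
    mix v (glue S (x, y)) (glue S (x', y')) = glue S (x', y) := by
  funext q
  by_cases h : q ∈ S
  · simp [mix, glue, h, (hS q).1 h]
  · have : v q ≠ 1 := fun h' => h ((hS q).2 h')
    simp [mix, glue, h, this]

/-- The reduced density matrix on the qubits in `S`. -/
def reduced (φ : QSpace Q) (S : Finset Q) (x x' : {q // q ∈ S} → ZMod 2) : ℂ :=
  ∑ y, φ (glue S (x, y)) * star (φ (glue S (x', y)))

theorem purity_eq_sum_reduced (φ : QSpace Q) {v : Q → ZMod 2} {S : Finset Q}
    (hS : ∀ q, q ∈ S ↔ v q = 1) :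
    purity φ v = ∑ x', ∑ x, ‖reduced φ S x x'‖ ^ 2 := by
  apply Complex.ofReal_injective
  rw [← swapOverlap_eq_purity, swapOverlap,
    ← ((glue S).prodCongr (glue S)).sum_comp, Fintype.sum_prod_type]
  simp only [Equiv.prodCongr_apply, Prod.map, mix_glue hS, Fintype.sum_prod_type]
  have h4 : ∀ z : ℂ, ((‖z‖ ^ 2 : ℝ) : ℂ) = z * star z := by
    intro z
    rw [Complex.star_def, Complex.mul_conj, Complex.normSq_eq_norm_sq]
  simp only [Complex.ofReal_sum, h4]
  rw [Finset.sum_congr rfl fun x _ => Finset.sum_comm, Finset.sum_comm]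
  refine Finset.sum_congr rfl fun x' _ => Finset.sum_congr rfl fun x _ => ?_
  rw [reduced, star_sum, Finset.sum_mul_sum]
  refine Finset.sum_congr rfl fun y _ => Finset.sum_congr rfl fun y' _ => ?_
  simp only [star_mul', star_star]
  ring

theorem purity_nonneg (φ : QSpace Q) (v : Q → ZMod 2) : 0 ≤ purity φ v := by
  rw [purity_eq_sum_reduced φ (S := {q | v q = 1}) (by simp)]
  positivity

/-- If the overlap of `φ` with all product states across the cut `S` is at most `λ`, then so is the
purity of its reduced state: this applies the bound to the product of a column of the reduced
density matrix and a row of `φ`. -/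
theorem purity_le_of_overlap_le {φ : QSpace Q} (hφ : ‖φ‖ = 1) {v : Q → ZMod 2} {S : Finset Q}
    (hS : ∀ q, q ∈ S ↔ v q = 1) {l : ℝ} (hl : 0 ≤ l)
    (h : ∀ (a : QSpace {q // q ∈ S}) (b : QSpace {q // q ∈ Sᶜ}), ‖a‖ = 1 → ‖b‖ = 1 →
      ‖∑ x, ∑ y, φ (glue S (x, y)) * star (a x * b y)‖ ^ 2 ≤ l) :
    purity φ v ≤ l := by
  have h' : ∀ (a : QSpace {q // q ∈ S}) (b : QSpace {q // q ∈ Sᶜ}),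
      ‖∑ x, ∑ y, φ (glue S (x, y)) * star (a x * b y)‖ ^ 2 ≤ l * (‖a‖ ^ 2 * ‖b‖ ^ 2) := by
    intro a b
    rcases eq_or_ne a 0 with rfl | ha
    · simp
    rcases eq_or_ne b 0 with rfl | hb
    · simp
    have ha' := norm_pos_iff.2 ha
    have hb' := norm_pos_iff.2 hb
    have h1 := h ((‖a‖⁻¹ : ℂ) • a) ((‖b‖⁻¹ : ℂ) • b)
      (by rw [norm_smul, norm_inv, Complex.norm_real, norm_norm, inv_mul_cancel₀ ha'.ne'])
      (by rw [norm_smul, norm_inv, Complex.norm_real, norm_norm, inv_mul_cancel₀ hb'.ne'])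
    have h2 : ∑ x, ∑ y, φ (glue S (x, y)) *
        star (((‖a‖⁻¹ : ℂ) • a) x * ((‖b‖⁻¹ : ℂ) • b) y) =
        ((‖a‖⁻¹ * ‖b‖⁻¹ : ℝ) : ℂ) * ∑ x, ∑ y, φ (glue S (x, y)) * star (a x * b y) := by
      simp only [Finset.mul_sum, PiLp.smul_apply, smul_eq_mul, star_mul', Complex.star_def,
        map_inv₀, Complex.conj_ofReal]
      refine Finset.sum_congr rfl fun x _ => Finset.sum_congr rfl fun y _ => ?_
      push_cast
      ring
    rw [h2, norm_mul, Complex.norm_real, mul_pow, Real.norm_of_nonneg (by positivity)] at h1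
    have h3 : (‖a‖⁻¹ * ‖b‖⁻¹) ^ 2 * (‖a‖ ^ 2 * ‖b‖ ^ 2) = 1 := by
      field_simp
    calc _ = ((‖a‖⁻¹ * ‖b‖⁻¹) ^ 2 * ‖∑ x, ∑ y, φ (glue S (x, y)) * star (a x * b y)‖ ^ 2) *
          (‖a‖ ^ 2 * ‖b‖ ^ 2) := by rw [mul_right_comm, h3, one_mul]
      _ ≤ _ := mul_le_mul_of_nonneg_right h1 (by positivity)
  have hsum : ∑ x', ∑ y, ‖φ (glue S (x', y))‖ ^ 2 = 1 := by
    have := EuclideanSpace.norm_sq_eq φ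
    rw [hφ, ← (glue S).sum_comp, Fintype.sum_prod_type] at this
    rw [← this, one_pow]
  rw [purity_eq_sum_reduced φ hS, ← mul_one l, ← hsum, Finset.mul_sum]
  refine Finset.sum_le_sum fun x' _ => ?_
  set N := ∑ x, ‖reduced φ S x x'‖ ^ 2 with hN
  have h1 := h' (WithLp.toLp 2 fun x => reduced φ S x x')
    (WithLp.toLp 2 fun y => φ (glue S (x', y)))
  rw [EuclideanSpace.norm_sq_eq, EuclideanSpace.norm_sq_eq] at h1
  simp only at h1
  have h2 : ∑ x, ∑ y, φ (glue S (x, y)) * star (reduced φ S x x' * φ (glue S (x', y))) = (N : ℂ) := by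
    rw [hN, Complex.ofReal_sum]
    refine Finset.sum_congr rfl fun x _ => ?_
    have h4 : ((‖reduced φ S x x'‖ ^ 2 : ℝ) : ℂ) = reduced φ S x x' * star (reduced φ S x x') := by
      rw [Complex.star_def, Complex.mul_conj, Complex.normSq_eq_norm_sq]
    rw [h4]
    nth_rewrite 2 [reduced]
    rw [Finset.sum_mul]
    refine Finset.sum_congr rfl fun y _ => ?_
    rw [star_mul']
    ring
  have hN0 : 0 ≤ N := by positivity
  rw [h2, Complex.norm_real, Real.norm_of_nonneg hN0, ← hN] at h1
  rcases hN0.eq_or_lt with h0 | h0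
  · rw [← h0]
    positivity
  · have h5 : N * N ≤ N * (l * ∑ y, ‖φ (glue S (x', y))‖ ^ 2) := by
      nlinarith [h1]
    exact le_of_mul_le_mul_left h5 h0

/-! ### Trace distance and fidelity of pure states -/

/-- The difference `D` of the two density matrices has rank at most two, so that the Cauchy–Schwarz
inequality over its nonzero singular values bounds the square of the trace norm by
`2 * trace (Dᴴ * D)`. (Equality holds, but is not needed.) -/
theorem traceDist_sq_le {φ χ : QSpace Q} (hφ : ‖φ‖ = 1) (hχ : ‖χ‖ = 1) :
    traceDist φ χ ^ 2 ≤ 1 - ‖∑ x, φ x * star (χ x)‖ ^ 2 := by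
  set D := density φ - density χ with hD
  set f := (Matrix.isHermitian_conjTranspose_mul_self D).eigenvalues with hf
  have hnn : ∀ i, 0 ≤ f i := fun i => Matrix.eigenvalues_conjTranspose_mul_self_nonneg D i
  have hrank : D.rank ≤ 2 := by
    have h1 : D = (Matrix.of fun x (k : Fin 2) => ![φ x, χ x] k) *
        (Matrix.of fun (k : Fin 2) y => ![star (φ y), -star (χ y)] k) := by
      ext x y
      simp [hD, density, Matrix.mul_apply, Fin.sum_univ_two, sub_eq_add_neg]
    rw [h1]
    exact (Matrix.rank_mul_le_left _ _).trans ((Matrix.rank_le_card_width _).trans_eq (by simp))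
  have hcard : (Finset.univ.filter fun i => f i ≠ 0).card ≤ 2 := by
    have := (Matrix.isHermitian_conjTranspose_mul_self D).rank_eq_card_non_zero_eigs
    rw [Fintype.card_subtype] at this
    rw [← this]
    exact (Matrix.rank_mul_le_right _ _).trans hrank
  have htrace : ∑ i, f i = 2 * (1 - ‖∑ x, φ x * star (χ x)‖ ^ 2) := by
    have h1 := (Matrix.isHermitian_conjTranspose_mul_self D).trace_eq_sum_eigenvalues
    have h4 : ∀ z : ℂ, ((‖z‖ ^ 2 : ℝ) : ℂ) = z * star z := by
      intro z
      rw [Complex.star_def, Complex.mul_conj, Complex.normSq_eq_norm_sq]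
    have hn : ∀ ξ : QSpace Q, ‖ξ‖ = 1 → ∑ x, ξ x * star (ξ x) = 1 := by
      intro ξ hξ
      have := norm_sq_eq_sum ξ
      rw [hξ] at this
      simpa using this.symm
    apply Complex.ofReal_injective
    rw [Complex.ofReal_sum]
    refine h1.symm.trans ?_
    rw [Complex.ofReal_mul, Complex.ofReal_sub, h4, Complex.ofReal_ofNat, Complex.ofReal_one]
    have h2 : (2 : ℂ) * (1 - (∑ x, φ x * star (χ x)) * star (∑ x, φ x * star (χ x))) =
        (∑ x, φ x * star (φ x)) * (∑ x, φ x * star (φ x)) -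
        (∑ x, φ x * star (χ x)) * star (∑ x, φ x * star (χ x)) -
        star (∑ x, φ x * star (χ x)) * (∑ x, φ x * star (χ x)) +
        (∑ x, χ x * star (χ x)) * (∑ x, χ x * star (χ x)) := by
      rw [hn φ hφ, hn χ hχ]
      ring
    rw [h2, star_sum]
    simp only [Finset.sum_mul_sum, ← Finset.sum_sub_distrib, ← Finset.sum_add_distrib,
      Matrix.trace, Matrix.diag, Matrix.mul_apply, Matrix.conjTranspose_apply]
    refine Finset.sum_congr rfl fun x _ => Finset.sum_congr rfl fun y _ => ?_
    simp only [hD, density, Matrix.sub_apply, Matrix.of_apply, star_sub, star_mul', star_star]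
    ring
  have hsum : traceNorm D = ∑ i with f i ≠ 0, Real.sqrt (f i) := by
    rw [traceNorm, Finset.sum_filter_of_ne]
    intro i _ h
    contrapose h
    exact (congrArg Real.sqrt h).trans Real.sqrt_zero
  have hcs : traceNorm D ^ 2 ≤ 2 * ∑ i, f i := by
    rw [hsum]
    refine (sq_sum_le_card_mul_sum_sq).trans ?_
    refine mul_le_mul (by exact_mod_cast hcard) ?_ (by positivity) (by norm_num)
    rw [Finset.sum_congr rfl fun i _ => Real.sq_sqrt (hnn i)]
    exact Finset.sum_le_sum_of_subset_of_nonneg (Finset.filter_subset _ _) fun i _ _ => hnn i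
  rw [traceDist, ← hD, mul_pow]
  rw [htrace] at hcs
  linarith

/-- A state far from separable has purity bounded away from one across every cut, as its overlap with
every product state `a ⊗ b` across this cut is small. -/
theorem purity_le_of_far {φ : QSpace Q} (hφ : ‖φ‖ = 1) {ε : ℝ} (hε : 0 ≤ ε) (hε1 : ε ≤ 1)
    (hfar : FarFromSeparable ε φ) {v : Q → ZMod 2} (hv : ∃ i j, v i ≠ v j) :
    purity φ v ≤ 1 - ε ^ 2 := by
  have hS : ∀ q, q ∈ (Finset.univ.filter fun q => v q = 1) ↔ v q = 1 := by simp
  set S := Finset.univ.filter fun q => v q = 1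
  refine purity_le_of_overlap_le hφ hS (by nlinarith) fun a b ha hb => ?_
  set χ : QSpace Q := WithLp.toLp 2 fun z => a (fun q => z q.1) * b (fun q => z q.1) with hχ
  have hχg : ∀ x y, χ (glue S (x, y)) = a x * b y := by
    intro x y
    have := (glue S).left_inv (x, y)
    have h1 : (fun q : {q // q ∈ S} => glue S (x, y) q.1) = x := congrArg Prod.fst this
    have h2 : (fun q : {q // q ∈ Sᶜ} => glue S (x, y) q.1) = y := congrArg Prod.snd this
    simp only [hχ]
    rw [h1, h2]
  have hχ1 : ‖χ‖ = 1 := by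
    have h1 : ‖χ‖ ^ 2 = 1 := by
      rw [EuclideanSpace.norm_sq_eq, ← (glue S).sum_comp, Fintype.sum_prod_type]
      simp only [hχg, norm_mul, mul_pow]
      rw [← Finset.sum_mul_sum, ← EuclideanSpace.norm_sq_eq, ← EuclideanSpace.norm_sq_eq, ha, hb]
      norm_num
    exact (pow_eq_one_iff_of_nonneg (norm_nonneg _) (by norm_num)).1 h1
  obtain ⟨i, j, hij⟩ := hv
  have hne : S.Nonempty ∧ Sᶜ.Nonempty := by
    rcases zmod_two_eq_zero_or_one (v i) with h1 | h1 <;>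
      rcases zmod_two_eq_zero_or_one (v j) with h2 | h2
    · exact absurd (h1.trans h2.symm) hij
    · exact ⟨⟨j, (hS j).2 h2⟩, ⟨i, Finset.mem_compl.2 fun h => by simp [(hS i).1 h] at h1⟩⟩
    · exact ⟨⟨i, (hS i).2 h1⟩, ⟨j, Finset.mem_compl.2 fun h => by simp [(hS j).1 h] at h2⟩⟩
    · exact absurd (h1.trans h2.symm) hij
  have h := (pow_le_pow_left₀ hε (hfar χ hχ1 ⟨S, hne.1, hne.2, a, b, ha, hb, fun _ => rfl⟩) 2).trans
    (traceDist_sq_le hφ hχ1)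
  rw [← (glue S).sum_comp, Fintype.sum_prod_type] at h
  simp only [hχg] at h
  linarith

end Purity

section Parts

variable {n : ℕ} (P : Finpartition (Finset.univ : Finset (Fin n)))

/-- The overlap of a product state, as a real number. -/
def partsPurity (φ : (C : {C // C ∈ P.parts}) → QSpace (PartQubits P C)) (v : Bits n) : ℝ :=
  ∏ C, purity (φ C) (fun i => v i.1)

theorem swapOverlap_productState_eq (φ : (C : {C // C ∈ P.parts}) → QSpace (PartQubits P C))
    (v : Bits n) : swapOverlap (productState P φ) v = partsPurity P φ v := by
  rw [swapOverlap_productState, partsPurity, Complex.ofReal_prod]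
  exact Finset.prod_congr rfl fun C _ => swapOverlap_eq_purity _ _

theorem partsPurity_nonneg (φ : (C : {C // C ∈ P.parts}) → QSpace (PartQubits P C)) (v : Bits n) :
    0 ≤ partsPurity P φ v :=
  Finset.prod_nonneg fun C _ => purity_nonneg (φ C) _

theorem partsPurity_eq_one {φ : (C : {C // C ∈ P.parts}) → QSpace (PartQubits P C)}
    (hφ : ∀ C, ‖φ C‖ = 1) {v : Bits n} (hv : v ∈ cutSpace P) : partsPurity P φ v = 1 :=
  Finset.prod_eq_one fun C _ => purity_const (hφ C) fun i j =>
    hv i.1 j.1 ((P.part_eq_of_mem C.2 i.2).trans (P.part_eq_of_mem C.2 j.2).symm)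

/-- A vector that is not constant on all parts cuts some part properly, and the purity of this single
factor bounds the product. -/
theorem partsPurity_le {φ : (C : {C // C ∈ P.parts}) → QSpace (PartQubits P C)}
    (hφ : ∀ C, ‖φ C‖ = 1) {η : ℝ}
    (h : ∀ C, ∀ v : PartQubits P C → ZMod 2, (∃ i j, v i ≠ v j) → purity (φ C) v ≤ η)
    {v : Bits n} (hv : v ∉ cutSpace P) : partsPurity P φ v ≤ η := by
  have : ∃ i j, P.part i = P.part j ∧ v i ≠ v j := by
    by_contra hcon
    push Not at hcon
    exact hv hcon
  obtain ⟨i, j, hij, hne⟩ := this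
  have hj : j ∈ (partOf P i).1 := by
    change j ∈ P.part i
    rw [hij]
    exact mem_partOf P j
  refine le_trans ?_ (h (partOf P i) (fun q => v q.1) ⟨⟨i, mem_partOf P i⟩, ⟨j, hj⟩, hne⟩)
  rw [partsPurity, ← Finset.mul_prod_erase _ _ (Finset.mem_univ (partOf P i))]
  exact mul_le_of_le_one_right (purity_nonneg _ _)
    (Finset.prod_le_one (fun C _ => purity_nonneg _ _) fun C _ => purity_le_one (hφ C) _)

end Parts

/-! ### The adaptive algorithm -/

theorem dotProduct_eq_zero_of_mem_span {n : ℕ} {ys : List (Bits n)} {y z : Bits n}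
    (hy : y ∈ Submodule.span (ZMod 2) {v | v ∈ ys}) (hz : z ∈ orth ys) : y ⬝ᵥ z = 0 := by
  induction hy using Submodule.span_induction with
  | mem x hx => exact hz x hx
  | zero => exact zero_dotProduct z
  | add x y _ _ hx hy => rw [add_dotProduct, hx, hy, add_zero]
  | smul c x _ hx => rw [smul_dotProduct, hx, smul_zero]

/-- Discarding samples in the span of the others does not change the nullspace. -/
theorem orth_kept {n : ℕ} (ys : List (Bits n)) : orth (kept ys) = orth ys := by
  induction ys using List.reverseRecOn with
  | nil => rfl
  | append_singleton ys y ih =>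
    ext z
    classical
    rw [mem_orth_append, ← ih]
    have h : kept (ys ++ [y]) =
        if y ∈ Submodule.span (ZMod 2) {v | v ∈ kept ys} then kept ys else kept ys ++ [y] := by
      rw [kept, List.foldl_append]
      exact if_congr Iff.rfl rfl rfl
    rw [h]
    split_ifs with hy
    · exact ⟨fun hz => ⟨hz, dotProduct_eq_zero_of_mem_span hy hz⟩, And.left⟩
    · exact mem_orth_append

theorem card_qubit (n s a : ℕ) : Fintype.card (Qubit n s a) = n + (2 * s * n + a) := by
  simp [Qubit, Copy, mul_comm]

theorem depth_adaptiveCircuit (n s : ℕ) (ys : List (Bits n)) :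
    (adaptiveCircuit n s ys).depth = n ^ 2 + 2 * levels s + 5 := by
  simp [adaptiveCircuit, prepareCircuit, fanoutCircuit, faninCircuit, dependentLayers,
    Circuit.depth, List.length_flatMap, pow_two]
  ring

theorem depth_nonadaptiveCircuit (n s a : ℕ) : (nonadaptiveCircuit n s a).depth = s + 2 := by
  simp [nonadaptiveCircuit, Circuit.depth]

theorem levels_le (s : ℕ) : levels s ≤ s + 1 :=
  Nat.clog_le_of_le_pow (Nat.lt_two_pow_self).le

/-- The total running time of an algorithm whose programs run in polynomial time and whose circuits
have polynomial size. -/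
theorem exists_runsInTime {A : HybridAlgorithm} {K : ℕ}
    (hcircuit : ∀ {n s M : ℕ} (ys : List (Bits n)), n + ys.length + 3 * s + 10 ≤ M →
      ∃ T, Outputs A.circuitProgram (controllerInput n s ys)
        ((A.circuit n s ys).encode Qubit.index) T ∧ T ≤ K * M ^ K)
    (hout : ∀ {n s M : ℕ} (ys : List (Bits n)), n + ys.length + 3 * s + 10 ≤ M →
      ∃ T, Outputs A.outputProgram (controllerInput n s ys) (List.ofFn (A.output n s ys)) T ∧
        T ≤ K * M ^ K)
    (hsize : ∀ {n s M : ℕ} (ys : List (Bits n)), n + ys.length + 3 * s + 10 ≤ M →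
      (A.circuit n s ys).size ≤ K * M ^ K)
    {n s M : ℕ} (ys : List (Bits n)) (hM : n + ys.length + 3 * s + 10 ≤ M) :
    ∃ T, A.RunsInTime n s ys T ∧ T ≤ 2 * K * M ^ (K + 1) := by
  have htake : ∀ k, n + (ys.take k).length + 3 * s + 10 ≤ M := fun k => by
    have := List.length_take_le' k ys
    omega
  choose τ hτ using fun k => hcircuit (ys.take k) (htake k)
  obtain ⟨T, hT, hTle⟩ := hout ys hM
  refine ⟨_, ⟨fun k => if k < ys.length then τ k else T, fun k hk => ?_, ?_, le_rfl⟩, ?_⟩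
  · simp only [hk, if_true]
    exact (hτ k).1
  · simpa using hT
  · have h1 : ∑ k ∈ Finset.range (ys.length + 1), (if k < ys.length then τ k else T) ≤
        (ys.length + 1) * (K * M ^ K) := by
      refine (Finset.sum_le_card_nsmul _ _ (K * M ^ K) fun k _ => ?_).trans_eq (by simp)
      split_ifs
      exacts [(hτ k).2, hTle]
    have h2 : ∑ k ∈ Finset.range ys.length, (A.circuit n s (ys.take k)).size ≤
        ys.length * (K * M ^ K) :=
      (Finset.sum_le_card_nsmul _ _ (K * M ^ K) fun k _ => hsize _ (htake k)).trans_eq (by simp)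
    calc _ ≤ (ys.length + 1) * (K * M ^ K) + ys.length * (K * M ^ K) := add_le_add h1 h2
      _ = (2 * ys.length + 1) * (K * M ^ K) := by ring
      _ ≤ (2 * M) * (K * M ^ K) := Nat.mul_le_mul_right _ (by omega)
      _ = 2 * K * M ^ (K + 1) := by ring

/-- The adaptive algorithm. -/
def adaptiveAlgorithm : HybridAlgorithm where
  ancillas n s := (s + 1) * n
  circuit n s ys := adaptiveCircuit n s ys
  output _ _ ys := cutLabels (orth ys)
  circuitProgram := adaptiveProgram
  outputProgram := HiddenCut.outputProgram

theorem isAdaptive_adaptiveAlgorithm : adaptiveAlgorithm.IsAdaptive := by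
  intro n s ys
  rw [orth_kept]
  exact ⟨implementsFourier_adaptiveCircuit ys, rfl⟩

/-- Bounds `K * M ^ K` increase with `K`. -/
theorem polynomial_mono {a K L M : ℕ} (hM : 1 ≤ M) (hKL : K ≤ L) (h : a ≤ K * M ^ K) :
    a ≤ L * M ^ L :=
  h.trans (Nat.mul_le_mul hKL (Nat.pow_le_pow_right hM hKL))

theorem exists_runsInTime_adaptiveAlgorithm : ∃ K : ℕ, ∀ {n s M : ℕ} (ys : List (Bits n)),
    n + ys.length + 3 * s + 10 ≤ M →
      ∃ T, adaptiveAlgorithm.RunsInTime n s ys T ∧ T ≤ 2 * K * M ^ (K + 1) := by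
  obtain ⟨K₁, h₁⟩ := adaptiveProgram.bound_polynomial
  obtain ⟨K₂, h₂⟩ := HiddenCut.outputProgram.bound_polynomial
  refine ⟨K₁ + K₂ + 4, fun ys hM => exists_runsInTime ?_ ?_ ?_ ys hM⟩
  · intro n s M ys hM
    obtain ⟨T, hT, hle⟩ := outputs_adaptiveProgram s ys hM
    exact ⟨T, hT, polynomial_mono (by omega) (by omega) (hle.trans (h₁ M (by omega)))⟩
  · intro n s M ys hM
    obtain ⟨T, hT, hle⟩ := outputs_outputProgram s ys hM
    exact ⟨T, hT, polynomial_mono (by omega) (by omega) (hle.trans (h₂ M (by omega)))⟩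
  · intro n s M ys hM
    refine polynomial_mono (K := 4) (by omega) (by omega) ?_
    refine (Circuit.size_le (adaptiveCircuit_valid ys)).trans ?_
    rw [depth_adaptiveCircuit, card_qubit]
    have hl := levels_le s
    have h1 : n ^ 2 + 2 * levels s + 5 ≤ 2 * M ^ 2 := by
      have : n ^ 2 ≤ M ^ 2 := Nat.pow_le_pow_left (by omega) 2
      nlinarith
    have h2 : n + (2 * s * n + (s + 1) * n) ≤ 2 * M ^ 2 := by
      have : n * s ≤ M * M := Nat.mul_le_mul (by omega) (by omega)
      have h3 : 3 * s * n ≤ M * M := Nat.mul_le_mul (by omega) (by omega)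
      have h4 : 2 * n ≤ M * M := Nat.mul_le_mul (by omega) (by omega)
      nlinarith
    calc _ ≤ (2 * M ^ 2) * (2 * M ^ 2) := Nat.mul_le_mul h1 h2
      _ = 4 * M ^ 4 := by ring

theorem levels_le_log {s : ℕ} {x : ℝ} (hx : 1 ≤ x) (hs : (s : ℝ) ≤ 11 * x ^ 2) :
    (levels s : ℝ) ≤ 17 + 3 * Real.log x := by
  have hlog : 0 ≤ Real.log x := Real.log_nonneg hx
  rcases Nat.eq_zero_or_pos (levels s) with h0 | h0
  · rw [h0]
    push_cast
    linarith
  have h1 : 2 ^ (levels s - 1) < s + 1 := lt_levels_iff.1 (by omega)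
  have h2 : (2 : ℝ) ^ (levels s - 1) ≤ 11 * x ^ 2 :=
    le_trans (by exact_mod_cast Nat.lt_succ_iff.1 h1) hs
  have h3 := Real.log_le_log (by positivity) h2
  rw [Real.log_pow, Real.log_mul (by norm_num) (by positivity), Real.log_pow,
    Nat.cast_sub h0] at h3
  have h11 := Real.log_le_sub_one_of_pos (x := 11) (by norm_num)
  have hl2 := Real.log_two_gt_d9
  push_cast at h3
  nlinarith

/-- With `s ≥ 10 / ε ^ 2` every properly cut factor contributes at most `(1 - ε ^ 2) ^ s ≤ exp (-10)`,
so a vector survives a round with probability at most `6 / 10`. -/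
theorem two_thirds_le_successProb {n s : ℕ} {ε : ℝ} (hn : 1 ≤ n) (hε : 0 < ε) (hε1 : ε ≤ 1)
    (hs : 10 / ε ^ 2 ≤ s) (P : Finpartition (Finset.univ : Finset (Fin n)))
    (φ : (C : {C // C ∈ P.parts}) → QSpace (PartQubits P C)) (hφ : ∀ C, ‖φ C‖ = 1)
    (hfar : ∀ C, FarFromSeparable ε (φ C)) :
    2 / 3 ≤ adaptiveAlgorithm.successProb (10 * n) s (productState P φ) P := by
  have hsmall : ∀ v, v ∉ cutSpace P → partsPurity P φ v ^ s ≤ 2 * (6 / 10 : ℝ) - 1 := by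
    intro v hv
    have h1 : partsPurity P φ v ≤ Real.exp (-ε ^ 2) :=
      (partsPurity_le P hφ (fun C v hv => purity_le_of_far (hφ C) hε.le hε1 (hfar C) hv) hv).trans
        (by linarith [Real.add_one_le_exp (-ε ^ 2)])
    have h2 : (10 : ℝ) ≤ s * ε ^ 2 := by rwa [div_le_iff₀ (by positivity)] at hs
    have h3 : (11 : ℝ) ≤ Real.exp 10 := by linarith [Real.add_one_le_exp (10 : ℝ)]
    calc partsPurity P φ v ^ s ≤ Real.exp (-ε ^ 2) ^ s :=
          pow_le_pow_left₀ (partsPurity_nonneg P φ v) h1 s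
      _ = Real.exp (-(s * ε ^ 2)) := by rw [← Real.exp_nat_mul]; ring_nf
      _ ≤ Real.exp (-10) := Real.exp_le_exp.2 (by linarith)
      _ = (Real.exp 10)⁻¹ := Real.exp_neg 10
      _ ≤ 11⁻¹ := inv_anti₀ (by norm_num) h3
      _ ≤ _ := by norm_num
  have h := one_sub_successProb_le adaptiveAlgorithm (norm_productState P hφ) P
    (V := fun ys => orth ys) (fun _ => le_rfl) (fun ys => implementsFourier_adaptiveCircuit ys)
    (fun _ => rfl) (swapOverlap_productState_eq P φ) (fun v hv => partsPurity_eq_one P hφ hv)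
    (by norm_num) hsmall (10 * n)
  -- ten rounds per qubit make `(6 / 10) ^ 10 * 2` less than one third
  have h4 : (6 / 10 : ℝ) ^ (10 * n) * 2 ^ n ≤ 1 / 3 := by
    rw [pow_mul, ← mul_pow]
    refine (pow_le_of_le_one (by norm_num) (by norm_num) (by omega)).trans (by norm_num)
  linarith

/-- The guarantees for the adaptive algorithm. The depth `n ^ 2 + 2 * levels s + 5` is dominated by the
CNOT gates of the preparation, one gate per layer, and the logarithmic fan-out. -/
theorem adaptive_complexity : ∃ (A : HybridAlgorithm) (c K : ℕ), A.IsAdaptive ∧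
      ∀ (n s : ℕ) (ε : ℝ), 1 ≤ n → 0 < ε → ε ≤ 1 → s = ⌈(c : ℝ) / ε ^ 2⌉₊ →
        ((2 * s : ℕ) : ℝ) ≤ K * (1 / ε ^ 2) ∧
        ((c * n * (2 * s) : ℕ) : ℝ) ≤ K * (n / ε ^ 2) ∧
        (∀ ys : List (Bits n),
          ((A.circuit n s ys).depth : ℝ) ≤ K * ((n : ℝ) ^ 2 + Real.log (1 / ε))) ∧
        (∀ ys : List (Bits n), ys.length = c * n →
          ∃ T : ℕ, A.RunsInTime n s ys T ∧ (T : ℝ) ≤ K * (n / ε) ^ K) ∧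
        (∀ (P : Finpartition (Finset.univ : Finset (Fin n)))
          (φ : (C : {C // C ∈ P.parts}) → QSpace (PartQubits P C)),
          (∀ C, ‖φ C‖ = 1) → (∀ C, FarFromSeparable ε (φ C)) →
          2 / 3 ≤ A.successProb (c * n) s (productState P φ) P) := by
  obtain ⟨K, hK⟩ := exists_runsInTime_adaptiveAlgorithm
  obtain ⟨L, hL⟩ : ∃ L, L = 2 * K * 54 ^ (K + 1) + 2 * K + 220 := ⟨_, rfl⟩
  refine ⟨adaptiveAlgorithm, 10, L, isAdaptive_adaptiveAlgorithm, ?_⟩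
  intro n s ε hn hε hε1 hs
  have hn' : (1 : ℝ) ≤ n := by exact_mod_cast hn
  have hx : 1 ≤ 1 / ε := by rw [le_div_iff₀ hε]; linarith
  have hx2 : 1 / ε ^ 2 = (1 / ε) ^ 2 := by rw [div_pow, one_pow]
  have hx1 : 1 ≤ (1 / ε) ^ 2 := one_le_pow₀ hx
  have hlow : 10 / ε ^ 2 ≤ s := by
    rw [hs]
    push_cast
    exact Nat.le_ceil _
  have hup : (s : ℝ) ≤ 11 * (1 / ε) ^ 2 := by
    have h1 : (s : ℝ) < 10 / ε ^ 2 + 1 := by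
      rw [hs]
      push_cast
      exact Nat.ceil_lt_add_one (by positivity)
    have h2 : 10 / ε ^ 2 = 10 * (1 / ε) ^ 2 := by rw [← hx2]; ring
    linarith
  have hL220 : (220 : ℝ) ≤ L := by exact_mod_cast (by omega : 220 ≤ L)
  refine ⟨?_, ?_, fun ys => ?_, fun ys hys => ?_, fun P φ hφ hfar =>
    two_thirds_le_successProb hn hε hε1 hlow P φ hφ hfar⟩
  · rw [hx2]
    push_cast
    nlinarith
  · rw [div_eq_mul_one_div, hx2]
    push_cast
    calc (10 * n * (2 * s) : ℝ) ≤ 10 * n * (2 * (11 * (1 / ε) ^ 2)) := by gcongr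
      _ = 220 * (n * (1 / ε) ^ 2) := by ring
      _ ≤ _ := by gcongr
  · have h1 : ((adaptiveAlgorithm.circuit n s ys).depth : ℝ) = n ^ 2 + 2 * levels s + 5 := by
      exact_mod_cast congrArg Nat.cast (depth_adaptiveCircuit n s ys)
    rw [h1]
    have h2 := levels_le_log hx hup
    have h3 : 0 ≤ Real.log (1 / ε) := Real.log_nonneg hx
    nlinarith
  · obtain ⟨T, hT, hle⟩ := hK (M := n + ys.length + 3 * s + 10) ys le_rfl
    refine ⟨T, hT, ?_⟩
    have hz : 1 ≤ (n / ε : ℝ) := by rw [le_div_iff₀ hε]; linarith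
    have hM : ((n + ys.length + 3 * s + 10 : ℕ) : ℝ) ≤ 54 * (n / ε) ^ 2 := by
      have h1 : (n / ε : ℝ) ^ 2 = n ^ 2 * (1 / ε) ^ 2 := by rw [div_eq_mul_one_div, mul_pow]
      rw [hys, h1]
      push_cast
      have h2 : (n : ℝ) ≤ n ^ 2 * (1 / ε) ^ 2 := by nlinarith [sq_nonneg ((n : ℝ) - 1)]
      have h3 : (1 / ε) ^ 2 ≤ n ^ 2 * (1 / ε) ^ 2 :=
        le_mul_of_one_le_left (by positivity) (one_le_pow₀ hn')
      nlinarith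
    calc (T : ℝ) ≤ ((2 * K * (n + ys.length + 3 * s + 10) ^ (K + 1) : ℕ) : ℝ) := by
          exact_mod_cast hle
      _ = 2 * K * ((n + ys.length + 3 * s + 10 : ℕ) : ℝ) ^ (K + 1) := by push_cast; ring
      _ ≤ 2 * K * (54 * (n / ε) ^ 2) ^ (K + 1) := by gcongr
      _ = ((2 * K * 54 ^ (K + 1) : ℕ) : ℝ) * (n / ε) ^ (2 * K + 2) := by
          push_cast
          rw [mul_pow, ← pow_mul]
          ring
      _ ≤ L * (n / ε) ^ L := by
          have h1 : ((2 * K * 54 ^ (K + 1) : ℕ) : ℝ) ≤ L := by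
            exact_mod_cast (by omega : 2 * K * 54 ^ (K + 1) ≤ L)
          have h2 : (n / ε : ℝ) ^ (2 * K + 2) ≤ (n / ε) ^ L := pow_le_pow_right₀ hz (by omega)
          gcongr

/-! ### Small ball estimates for random states -/

open scoped Pointwise

section Gaussian

variable {E : Type*} [NormedAddCommGroup E] [NormedSpace ℝ E] [FiniteDimensional ℝ E]
  [MeasurableSpace E] [BorelSpace E] (μ : Measure E) [μ.IsAddHaarMeasure]

/-- The volume of the unit ball, in terms of a Gaussian integral. -/
theorem measureReal_ball_eq {d : ℕ} (hd : Module.finrank ℝ E = 2 * d) :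
    μ.real (Metric.ball 0 1) = (∫ x, Real.exp (-‖x‖ ^ 2) ∂μ) / d.factorial := by
  have h := measure_lt_one_eq_integral_div_gamma μ (g := fun x : E => ‖x‖) norm_zero norm_neg
    norm_add_le (fun hx => norm_eq_zero.1 hx) (fun r x => by rw [norm_smul, Real.norm_eq_abs])
    (p := 2) (by norm_num)
  have h1 : {x : E | ‖x‖ < 1} = Metric.ball 0 1 := by
    ext x
    simp
  have h2 : (Module.finrank ℝ E : ℝ) / 2 + 1 = d + 1 := by
    rw [hd]
    push_cast
    ring
  rw [h1, h2, Real.Gamma_nat_eq_factorial] at h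
  simp only [Real.rpow_ofNat] at h
  rw [measureReal_def, h, ENNReal.toReal_ofReal]
  exact div_nonneg (integral_nonneg fun x => (Real.exp_pos _).le) (by positivity)

theorem gaussian_integral_pos {d : ℕ} (hd : Module.finrank ℝ E = 2 * d) :
    0 < ∫ x, Real.exp (-‖x‖ ^ 2) ∂μ := by
  have h : 0 < μ.real (Metric.ball 0 1) :=
    ENNReal.toReal_pos (Metric.measure_ball_pos μ 0 one_pos).ne' measure_ball_lt_top.ne
  rw [measureReal_ball_eq μ hd] at h
  by_contra hcon
  exact absurd h (not_lt.2 (div_nonpos_of_nonpos_of_nonneg (not_lt.1 hcon) (by positivity)))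

theorem integrable_gaussian {d : ℕ} (hd : Module.finrank ℝ E = 2 * d) :
    Integrable (fun x => Real.exp (-‖x‖ ^ 2)) μ := by
  by_contra h
  exact (gaussian_integral_pos μ hd).ne' (integral_undef h)

theorem integrable_gaussian_mul {d : ℕ} (hd : Module.finrank ℝ E = 2 * d) {F : E → ℝ}
    (hF : Continuous F) (hF0 : ∀ x, 0 ≤ F x) :
    Integrable (fun x => Real.exp (-‖x‖ ^ 2 - F x)) μ := by
  refine (integrable_gaussian μ hd).mono (by fun_prop) (Filter.Eventually.of_forall fun x => ?_)
  rw [Real.norm_of_nonneg (Real.exp_pos _).le, Real.norm_of_nonneg (Real.exp_pos _).le]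
  exact Real.exp_le_exp.2 (by linarith [hF0 x])

/-- The uniform measure on the sphere, evaluated through the volumes of cones. -/
theorem toSphere_normalized_apply [Nontrivial E] (ν : Measure E) [ν.IsAddHaarMeasure]
    {s : Set (Metric.sphere (0 : E) 1)} (hs : MeasurableSet s) :
    ((ν.toSphere Set.univ)⁻¹ • ν.toSphere) s =
      μ (Set.Ioo (0 : ℝ) 1 • ((↑) '' s)) / μ (Metric.ball 0 1) := by
  have hν := Measure.isAddLeftInvariant_eq_smul ν μ
  set c := ν.addHaarScalarFactor μ with hc
  have hc0 : (c : ENNReal) ≠ 0 := by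
    simpa using (Measure.addHaarScalarFactor_pos_of_isAddHaarMeasure ν μ).ne'
  have hdim : (Module.finrank ℝ E : ENNReal) ≠ 0 := by
    simpa using (Module.finrank_pos (R := ℝ) (M := E)).ne'
  have happ : ∀ t, ν t = c * μ t := fun t => by rw [hν]; rfl
  rw [Measure.smul_apply, smul_eq_mul, Measure.toSphere_apply' ν hs, Measure.toSphere_apply_univ,
    happ, happ, ← ENNReal.div_eq_inv_mul, ← mul_assoc, ← mul_assoc, ENNReal.mul_div_mul_left _ _ (mul_ne_zero hdim hc0)
    (ENNReal.mul_ne_top (by simp) (by simp))]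

/-- A small ball estimate on the sphere: for a continuous function that is homogeneous of degree
four, small values on the sphere are compared with a Laplace transform under the Gaussian measure.
The comparison takes place on the ball of radius `√d`, the typical norm of a Gaussian vector. -/
theorem sphere_small_le [Nontrivial E] (ν : Measure E) [ν.IsAddHaarMeasure] {d : ℕ} (hd0 : 0 < d)
    (hd : Module.finrank ℝ E = 2 * d) {F : E → ℝ} (hF : Continuous F) (hF0 : ∀ x, 0 ≤ F x)
    (hhom : ∀ (r : ℝ) x, F (r • x) = r ^ 4 * F x) (κ : ℝ) :
    ((ν.toSphere Set.univ)⁻¹ • ν.toSphere) {x | F x.1 ≤ κ / d} ≤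
      ENNReal.ofReal (d.factorial * Real.exp d / d ^ d * Real.exp (κ * d) *
        ((∫ x, Real.exp (-‖x‖ ^ 2 - F x) ∂μ) / ∫ x, Real.exp (-‖x‖ ^ 2) ∂μ)) := by
  have hs : MeasurableSet {x : Metric.sphere (0 : E) 1 | F x.1 ≤ κ / d} :=
    (isClosed_le (hF.comp continuous_subtype_val) continuous_const).measurableSet
  rw [toSphere_normalized_apply μ ν hs]
  set C := Set.Ioo (0 : ℝ) 1 • ((↑) '' {x : Metric.sphere (0 : E) 1 | F x.1 ≤ κ / d} : Set E)
  have hd' : (0 : ℝ) < d := by exact_mod_cast hd0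
  set T := {x : E | Real.exp (-(d + κ * d)) ≤ Real.exp (-‖x‖ ^ 2 - F x)} with hT
  have hsub : Real.sqrt d • C ⊆ T := by
    rintro _ ⟨_, ⟨r, ⟨hr0, hr1⟩, _, ⟨x, hx, rfl⟩, rfl⟩, rfl⟩
    have hx1 : ‖(x : E)‖ = 1 := by simp
    have hr4 : r ^ 4 ≤ 1 := pow_le_one₀ hr0.le hr1.le
    have hr2 : r ^ 2 ≤ 1 := pow_le_one₀ hr0.le hr1.le
    have hsd : Real.sqrt d ^ 2 = d := Real.sq_sqrt hd'.le
    have hsd4 : Real.sqrt d ^ 4 = d ^ 2 := by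
      rw [show (4 : ℕ) = 2 * 2 by rfl, pow_mul, hsd]
    have h1 : ‖Real.sqrt d • r • (x : E)‖ ^ 2 ≤ d := by
      rw [norm_smul, norm_smul, hx1, mul_one, mul_pow, Real.norm_eq_abs, Real.norm_eq_abs, sq_abs,
        sq_abs, hsd]
      exact mul_le_of_le_one_right hd'.le hr2
    have h2 : F (Real.sqrt d • r • (x : E)) ≤ κ * d := by
      rw [hhom, hhom, hsd4]
      have h3 : r ^ 4 * F x ≤ κ / d := (mul_le_of_le_one_left (hF0 _) hr4).trans hx
      calc (d : ℝ) ^ 2 * (r ^ 4 * F x) ≤ d ^ 2 * (κ / d) := by gcongr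
        _ = κ * d := by field_simp
    exact Real.exp_le_exp.2 (by linarith)
  have hI := integrable_gaussian_mul μ hd hF hF0
  have hmarkov : Real.exp (-(d + κ * d)) * μ.real T ≤ ∫ x, Real.exp (-‖x‖ ^ 2 - F x) ∂μ :=
    mul_meas_ge_le_integral_of_nonneg (Filter.Eventually.of_forall fun x => (Real.exp_pos _).le)
      hI _
  have hTfin : μ T ≠ ⊤ := by
    have h := (hI.measure_norm_ge_lt_top (Real.exp_pos (-(d + κ * d)))).ne
    simpa only [Real.norm_of_nonneg (Real.exp_pos _).le] using h
  have hscale : μ (Real.sqrt d • C) = ENNReal.ofReal (d ^ d) * μ C := by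
    rw [Measure.addHaar_smul, hd, pow_mul, Real.sq_sqrt hd'.le, abs_of_nonneg (by positivity)]
  have hCfin : μ C ≠ ⊤ := by
    intro h
    have h1 := (measure_mono hsub).trans_lt hTfin.lt_top
    rw [hscale, h, ENNReal.mul_top (by simp [hd0.ne'])] at h1
    exact absurd h1 (lt_irrefl _)
  have hC : d ^ d * μ.real C ≤ μ.real T := by
    have h1 := ENNReal.toReal_mono hTfin (measure_mono hsub)
    rw [hscale, ENNReal.toReal_mul, ENNReal.toReal_ofReal (by positivity)] at h1
    exact h1
  have hG := gaussian_integral_pos μ hd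
  have hball := measureReal_ball_eq μ hd
  have hball0 : μ (Metric.ball 0 1) ≠ 0 := (Metric.measure_ball_pos μ 0 one_pos).ne'
  have hballtop : μ (Metric.ball (0 : E) 1) ≠ ⊤ := measure_ball_lt_top.ne
  rw [← ENNReal.ofReal_toReal hCfin, ← ENNReal.ofReal_toReal hballtop,
    ← ENNReal.ofReal_div_of_pos (ENNReal.toReal_pos hball0 hballtop)]
  refine ENNReal.ofReal_le_ofReal ?_
  rw [← measureReal_def, ← measureReal_def, hball]
  set I := ∫ x, Real.exp (-‖x‖ ^ 2 - F x) ∂μ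
  set G := ∫ x, Real.exp (-‖x‖ ^ 2) ∂μ
  have hfac : (0 : ℝ) < d.factorial := by exact_mod_cast d.factorial_pos
  have hTI : μ.real T ≤ Real.exp (d + κ * d) * I := by
    rw [Real.exp_neg, inv_mul_le_iff₀ (Real.exp_pos _)] at hmarkov
    exact hmarkov
  have hCI : μ.real C ≤ Real.exp (d + κ * d) * I / d ^ d := by
    rw [le_div_iff₀ (by positivity), mul_comm]
    exact hC.trans hTI
  calc μ.real C / (G / d.factorial) ≤ (Real.exp (d + κ * d) * I / d ^ d) / (G / d.factorial) := by
        gcongr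
    _ = _ := by
        rw [Real.exp_add]
        field_simp

end Gaussian

/-- `d! eᵈ / dᵈ` grows at most linearly. -/
theorem factorial_mul_exp_le {d : ℕ} (hd : 0 < d) :
    d.factorial * Real.exp d / (d : ℝ) ^ d ≤ Real.exp 1 * d := by
  induction d, hd using Nat.le_induction with
  | base => simp
  | succ d hd ih =>
    have hd' : (0 : ℝ) < d := by exact_mod_cast hd
    have hkey : Real.exp 1 * (d : ℝ) ^ (d + 1) ≤ (d + 1) ^ (d + 1) := by
      have h1 := Real.one_sub_inv_le_log_of_pos (x := (d + 1 : ℝ) / d) (by positivity)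
      have h2 : 1 ≤ Real.log (((d + 1 : ℝ) / d) ^ (d + 1)) := by
        rw [Real.log_pow]
        have h3 : 1 - ((d + 1 : ℝ) / d)⁻¹ = 1 / (d + 1) := by field_simp; ring
        rw [h3, div_le_iff₀ (by positivity)] at h1
        push_cast
        linarith
      have h3 := Real.exp_le_exp.2 h2
      rw [Real.exp_log (by positivity), div_pow, le_div_iff₀ (by positivity)] at h3
      exact h3
    rw [div_le_iff₀ (by positivity)] at ih ⊢
    push_cast [Nat.factorial_succ]
    rw [Real.exp_add]
    calc (d + 1) * (d.factorial : ℝ) * (Real.exp d * Real.exp 1) =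
        (d + 1) * Real.exp 1 * (d.factorial * Real.exp d) := by ring
      _ ≤ (d + 1) * Real.exp 1 * (Real.exp 1 * d * d ^ d) := by gcongr
      _ = (d + 1) * Real.exp 1 * (Real.exp 1 * d ^ (d + 1)) := by ring
      _ ≤ (d + 1) * Real.exp 1 * (d + 1) ^ (d + 1) := by gcongr
      _ = _ := by ring

section Blocks

variable {ι R κ : Type} [Fintype ι] [Fintype R] [Fintype κ]

/-- Vectors indexed by `ι`, cut into blocks. -/
def blockEquiv (e : R × κ ≃ ι) : (R → κ → ℂ) ≃L[ℝ] EuclideanSpace ℂ ι :=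
  ((LinearEquiv.curry ℝ ℂ R κ).symm ≪≫ₗ LinearEquiv.funCongrLeft ℝ ℂ e.symm ≪≫ₗ
    (WithLp.linearEquiv 2 ℝ (ι → ℂ)).symm).toContinuousLinearEquiv

theorem blockEquiv_apply (e : R × κ ≃ ι) (y : R → κ → ℂ) (r : R) (k : κ) :
    blockEquiv e y (e (r, k)) = y r k := by
  change y (e.symm (e (r, k))).1 (e.symm (e (r, k))).2 = y r k
  rw [e.symm_apply_apply]

theorem isAddHaarMeasure_volume_pi {X : Type} [MeasureSpace X] [AddGroup X] [TopologicalSpace X]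
    [MeasurableAdd X] [SigmaFinite (volume : Measure X)] [(volume : Measure X).IsAddHaarMeasure] :
    (volume : Measure (R → X)).IsAddHaarMeasure := inferInstance

instance isAddHaarMeasure_map_blockEquiv (e : R × κ ≃ ι) :
    ((volume : Measure (R → κ → ℂ)).map (blockEquiv e)).IsAddHaarMeasure := by
  have h₁ : (volume : Measure (κ → ℂ)).IsAddHaarMeasure := isAddHaarMeasure_volume_pi
  have h₂ : (volume : Measure (R → κ → ℂ)).IsAddHaarMeasure := isAddHaarMeasure_volume_pi
  exact ContinuousLinearEquiv.isAddHaarMeasure_map (blockEquiv e) volume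

/-- Under a Gaussian measure, disjoint blocks of coordinates are independent. -/
theorem integral_blocks (e : R × κ ≃ ι) (h : (κ → ℂ) → ℝ) :
    ∫ x, Real.exp (-‖x‖ ^ 2 - ∑ r, h fun k => x (e (r, k)))
        ∂(volume : Measure (R → κ → ℂ)).map (blockEquiv e) =
      (∫ y : κ → ℂ, Real.exp (-∑ k, ‖y k‖ ^ 2 - h y)) ^ Fintype.card R := by
  have h1 := (blockEquiv e).toHomeomorph.measurableEmbedding.integral_map
    (μ := (volume : Measure (R → κ → ℂ)))
    (fun x : EuclideanSpace ℂ ι => Real.exp (-‖x‖ ^ 2 - ∑ r, h fun k => x (e (r, k))))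
  refine h1.trans ?_
  rw [← integral_fintype_prod_volume_eq_pow]
  refine integral_congr_ae (Filter.Eventually.of_forall fun y => ?_)
  have h2 : ‖blockEquiv e y‖ ^ 2 = ∑ r, ∑ k, ‖y r k‖ ^ 2 := by
    rw [EuclideanSpace.norm_sq_eq, ← e.sum_comp, Fintype.sum_prod_type]
    simp only [blockEquiv_apply]
  have h3 : ∀ r, (fun k => blockEquiv e y (e (r, k))) = y r := fun r => by
    funext k
    exact blockEquiv_apply e y r k
  change Real.exp (-‖blockEquiv e y‖ ^ 2 - ∑ r, h fun k => blockEquiv e y (e (r, k))) = _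
  simp only [h3, h2]
  rw [← Real.exp_sum, Finset.sum_sub_distrib, Finset.sum_neg_distrib]

end Blocks

/-! ### Purities of Haar-random states -/

section Minors

variable {Q : Type} [Fintype Q] [DecidableEq Q]

/-- The labels that vanish at `q₁` and `q₀`. -/
abbrev Anchored (q₁ q₀ : Q) : Type := {a : Q → ZMod 2 // a q₁ = 0 ∧ a q₀ = 0}

/-- The square of labels spanned at a base point `a` by the restrictions of `b + 1` to the two sides
of the cut `v`. For fixed `b`, the squares over all anchored `a` partition the labels. -/
def squareEquiv {v : Q → ZMod 2} {q₁ q₀ : Q} (h₁ : v q₁ = 1) (h₀ : v q₀ = 0) (b : Anchored q₁ q₀) :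
    Anchored q₁ q₀ × (ZMod 2 × ZMod 2) ≃ (Q → ZMod 2) where
  toFun p q := p.1.1 q + v q * (b.1 q + 1) * p.2.1 + (1 + v q) * (b.1 q + 1) * p.2.2
  invFun z := (⟨fun q => z q + v q * (b.1 q + 1) * z q₁ + (1 + v q) * (b.1 q + 1) * z q₀, by
    simp only [h₁, h₀, b.2.1, b.2.2]
    generalize z q₁ = s
    generalize z q₀ = t
    revert s t
    decide⟩, (z q₁, z q₀))
  left_inv p := by
    obtain ⟨⟨a, ha₁, ha₀⟩, s, t⟩ := p
    have e₁ : a q₁ + v q₁ * (b.1 q₁ + 1) * s + (1 + v q₁) * (b.1 q₁ + 1) * t = s := by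
      rw [h₁, b.2.1, ha₁]
      revert s t
      decide
    have e₀ : a q₀ + v q₀ * (b.1 q₀ + 1) * s + (1 + v q₀) * (b.1 q₀ + 1) * t = t := by
      rw [h₀, b.2.2, ha₀]
      clear e₁
      revert s t
      decide
    refine Prod.ext (Subtype.ext (funext fun q => ?_)) (Prod.ext e₁ e₀)
    simp only [e₁, e₀]
    clear e₁ e₀
    generalize a q = a'
    generalize v q = v'
    generalize b.1 q = b'
    revert a' v' b' s t
    decide
  right_inv z := by
    funext q
    simp only
    generalize z q = a'
    generalize v q = v'
    generalize b.1 q = b'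
    generalize z q₁ = s
    generalize z q₀ = t
    revert a' v' b' s t
    decide

variable {v : Q → ZMod 2} {q₁ q₀ : Q} (h₁ : v q₁ = 1) (h₀ : v q₀ = 0) (b : Anchored q₁ q₀)

omit [Fintype Q] [DecidableEq Q] in
theorem squareEquiv_mix (a : Anchored q₁ q₀) (s t s' t' : ZMod 2) :
    mix v (squareEquiv h₁ h₀ b (a, (s, t))) (squareEquiv h₁ h₀ b (a, (s', t'))) =
      squareEquiv h₁ h₀ b (a, (s', t)) := by
  funext q
  simp only [mix, squareEquiv, Equiv.coe_fn_mk]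
  generalize a.1 q = a'
  generalize v q = v'
  generalize b.1 q = b'
  revert a' v' b' s t s' t'
  decide

/-- The squared modulus of a `2 × 2` determinant. -/
def minorSq (y : ZMod 2 × ZMod 2 → ℂ) : ℝ := ‖y (0, 0) * y (1, 1) - y (1, 0) * y (0, 1)‖ ^ 2

/-- The sum of the squared minors of `φ` over the squares in direction `b`. -/
def minorSum (φ : QSpace Q) : ℝ := ∑ a, minorSq fun k => φ (squareEquiv h₁ h₀ b (a, k))

/-- Different squares have different main diagonals, so each minor is counted at most once. -/
theorem sum_minorSum_le {φ : QSpace Q} (hφ : ‖φ‖ = 1) :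
    ∑ b, minorSum h₁ h₀ b φ ≤ 2 * (1 - purity φ v) := by
  rw [two_mul_one_sub_purity hφ]
  have hinj : Function.Injective fun p : Anchored q₁ q₀ × Anchored q₁ q₀ =>
      (squareEquiv h₁ h₀ p.1 (p.2, (0, 0)), squareEquiv h₁ h₀ p.1 (p.2, (1, 1))) := by
    rintro ⟨b, a⟩ ⟨b', a'⟩ h
    have ha : a = a' := Subtype.ext (funext fun q => by
      simpa [squareEquiv] using congrFun (congrArg Prod.fst h) q)
    subst ha
    refine Prod.ext (Subtype.ext (funext fun q => ?_)) rfl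
    have h2 := congrFun (congrArg Prod.snd h) q
    simp only [squareEquiv, Equiv.coe_fn_mk] at h2
    revert h2
    simp only
    generalize a.1 q = a'
    generalize v q = v'
    generalize b.1 q = b₁
    generalize b'.1 q = b₂
    revert a' v' b₁ b₂
    decide
  have h := Finset.sum_le_sum_of_subset_of_nonneg
    (Finset.subset_univ (Finset.univ.map ⟨_, hinj⟩))
    (f := fun p : (Q → ZMod 2) × (Q → ZMod 2) =>
      ‖φ p.1 * φ p.2 - φ (mix v p.1 p.2) * φ (mix v p.2 p.1)‖ ^ 2)
    (fun _ _ _ => by positivity)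
  refine le_trans (le_of_eq ?_) h
  rw [Finset.sum_map, Fintype.sum_prod_type]
  refine Finset.sum_congr rfl fun b _ => Finset.sum_congr rfl fun a _ => ?_
  simp only [Function.Embedding.coeFn_mk, squareEquiv_mix]
  rfl

theorem card_labels (h₁ : v q₁ = 1) (h₀ : v q₀ = 0) :
    Fintype.card (Q → ZMod 2) = 4 * Fintype.card (Anchored q₁ q₀) := by
  have b : Anchored q₁ q₀ := ⟨0, rfl, rfl⟩
  rw [← Fintype.card_congr (squareEquiv h₁ h₀ b), Fintype.card_prod, Fintype.card_prod, ZMod.card]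
  ring

end Minors

/-- The Laplace transform of the squared determinant of a Gaussian `2 × 2` matrix. -/
def minorLaplace (c : ℝ) : ℝ :=
  ∫ y : ZMod 2 × ZMod 2 → ℂ, Real.exp (-∑ k, ‖y k‖ ^ 2 - c * minorSq y)

theorem integrable_minorLaplace {c : ℝ} (hc : 0 ≤ c) :
    Integrable fun y : ZMod 2 × ZMod 2 → ℂ => Real.exp (-∑ k, ‖y k‖ ^ 2 - c * minorSq y) := by
  have hdim : Module.finrank ℝ ℂ = 2 * 1 := by simp
  have h := Integrable.fintype_prod (ι := ZMod 2 × ZMod 2) (𝕜 := ℝ)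
    (fun _ => integrable_gaussian (volume : Measure ℂ) hdim)
  refine h.mono ?_ (Filter.Eventually.of_forall fun y => ?_)
  · unfold minorSq
    fun_prop
  · simp only [← Real.exp_sum, Finset.sum_neg_distrib]
    rw [Real.norm_of_nonneg (Real.exp_pos _).le, Real.norm_of_nonneg (Real.exp_pos _).le]
    have : 0 ≤ minorSq y := by unfold minorSq; positivity
    exact Real.exp_le_exp.2 (by nlinarith)

theorem minorLaplace_one_lt : minorLaplace 1 < minorLaplace 0 := by
  have h := integral_pos_iff_support_of_nonneg (μ := (volume : Measure (ZMod 2 × ZMod 2 → ℂ)))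
    (f := fun y => Real.exp (-∑ k, ‖y k‖ ^ 2 - 0 * minorSq y) -
      Real.exp (-∑ k, ‖y k‖ ^ 2 - 1 * minorSq y)) ?_
      ((integrable_minorLaplace le_rfl).sub (integrable_minorLaplace zero_le_one))
  · rw [integral_sub (integrable_minorLaplace le_rfl) (integrable_minorLaplace zero_le_one)] at h
    refine sub_pos.1 (h.2 ?_)
    refine IsOpen.measure_pos _ ?_ ⟨fun k => if k.1 = k.2 then 1 else 0, ?_⟩
    · refine Continuous.isOpen_support ?_
      unfold minorSq
      fun_prop
    · rw [Function.mem_support, sub_ne_zero]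
      intro h
      have := Real.exp_injective h
      simp only [minorSq] at this
      norm_num at this
      linarith
  · intro y
    refine sub_nonneg.2 (Real.exp_le_exp.2 ?_)
    have : 0 ≤ minorSq y := by unfold minorSq; positivity
    linarith

theorem minorLaplace_nonneg (c : ℝ) : 0 ≤ minorLaplace c :=
  integral_nonneg fun _ => (Real.exp_pos _).le

section Haar

variable {Q : Type} [Fintype Q] [DecidableEq Q] {v : Q → ZMod 2} {q₁ q₀ : Q}

theorem continuous_minorSum (h₁ : v q₁ = 1) (h₀ : v q₀ = 0) (b : Anchored q₁ q₀) :
    Continuous (minorSum h₁ h₀ b) := by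
  unfold minorSum minorSq
  fun_prop

theorem minorSum_nonneg (h₁ : v q₁ = 1) (h₀ : v q₀ = 0) (b : Anchored q₁ q₀) (φ : QSpace Q) :
    0 ≤ minorSum h₁ h₀ b φ := by
  unfold minorSum minorSq
  positivity

theorem minorSum_smul (h₁ : v q₁ = 1) (h₀ : v q₀ = 0) (b : Anchored q₁ q₀) (r : ℝ) (φ : QSpace Q) :
    minorSum h₁ h₀ b (r • φ) = r ^ 4 * minorSum h₁ h₀ b φ := by
  have h : ∀ w x y z : ℂ, ‖(r * w) * (r * x) - (r * y) * (r * z)‖ ^ 2 =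
      r ^ 4 * ‖w * x - y * z‖ ^ 2 := by
    intro w x y z
    have : (r * w) * (r * x) - (r * y) * (r * z) = ((r ^ 2 : ℝ) : ℂ) * (w * x - y * z) := by
      push_cast
      ring
    rw [this, norm_mul, Complex.norm_real, Real.norm_of_nonneg (by positivity)]
    ring
  rw [minorSum, minorSum, Finset.mul_sum]
  refine Finset.sum_congr rfl fun a _ => ?_
  simp only [minorSq, PiLp.smul_apply, Complex.real_smul]
  exact h _ _ _ _

theorem integral_minorSum (h₁ : v q₁ = 1) (h₀ : v q₀ = 0) (b : Anchored q₁ q₀) (c : ℝ) :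
    ∫ x, Real.exp (-‖x‖ ^ 2 - c * minorSum h₁ h₀ b x)
        ∂(volume : Measure (Anchored q₁ q₀ → ZMod 2 × ZMod 2 → ℂ)).map
          (blockEquiv (squareEquiv h₁ h₀ b)) =
      minorLaplace c ^ Fintype.card (Anchored q₁ q₀) := by
  rw [minorLaplace, ← integral_blocks (squareEquiv h₁ h₀ b)]
  simp only [minorSum, Finset.mul_sum]

/-- For one direction `b` the squares partition the amplitudes, so under the Gaussian measure the
Laplace transform of the sum of minors is a power of the one of a single minor. -/
theorem haarState_minorSum_le (h₁ : v q₁ = 1) (h₀ : v q₀ = 0) (b : Anchored q₁ q₀) (κ : ℝ) {d : ℕ}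
    (hd : Fintype.card (Q → ZMod 2) = d) :
    haarState Q {φ | minorSum h₁ h₀ b φ.1 ≤ κ / d} ≤
      ENNReal.ofReal (d.factorial * Real.exp d / d ^ d * Real.exp (κ * d) *
        (minorLaplace 1 / minorLaplace 0) ^ Fintype.card (Anchored q₁ q₀)) := by
  have hd0 : 0 < d := hd ▸ Fintype.card_pos
  have hdim : Module.finrank ℝ (QSpace Q) = 2 * d := by
    rw [finrank_real_of_complex, finrank_euclideanSpace, hd]
  have h := sphere_small_le
    ((volume : Measure (Anchored q₁ q₀ → ZMod 2 × ZMod 2 → ℂ)).map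
      (blockEquiv (squareEquiv h₁ h₀ b)))
    (Measure.addHaar : Measure (QSpace Q)) hd0 hdim (continuous_minorSum h₁ h₀ b)
    (minorSum_nonneg h₁ h₀ b) (minorSum_smul h₁ h₀ b) κ
  have e₁ := integral_minorSum h₁ h₀ b 1
  have e₀ := integral_minorSum h₁ h₀ b 0
  simp only [one_mul] at e₁
  simp only [zero_mul, sub_zero] at e₀
  rw [e₁, e₀, ← div_pow] at h
  exact h

/-- If the purity is close to one, then for some direction the sum of minors is below its average, to
which the small ball estimate applies. Here `m` is the number of directions as well as the number of
squares in each. -/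
theorem haarState_purity_le (h₁ : v q₁ = 1) (h₀ : v q₀ = 0) (κ : ℝ) {m : ℕ}
    (hm : Fintype.card (Q → ZMod 2) = 4 * m) :
    haarState Q {φ | 1 - κ / 8 < purity φ.1 v} ≤
      ENNReal.ofReal (4 * Real.exp 1 * m ^ 2 *
        (Real.exp (4 * κ) * (minorLaplace 1 / minorLaplace 0)) ^ m) := by
  have hcard : Fintype.card (Anchored q₁ q₀) = m := by
    have := card_labels h₁ h₀
    omega
  have hm0 : 0 < m := by
    have : 0 < Fintype.card (Q → ZMod 2) := Fintype.card_pos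
    omega
  have hm0' : (0 : ℝ) < m := by exact_mod_cast hm0
  have hsub : {φ : Metric.sphere (0 : QSpace Q) 1 | 1 - κ / 8 < purity φ.1 v} ⊆
      ⋃ b, {φ | minorSum h₁ h₀ b φ.1 ≤ κ / (4 * m : ℕ)} := by
    intro φ hφ
    rw [Set.mem_iUnion]
    by_contra hcon
    push Not at hcon
    have hn : ‖φ.1‖ = 1 := by simp
    have h1 := sum_minorSum_le h₁ h₀ hn
    have h2 : ∑ _b : Anchored q₁ q₀, κ / (4 * m : ℕ) ≤ ∑ b, minorSum h₁ h₀ b φ.1 :=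
      Finset.sum_le_sum fun b _ => (not_le.1 (hcon b)).le
    rw [Finset.sum_const, Finset.card_univ, hcard, nsmul_eq_mul] at h2
    push_cast at h2
    have h3 : (m : ℝ) * (κ / (4 * m)) = κ / 4 := by field_simp
    have hφ' : 1 - κ / 8 < purity φ.1 v := hφ
    linarith
  have hρ : 0 ≤ minorLaplace 1 / minorLaplace 0 :=
    div_nonneg (minorLaplace_nonneg _) (minorLaplace_nonneg _)
  refine (measure_mono hsub).trans ((measure_iUnion_fintype_le _ _).trans ?_)
  refine (Finset.sum_le_sum fun b _ => haarState_minorSum_le h₁ h₀ b κ hm).trans ?_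
  rw [Finset.sum_const, Finset.card_univ, hcard, ← ENNReal.ofReal_nsmul]
  refine ENNReal.ofReal_le_ofReal ?_
  rw [nsmul_eq_mul]
  have h4 := factorial_mul_exp_le (d := 4 * m) (by omega)
  calc _ ≤ (m : ℝ) * (Real.exp 1 * (4 * m : ℕ) * Real.exp (κ * (4 * m : ℕ)) *
        (minorLaplace 1 / minorLaplace 0) ^ m) := by gcongr
    _ = _ := by
      rw [mul_pow, ← Real.exp_nat_mul]
      push_cast
      rw [show κ * (4 * m) = m * (4 * κ) by ring]
      ring

/-- All reduced states of a Haar-random state have purity bounded away from one, up to an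
exponentially small probability. -/
theorem exists_haarState_purity_le : ∃ c K : ℝ, 0 < c ∧ c ≤ 1 ∧ 0 ≤ K ∧
    ∀ (Q : Type) [Fintype Q] [DecidableEq Q],
      haarState Q {φ | ∃ v : Q → ZMod 2, (∃ i j, v i ≠ v j) ∧ 1 - c < purity φ.1 v} ≤
        ENNReal.ofReal (K / 2 ^ Fintype.card Q) := by
  have hlt := minorLaplace_one_lt
  have hnn := minorLaplace_nonneg 1
  set ρ := minorLaplace 1 / minorLaplace 0 with hρ
  have hρ0 : 0 ≤ ρ := div_nonneg hnn (minorLaplace_nonneg _)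
  have hρ1 : ρ < 1 := (div_lt_one (hnn.trans_lt hlt)).2 hlt
  -- `κ > 0` is so small that `exp (4 κ) ρ < 1`
  set κ := Real.log (2 / (1 + ρ)) / 4 with hκ
  have h2 : 1 < 2 / (1 + ρ) := by rw [lt_div_iff₀ (by linarith)]; linarith
  have hκ0 : 0 < κ := div_pos (Real.log_pos h2) (by norm_num)
  have hκ8 : κ / 8 ≤ 1 := by
    have h3 : Real.log (2 / (1 + ρ)) ≤ 2 / (1 + ρ) - 1 := Real.log_le_sub_one_of_pos (by linarith)
    have h4 : 2 / (1 + ρ) ≤ 2 := by rw [div_le_iff₀ (by linarith)]; linarith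
    rw [hκ]
    linarith
  set σ := Real.exp (4 * κ) * ρ with hσ
  have hσ' : σ = 2 / (1 + ρ) * ρ := by
    rw [hσ, hκ, show 4 * (Real.log (2 / (1 + ρ)) / 4) = Real.log (2 / (1 + ρ)) by ring,
      Real.exp_log (by linarith)]
  have hσ0 : 0 ≤ σ := by positivity
  have hσ1 : σ < 1 := by
    rw [hσ', div_mul_eq_mul_div, div_lt_one (by linarith)]
    linarith
  -- the factors `m ^ 4` are `m ^ 2` from `haarState_purity_le`, `4 m` cuts and the target
  -- `2 ^ card Q = 4 m`
  obtain ⟨B, hB⟩ := (tendsto_pow_const_mul_const_pow_of_abs_lt_one 4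
    (abs_lt.2 ⟨by linarith, hσ1⟩)).bddAbove_range
  have hB' : ∀ m : ℕ, (m : ℝ) ^ 4 * σ ^ m ≤ B := fun m => hB ⟨m, rfl⟩
  have hB0 : 0 ≤ B := le_trans (by positivity) (hB' 0)
  refine ⟨κ / 8, 64 * Real.exp 1 * B, by positivity, hκ8, by positivity, fun Q _ _ => ?_⟩
  by_cases hQ : ∃ v : Q → ZMod 2, ∃ i j, v i ≠ v j
  · obtain ⟨m, hm⟩ : ∃ m, Fintype.card (Q → ZMod 2) = 4 * m := by
      obtain ⟨v, i, j, hv⟩ := hQ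
      rcases zmod_two_eq_zero_or_one (v i) with hi | hi <;>
        rcases zmod_two_eq_zero_or_one (v j) with hj | hj
      · exact absurd (hi.trans hj.symm) hv
      · exact ⟨_, card_labels hj hi⟩
      · exact ⟨_, card_labels hi hj⟩
      · exact absurd (hi.trans hj.symm) hv
    have hm0 : 0 < m := by
      have : 0 < Fintype.card (Q → ZMod 2) := Fintype.card_pos
      omega
    have hm0' : (0 : ℝ) < m := by exact_mod_cast hm0
    have hpow : (2 : ℝ) ^ Fintype.card Q = 4 * m := by
      have : Fintype.card (Q → ZMod 2) = 2 ^ Fintype.card Q := by simp [ZMod.card]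
      exact_mod_cast this.symm.trans hm
    have hsub : {φ : Metric.sphere (0 : QSpace Q) 1 |
        ∃ v : Q → ZMod 2, (∃ i j, v i ≠ v j) ∧ 1 - κ / 8 < purity φ.1 v} ⊆
        ⋃ v : Q → ZMod 2, {φ | (∃ i j, v i ≠ v j) ∧ 1 - κ / 8 < purity φ.1 v} := by
      intro φ hφ
      exact Set.mem_iUnion.2 hφ
    have hone : ∀ v : Q → ZMod 2,
        haarState Q {φ | (∃ i j, v i ≠ v j) ∧ 1 - κ / 8 < purity φ.1 v} ≤
          ENNReal.ofReal (4 * Real.exp 1 * m ^ 2 * σ ^ m) := by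
      intro v
      by_cases hv : ∃ i j, v i ≠ v j
      · simp only [hv, true_and]
        obtain ⟨i, j, hv⟩ := hv
        rcases zmod_two_eq_zero_or_one (v i) with hi | hi <;>
          rcases zmod_two_eq_zero_or_one (v j) with hj | hj
        · exact absurd (hi.trans hj.symm) hv
        · exact haarState_purity_le hj hi κ hm
        · exact haarState_purity_le hi hj κ hm
        · exact absurd (hi.trans hj.symm) hv
      · simp [hv]
    refine (measure_mono hsub).trans ((measure_iUnion_fintype_le _ _).trans ?_)
    refine (Finset.sum_le_sum fun v _ => hone v).trans ?_
    rw [Finset.sum_const, Finset.card_univ, hm, ← ENNReal.ofReal_nsmul]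
    refine ENNReal.ofReal_le_ofReal ?_
    rw [nsmul_eq_mul, hpow, le_div_iff₀ (by positivity)]
    push_cast
    calc (4 * m * (4 * Real.exp 1 * m ^ 2 * σ ^ m) * (4 * m) : ℝ) =
        64 * Real.exp 1 * (m ^ 4 * σ ^ m) := by ring
      _ ≤ _ := by gcongr; exact hB' m
  · have : {φ : Metric.sphere (0 : QSpace Q) 1 |
        ∃ v : Q → ZMod 2, (∃ i j, v i ≠ v j) ∧ 1 - κ / 8 < purity φ.1 v} = ∅ := by
      ext φ
      simp only [Set.mem_ofPred_eq, Set.mem_empty_iff_false, iff_false]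
      rintro ⟨v, hv, -⟩
      exact hQ ⟨v, hv⟩
    rw [this, measure_empty]
    exact zero_le

end Haar

/-! ### The non-adaptive algorithm -/

/-- The non-adaptive algorithm. -/
def nonadaptiveAlgorithm : HybridAlgorithm where
  ancillas _ _ := 0
  circuit n s _ := nonadaptiveCircuit n s 0
  output _ _ ys := cutLabels (orth ys)
  circuitProgram := nonadaptiveProgram
  outputProgram := HiddenCut.outputProgram

theorem isNonadaptive_nonadaptiveAlgorithm : nonadaptiveAlgorithm.IsNonadaptive :=
  fun _ _ _ => ⟨rfl, implementsFourier_nonadaptiveCircuit, rfl⟩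

theorem hadamardAll_zeroState (n : ℕ) : hadamardAll (zeroState n) = subspaceState ⊤ := by
  funext y
  have h : Nat.card (⊤ : Submodule (ZMod 2) (Bits n)) = 2 ^ n := by
    rw [Nat.card_congr (Submodule.topEquiv (R := ZMod 2) (M := Bits n)).toEquiv]
    simp [Nat.card_eq_fintype_card, ZMod.card]
  rw [hadamardAll, Finset.sum_eq_single 0]
  · rw [subspaceState, if_pos Submodule.mem_top, h]
    simp [zeroState, sign]
  · intro x _ hx
    simp [zeroState, hx]
  · simp

theorem exists_runsInTime_nonadaptiveAlgorithm : ∃ K : ℕ, ∀ {n s M : ℕ} (ys : List (Bits n)),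
    n + ys.length + 3 * s + 10 ≤ M →
      ∃ T, nonadaptiveAlgorithm.RunsInTime n s ys T ∧ T ≤ 2 * K * M ^ (K + 1) := by
  obtain ⟨K₁, h₁⟩ := nonadaptiveProgram.bound_polynomial
  obtain ⟨K₂, h₂⟩ := HiddenCut.outputProgram.bound_polynomial
  refine ⟨K₁ + K₂ + 3, fun ys hM => exists_runsInTime ?_ ?_ ?_ ys hM⟩
  · intro n s M ys hM
    obtain ⟨T, hT, hle⟩ := outputs_nonadaptiveProgram s 0 ys hM
    exact ⟨T, hT, polynomial_mono (by omega) (by omega) (hle.trans (h₁ M (by omega)))⟩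
  · intro n s M ys hM
    obtain ⟨T, hT, hle⟩ := outputs_outputProgram s ys hM
    exact ⟨T, hT, polynomial_mono (by omega) (by omega) (hle.trans (h₂ M (by omega)))⟩
  · intro n s M ys hM
    refine polynomial_mono (K := 3) (by omega) (by omega) ?_
    refine (Circuit.size_le nonadaptiveCircuit_valid).trans ?_
    rw [depth_nonadaptiveCircuit, card_qubit]
    have h1 : s + 2 ≤ M := by omega
    have h2 : n + (2 * s * n + 0) ≤ 3 * M ^ 2 := by
      have : 2 * s * n ≤ M * M := Nat.mul_le_mul (by omega) (by omega)
      nlinarith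
    calc _ ≤ M * (3 * M ^ 2) := Nat.mul_le_mul h1 h2
      _ = 3 * M ^ 3 := by ring

/-- The failure probability when the purities of all factors across all cuts are at most `1 - c`. -/
theorem one_sub_successProb_nonadaptive_le {n : ℕ} {c : ℝ} (hc1 : c ≤ 1)
    (P : Finpartition (Finset.univ : Finset (Fin n)))
    (φ : (C : {C // C ∈ P.parts}) → QSpace (PartQubits P C)) (hφ : ∀ C, ‖φ C‖ = 1)
    (h : ∀ C, ∀ v : PartQubits P C → ZMod 2, (∃ i j, v i ≠ v j) → purity (φ C) v ≤ 1 - c) (r : ℕ) :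
    1 - nonadaptiveAlgorithm.successProb r 1 (productState P φ) P ≤ (1 - c / 2) ^ r * 2 ^ n := by
  refine one_sub_successProb_le nonadaptiveAlgorithm (norm_productState P hφ) P
    (V := fun _ => ⊤) (fun _ => le_top) (fun ys => ?_) (fun _ => rfl)
    (swapOverlap_productState_eq P φ) (fun v hv => partsPurity_eq_one P hφ hv)
    (by linarith) (fun v hv => ?_) r
  · rw [← hadamardAll_zeroState]
    exact implementsFourier_nonadaptiveCircuit
  · rw [pow_one]
    linarith [partsPurity_le P hφ h hv]

instance isProbabilityMeasure_haarState (Q : Type) [Fintype Q] [DecidableEq Q] :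
    IsProbabilityMeasure (haarState Q) := by
  refine ⟨?_⟩
  rw [haarState, Measure.smul_apply, smul_eq_mul]
  refine ENNReal.inv_mul_cancel ?_ (measure_ne_top _ _)
  rw [Ne, Measure.measure_univ_eq_zero]
  exact Measure.toSphere_ne_zero _

/-- The probability that some factor is bad, for arbitrary sets of bad states. -/
theorem haarFactors_exists_mem_le {n : ℕ} (P : Finpartition (Finset.univ : Finset (Fin n)))
    (B : (C : {C // C ∈ P.parts}) → Set (Metric.sphere (0 : QSpace (PartQubits P C)) 1))
    {p : ENNReal} (hB : ∀ C, haarState (PartQubits P C) (B C) ≤ p) :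
    haarFactors P {φ | ∃ C, φ C ∈ B C} ≤ n * p := by
  have hsub : {φ | ∃ C, φ C ∈ B C} ⊆
      ⋃ C, (Function.eval C) ⁻¹' toMeasurable (haarState (PartQubits P C)) (B C) := by
    rintro φ ⟨C, hC⟩
    exact Set.mem_iUnion.2 ⟨C, subset_toMeasurable _ _ hC⟩
  refine (measure_mono hsub).trans ((measure_iUnion_fintype_le _ _).trans ?_)
  have h1 : ∀ C : {C // C ∈ P.parts}, haarFactors P
      ((Function.eval C) ⁻¹' toMeasurable (haarState (PartQubits P C)) (B C)) ≤ p := by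
    intro C
    rw [haarFactors, (measurePreserving_eval _ C).measure_preimage
      (measurableSet_toMeasurable _ _).nullMeasurableSet, measure_toMeasurable]
    exact hB C
  refine (Finset.sum_le_card_nsmul _ _ p fun C _ => h1 C).trans ?_
  rw [nsmul_eq_mul]
  gcongr
  have h2 := P.card_parts_le_card
  simpa using h2

/-- Sizes that dominate the logarithm make the exponential of the size dominate the square. -/
theorem eventually_sq_le_two_pow {f : ℕ → ℕ}
    (hf : (fun n : ℕ => Real.log n) =o[Filter.atTop] (fun n : ℕ => (f n : ℝ))) :
    ∀ᶠ n : ℕ in Filter.atTop, (n : ℝ) ^ 2 ≤ 2 ^ f n := by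
  have hl2 : 0 < Real.log 2 := Real.log_pos (by norm_num)
  filter_upwards [hf.def (half_pos hl2), Filter.eventually_ge_atTop 1] with n hn hn1
  have hn0 : (0 : ℝ) < n := by exact_mod_cast hn1
  rw [Real.norm_of_nonneg (Real.log_nonneg (by exact_mod_cast hn1)),
    Real.norm_of_nonneg (Nat.cast_nonneg _)] at hn
  rw [← Real.log_le_log_iff (by positivity) (by positivity), Real.log_pow, Real.log_pow]
  push_cast
  linarith

/-- The guarantees for the non-adaptive algorithm. The factor on a part `C` has
some cut with purity close to one with probability `O(1 / 2 ^ |C|)`, hence `O(1 / n ^ 2)`, and there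
are at most `n` parts. -/
theorem nonadaptive_complexity : ∃ (A : HybridAlgorithm) (c K : ℕ), A.IsNonadaptive ∧
      (∀ n : ℕ, 1 ≤ n →
        c * n * 2 ≤ K * n ∧
        (∀ ys : List (Bits n), (A.circuit n 1 ys).depth ≤ K) ∧
        (∀ ys : List (Bits n), ys.length = c * n →
          ∃ T : ℕ, A.RunsInTime n 1 ys T ∧ T ≤ K * n ^ K)) ∧
      ∀ f : ℕ → ℕ, (fun n : ℕ => Real.log n) =o[Filter.atTop] (fun n : ℕ => (f n : ℝ)) →
        ∀ δ : ℝ, 0 < δ → ∀ᶠ n : ℕ in Filter.atTop,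
          ∀ P : Finpartition (Finset.univ : Finset (Fin n)), (∀ C ∈ P.parts, f n ≤ C.card) →
            haarFactors P {φ | A.successProb (c * n) 1
              (productState P fun C => (φ C).1) P < 1 - δ} ≤ ENNReal.ofReal δ := by
  obtain ⟨K₁, hK₁⟩ := exists_runsInTime_nonadaptiveAlgorithm
  obtain ⟨η, K₂, hη0, hη1, hK₂, hhaar⟩ := exists_haarState_purity_le
  -- so many rounds per qubit that the union bound over `2 ^ n` cuts leaves `2 ^ (-n)`
  obtain ⟨c, hc⟩ := exists_pow_lt_of_lt_one (x := (1 / 4 : ℝ)) (y := 1 - η / 2) (by norm_num)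
    (by linarith)
  refine ⟨nonadaptiveAlgorithm, c, 2 * K₁ * (c + 14) ^ (K₁ + 1) + K₁ + 2 * c + 3,
    isNonadaptive_nonadaptiveAlgorithm, fun n hn => ⟨?_, fun ys => ?_, fun ys hys => ?_⟩, ?_⟩
  · rw [mul_right_comm, mul_comm c 2]
    exact Nat.mul_le_mul_right _ (by omega)
  · refine (depth_nonadaptiveCircuit n 1 0).le.trans (by omega)
  · obtain ⟨T, hT, hle⟩ := hK₁ (M := n + ys.length + 3 * 1 + 10) ys le_rfl
    refine ⟨T, hT, hle.trans ?_⟩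
    have hM : n + ys.length + 3 * 1 + 10 ≤ (c + 14) * n := by
      rw [hys]
      nlinarith
    calc _ ≤ 2 * K₁ * ((c + 14) * n) ^ (K₁ + 1) := by gcongr
      _ = (2 * K₁ * (c + 14) ^ (K₁ + 1)) * n ^ (K₁ + 1) := by rw [mul_pow]; ring
      _ ≤ _ := Nat.mul_le_mul (by omega) (Nat.pow_le_pow_right hn (by omega))
  · intro f hf δ hδ
    have hhalf : ∀ᶠ n : ℕ in Filter.atTop, (1 / 2 : ℝ) ^ n < δ :=
      (tendsto_pow_atTop_nhds_zero_of_lt_one (by norm_num) (by norm_num)).eventually_lt_const hδ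
    have hdiv : ∀ᶠ n : ℕ in Filter.atTop, K₂ / (n : ℝ) < δ :=
      (tendsto_const_div_atTop_nhds_zero_nat K₂).eventually_lt_const hδ
    filter_upwards [eventually_sq_le_two_pow hf, hhalf, hdiv, Filter.eventually_ge_atTop 1]
      with n hn hhalf hdiv hn1 P hP
    have hn0 : (0 : ℝ) < n := by exact_mod_cast hn1
    have hsub : {φ : (C : {C // C ∈ P.parts}) → Metric.sphere (0 : QSpace (PartQubits P C)) 1 |
        nonadaptiveAlgorithm.successProb (c * n) 1 (productState P fun C => (φ C).1) P < 1 - δ} ⊆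
        {φ | ∃ C, φ C ∈ {χ : Metric.sphere (0 : QSpace (PartQubits P C)) 1 |
          ∃ v : PartQubits P C → ZMod 2, (∃ i j, v i ≠ v j) ∧ 1 - η < purity χ.1 v}} := by
      intro φ hφ
      by_contra hcon
      simp only [Set.mem_ofPred_eq, not_exists, not_and, not_lt] at hcon
      have h1 := one_sub_successProb_nonadaptive_le hη1 P (fun C => (φ C).1)
        (fun C => by simp) (fun C v hv => hcon C v hv) (c * n)
      have h2 : (1 - η / 2) ^ (c * n) * 2 ^ n ≤ (1 / 2 : ℝ) ^ n := by
        rw [pow_mul, ← mul_pow]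
        refine pow_le_pow_left₀ (mul_nonneg (pow_nonneg (by linarith) _) (by norm_num)) ?_ n
        linarith
      have h3 : nonadaptiveAlgorithm.successProb (c * n) 1
        (productState P fun C => (φ C).1) P < 1 - δ := hφ
      linarith
    refine (measure_mono hsub).trans
      ((haarFactors_exists_mem_le P _ (p := ENNReal.ofReal (K₂ / n ^ 2)) fun C => ?_).trans ?_)
    · refine (hhaar _).trans (ENNReal.ofReal_le_ofReal ?_)
      have hcard : Fintype.card (PartQubits P C) = C.1.card := Fintype.card_coe _
      rw [hcard]
      have h4 : (2 : ℝ) ^ f n ≤ 2 ^ C.1.card := pow_le_pow_right₀ (by norm_num) (hP C.1 C.2)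
      exact div_le_div_of_nonneg_left hK₂ (by positivity) (hn.trans h4)
    · rw [← ENNReal.ofReal_natCast, ← ENNReal.ofReal_mul hn0.le]
      refine ENNReal.ofReal_le_ofReal ?_
      have h5 : (n : ℝ) * (K₂ / n ^ 2) = K₂ / n := by field_simp
      rw [h5]
      exact hdiv.le

end HiddenCut

end

theorem corollary1 :
    -- (a) adaptive algorithm: `c * n` rounds, each on `2 * ⌈c / ε ^ 2⌉` copies
    (∃ (A : HybridAlgorithm) (c K : ℕ), A.IsAdaptive ∧
      ∀ (n s : ℕ) (ε : ℝ), 1 ≤ n → 0 < ε → ε ≤ 1 → s = ⌈(c : ℝ) / ε ^ 2⌉₊ →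
        -- copies used coherently at a time, and in total
        ((2 * s : ℕ) : ℝ) ≤ K * (1 / ε ^ 2) ∧
        ((c * n * (2 * s) : ℕ) : ℝ) ≤ K * (n / ε ^ 2) ∧
        -- circuit depth
        (∀ ys : List (Bits n),
          ((A.circuit n s ys).depth : ℝ) ≤ K * ((n : ℝ) ^ 2 + Real.log (1 / ε))) ∧
        -- polynomial running time, whatever the outcomes
        (∀ ys : List (Bits n), ys.length = c * n →
          ∃ T : ℕ, A.RunsInTime n s ys T ∧ (T : ℝ) ≤ K * (n / ε) ^ K) ∧
        -- success with constant probability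
        (∀ (P : Finpartition (Finset.univ : Finset (Fin n)))
          (φ : (C : {C // C ∈ P.parts}) → QSpace (PartQubits P C)),
          (∀ C, ‖φ C‖ = 1) → (∀ C, FarFromSeparable ε (φ C)) →
          2 / 3 ≤ A.successProb (c * n) s (productState P φ) P)) ∧
    -- (b) non-adaptive algorithm: `c * n` rounds, each on two copies
    (∃ (A : HybridAlgorithm) (c K : ℕ), A.IsNonadaptive ∧
      (∀ n : ℕ, 1 ≤ n →
        -- copies used in total
        c * n * 2 ≤ K * n ∧
        -- circuit depth
        (∀ ys : List (Bits n), (A.circuit n 1 ys).depth ≤ K) ∧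
        -- polynomial running time, whatever the outcomes
        (∀ ys : List (Bits n), ys.length = c * n →
          ∃ T : ℕ, A.RunsInTime n 1 ys T ∧ T ≤ K * n ^ K)) ∧
      -- success with high probability, uniformly over all partitions into parts of
      -- superlogarithmic size
      ∀ f : ℕ → ℕ, (fun n : ℕ => Real.log n) =o[Filter.atTop] (fun n : ℕ => (f n : ℝ)) →
        ∀ δ : ℝ, 0 < δ → ∀ᶠ n : ℕ in Filter.atTop,
          ∀ P : Finpartition (Finset.univ : Finset (Fin n)), (∀ C ∈ P.parts, f n ≤ C.card) →
            haarFactors P {φ | A.successProb (c * n) 1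
              (productState P fun C => (φ C).1) P < 1 - δ} ≤ ENNReal.ofReal δ) :=
  ⟨adaptive_complexity, nonadaptive_complexity⟩
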